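/- Let $\Gamma$ be a divisible totally ordered abelian group, written multiplicatively, and let $k$ be a field with a non-archimedean absolute value $|\cdot|:k\to\Gamma\cup\{0\}$. Assume that $k$ is henselian: on every finite extension of $k$ there is exactly one absolute value with values in $\Gamma\cup\{0\}$ extending that of $k$. Every algebraic extension of $k$ carries the resulting absolute value, and every finite product $E=\prod_i L_i$ of finite extensions of $k$ carries the norm $\|(x_i)\|=\max_i|x_i|$. For such a field or algebra $A$, put $\widetilde A=\bigoplus_{r\in\Gamma}A_{\le r}/A_{<r}$, where $A_{\le r}=\{a:\|a\|\le r\}$ and $A_{<r}=\{a:\|a\|<r\}$. It is a $\Gamma$-graded algebra over the graded ring $\widetilde k$, in which every nonzero homogeneous element is invertible. Morphisms of graded algebras preserve degrees, and tensor products of graded algebras carry the product grading. A graded $\widetilde k$-algebra $B$ is *étale* if it is finite over $\widetilde k$ and $\Omega_{B/\widetilde k}=0$. Let $k^s$ be a separable closure of $k$. For a finite Galois extension $L/k$ let $I_{\rm grad}(L/k)$ be the kernel of the action of $\mathrm{Gal}(L/k)$ on $\widetilde L$; put $I_{\rm grad}(k^s/k)=\varprojlim_L I_{\rm grad}(L/k)\subset\mathrm{Gal}(k^s/k)$,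 with $L$ running through the finite Galois subextensions of $k^s$, and let $M$ be the subfield of $k^s$ fixed by $I_{\rm grad}(k^s/k)$ (the maximal tamely ramified extension). An étale $k$-algebra $E$ is *tamely ramified* if $M\otimes_kE$ is isomorphic, as an $M$-algebra, to a finite product of copies of $M$. 1. Every étale graded $\widetilde k$-algebra $B$ is split by $\widetilde M$: the graded $\widetilde M$-algebra $\widetilde M\otimes_{\widetilde k}B$ is isomorphic to a finite product of copies of $\widetilde M$. 2. If $E$ is a tamely ramified étale $k$-algebra, then $\widetilde E$ is an étale graded $\widetilde k$-algebra, and $E\mapsto\widetilde E$ is an equivalence from the category of tamely ramified étale $k$-algebras to the category of étale graded $\widetilde k$-algebras. 3. Let $\Pi$ be the group of automorphisms of the graded $\widetilde k$-algebra $\widetilde{k^s}$. The natural map $\mathrm{Gal}(k^s/k)\to\Pi$ induces an isomorphism $\mathrm{Gal}(M/k)\simeq\Pi$. Through it, both categories in 2 are anti-equivalent to the category of finite $\Pi$-sets with open stabilizers (for the Krull topology of $\mathrm{Gal}(M/k)$), by the functors $E\mapsto\mathrm{Hom}_k(E,M)$ and $B\mapsto\mathrm{Hom}_{\widetilde k}(B,\widetilde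 M)$ (morphisms of graded algebras). These equivalences are compatible: for every tamely ramified étale $k$-algebra $E$, the natural map $\mathrm{Hom}_k(E,M)\to\mathrm{Hom}_{\widetilde k}(\widetilde E,\widetilde M)$ is an isomorphism of $\Pi$-sets, functorial in $E$. 4. Let $K$ be a field extension of $k$ with a henselian absolute value $K\to\Gamma\cup\{0\}$ extending that of $k$, and let $E$ be a tamely ramified étale $k$-algebra. Then $K\otimes_kE$ is a tamely ramified étale $K$-algebra, and the natural map $\widetilde K\otimes_{\widetilde k}\widetilde E\to\widetilde{K\otimes_kE}$ is an isomorphism of graded $\widetilde K$-algebras. -/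

import Mathlib

open CategoryTheory TensorProduct

universe u

noncomputable section

namespace GradedRamification

/-! ### Graded reduction

`Γ` is a (multiplicative) ordered abelian group and `WithZero Γ` is `Γ ∪ {0}`.  Mathlib indexes
gradings additively, so the degrees are written in `Additive Γ`. -/

section Reduction

set_option linter.unusedSectionVars false

variable {Γ : Type u} [CommGroup Γ] [LinearOrder Γ] [IsOrderedMonoid Γ]

/-- A degree, seen as a nonzero element of `Γ ∪ {0}`. -/
def radius (r : Additive Γ) : WithZero Γ := ((Additive.toMul r : Γ) : WithZero Γ)

theorem radius_pos (r : Additive Γ) : 0 < radius r := WithZero.zero_lt_coe _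

theorem radius_add (r s : Additive Γ) : radius (r + s) = radius r * radius s := rfl

theorem radius_zero : radius (0 : Additive Γ) = 1 := rfl

/-- `{a ∈ A | ‖a‖ ≤ r}`, where `‖a‖` is the maximum of the `w a`, for `w` in the set `S` of
valuations on the ring `A`. -/
def closedBall {A : Type u} [CommRing A] (S : Set (Valuation A (WithZero Γ)))
    (r : Additive Γ) : AddSubgroup A where
  carrier := {a | ∀ w ∈ S, w a ≤ radius r}
  add_mem' ha hb w hw := w.map_add_le (ha w hw) (hb w hw)
  zero_mem' w _ := by rw [map_zero]; exact zero_le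
  neg_mem' ha w hw := by rw [Valuation.map_neg]; exact ha w hw

/-- `{a ∈ A | ‖a‖ < r}`, where `‖a‖` is the maximum of the `w a`, for `w` in the (finite) set `S`
of valuations on the ring `A`. -/
def openBall {A : Type u} [CommRing A] (S : Set (Valuation A (WithZero Γ)))
    (r : Additive Γ) : AddSubgroup A where
  carrier := {a | ∀ w ∈ S, w a < radius r}
  add_mem' ha hb w hw := w.map_add_lt (ha w hw) (hb w hw)
  zero_mem' w _ := by rw [map_zero]; exact radius_pos r
  neg_mem' ha w hw := by rw [Valuation.map_neg]; exact ha w hw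

/-- The homogeneous component of degree `r` of the graded reduction: `A_{≤ r} / A_{< r}`. -/
abbrev Piece {A : Type u} [CommRing A] (S : Set (Valuation A (WithZero Γ)))
    (r : Additive Γ) : Type u :=
  closedBall S r ⧸ (openBall S r).addSubgroupOf (closedBall S r)

/-- The class in `A_{≤ r} / A_{< r}` of an element `a` such that `‖a‖ ≤ r`. -/
def Piece.mk {A : Type u} [CommRing A] {S : Set (Valuation A (WithZero Γ))}
    (r : Additive Γ) (a : A) (ha : a ∈ closedBall S r) : Piece S r :=
  QuotientAddGroup.mk (⟨a, ha⟩ : closedBall S r)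

section Product

variable {A : Type u} [CommRing A] {S : Set (Valuation A (WithZero Γ))}

theorem Piece.ind {r : Additive Γ} {p : Piece S r → Prop}
    (h : ∀ (a : A) (ha : a ∈ closedBall S r), p (Piece.mk r a ha)) (x : Piece S r) : p x := by
  induction x using QuotientAddGroup.induction_on with
  | H z => exact h z.1 z.2

theorem mul_mem_closedBall {r s : Additive Γ} {a b : A} (ha : a ∈ closedBall S r)
    (hb : b ∈ closedBall S s) : a * b ∈ closedBall S (r + s) := fun w hw => by
  rw [map_mul, radius_add]
  exact mul_le_mul' (ha w hw) (hb w hw)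

theorem mul_mem_openBall {r s : Additive Γ} {a b : A} (ha : a ∈ openBall S r)
    (hb : b ∈ closedBall S s) : a * b ∈ openBall S (r + s) := fun w hw => by
  rw [map_mul, radius_add]
  exact mul_lt_mul_of_lt_of_le_of_nonneg_of_pos (ha w hw) (hb w hw) zero_le (radius_pos s)

theorem one_mem_closedBall : (1 : A) ∈ closedBall S (0 : Additive Γ) := fun w _ => by
  rw [map_one, radius_zero]

/-- The product `A_{≤ r} / A_{< r} × A_{≤ s} / A_{< s} → A_{≤ rs} / A_{< rs}`. -/
def Piece.mulHom (S : Set (Valuation A (WithZero Γ))) (r s : Additive Γ) :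
    Piece S r →+ Piece S s →+ Piece S (r + s) :=
  QuotientAddGroup.lift _
    (AddMonoidHom.mk' (fun a : closedBall S r =>
      QuotientAddGroup.lift _
        (AddMonoidHom.mk' (fun b : closedBall S s =>
          Piece.mk (S := S) (r + s) (a.1 * b.1) (mul_mem_closedBall a.2 b.2))
          (fun b b' => congrArg QuotientAddGroup.mk (Subtype.ext (mul_add a.1 b.1 b'.1))))
        (fun b hb => (QuotientAddGroup.eq_zero_iff _).2 (by
          have h := mul_mem_openBall (AddSubgroup.mem_addSubgroupOf.1 hb) a.2
          rw [mul_comm, add_comm] at h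
          exact AddSubgroup.mem_addSubgroupOf.2 h)))
      (fun a a' => by
        ext b
        exact congrArg QuotientAddGroup.mk (Subtype.ext (add_mul a.1 a'.1 b.1))))
    (fun a ha => by
      ext b
      exact (QuotientAddGroup.eq_zero_iff _).2
        (AddSubgroup.mem_addSubgroupOf.2
          (mul_mem_openBall (AddSubgroup.mem_addSubgroupOf.1 ha) b.2)))

theorem Piece.sigma_ext {r s : Additive Γ} (h : r = s) {a b : A} (hab : a = b)
    (ha : a ∈ closedBall S r) (hb : b ∈ closedBall S s) :
    (⟨r, Piece.mk r a ha⟩ : GradedMonoid (Piece S)) = ⟨s, Piece.mk s b hb⟩ := by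
  subst h; subst hab; rfl

instance : GradedMonoid.GMul (Piece S) where
  mul {r s} x y := Piece.mulHom S r s x y

instance : GradedMonoid.GOne (Piece S) where
  one := Piece.mk 0 1 one_mem_closedBall

instance : DirectSum.GCommRing (Piece S) where
  mul_zero {r s} x := map_zero (Piece.mulHom S r s x)
  zero_mul {r s} x := congrArg (fun f => f x) (map_zero (Piece.mulHom S r s))
  mul_add {r s} x y z := map_add (Piece.mulHom S r s x) y z
  add_mul {r s} x y z := congrArg (fun f => f z) (map_add (Piece.mulHom S r s) x y)
  one_mul x := by
    obtain ⟨r, x⟩ := x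
    induction x using Piece.ind with
    | h a ha => exact Piece.sigma_ext (zero_add r) (one_mul a) _ _
  mul_one x := by
    obtain ⟨r, x⟩ := x
    induction x using Piece.ind with
    | h a ha => exact Piece.sigma_ext (add_zero r) (mul_one a) _ _
  mul_assoc x y z := by
    obtain ⟨r, x⟩ := x
    obtain ⟨s, y⟩ := y
    obtain ⟨t, z⟩ := z
    induction x using Piece.ind with
    | h a ha =>
      induction y using Piece.ind with
      | h b hb =>
        induction z using Piece.ind with
        | h c hc => exact Piece.sigma_ext (add_assoc r s t) (mul_assoc a b c) _ _
  mul_comm x y := by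
    obtain ⟨r, x⟩ := x
    obtain ⟨s, y⟩ := y
    induction x using Piece.ind with
    | h a ha =>
      induction y using Piece.ind with
      | h b hb => exact Piece.sigma_ext (add_comm r s) (mul_comm a b) _ _
  natCast n := n • Piece.mk 0 1 one_mem_closedBall
  natCast_zero := zero_nsmul _
  natCast_succ n := succ_nsmul _ n
  intCast n := n • Piece.mk 0 1 one_mem_closedBall
  intCast_ofNat n := natCast_zsmul _ n
  intCast_negSucc_ofNat n := negSucc_zsmul _ n

end Product

/-- The graded reduction `⨁_r A_{≤ r} / A_{< r}` of the ring `A`, endowed with the semi-norm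
`‖a‖ = max {w a | w ∈ S}`. -/
def GRed {A : Type u} [CommRing A] (S : Set (Valuation A (WithZero Γ))) : Type u :=
  DirectSum (Additive Γ) (Piece S)

instance {A : Type u} [CommRing A] (S : Set (Valuation A (WithZero Γ))) : CommRing (GRed S) :=
  inferInstanceAs (CommRing (DirectSum (Additive Γ) (Piece S)))

/-- The inclusion of `A_{≤ r} / A_{< r}` in the graded reduction. -/
def GRed.of {A : Type u} [CommRing A] (S : Set (Valuation A (WithZero Γ))) (r : Additive Γ) :
    Piece S r →+ GRed S :=
  DirectSum.of (Piece S) r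

/-- The homogeneous elements of degree `r` of the graded reduction. -/
def redDeg {A : Type u} [CommRing A] (S : Set (Valuation A (WithZero Γ))) (r : Additive Γ) :
    AddSubgroup (GRed S) :=
  (GRed.of S r).range

section Graded

variable {A : Type u} [CommRing A] {S : Set (Valuation A (WithZero Γ))}

instance : SetLike.GradedMonoid (redDeg S) where
  one_mem := ⟨_, rfl⟩
  mul_mem r s x y := by
    rintro ⟨x, rfl⟩ ⟨y, rfl⟩
    exact ⟨_, (DirectSum.of_mul_of x y).symm⟩

/-- The graded reduction is the direct sum of its homogeneous components. -/
def redDecompose (S : Set (Valuation A (WithZero Γ))) :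
    GRed S →+ DirectSum (Additive Γ) (fun r => redDeg S r) :=
  DirectSum.toAddMonoid fun r =>
    (DirectSum.of (fun r => redDeg S r) r).comp (GRed.of S r).rangeRestrict

theorem redDecompose_of (r : Additive Γ) (x : Piece S r) :
    redDecompose S (GRed.of S r x) =
      DirectSum.of (fun r => redDeg S r) r ⟨GRed.of S r x, x, rfl⟩ :=
  DirectSum.toAddMonoid_of _ _ _

theorem GRed.ind {p : GRed S → Prop} (h0 : p 0)
    (hof : ∀ (r : Additive Γ) (x : Piece S r), p (GRed.of S r x))
    (hadd : ∀ x y, p x → p y → p (x + y)) (x : GRed S) : p x :=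
  DirectSum.induction_on (motive := p) x h0 hof hadd

instance : GradedRing (redDeg S) where
  decompose' := redDecompose S
  left_inv x := by
    induction x using GRed.ind with
    | h0 => rw [map_zero, map_zero]
    | hof r x => rw [redDecompose_of, DirectSum.coeAddMonoidHom_of]
    | hadd x y hx hy => rw [map_add, map_add, hx, hy]
  right_inv x := by
    induction x using DirectSum.induction_on with
    | zero => rw [map_zero, map_zero]
    | of r x =>
      obtain ⟨_, x, rfl⟩ := x
      rw [DirectSum.coeAddMonoidHom_of, redDecompose_of]
    | add x y hx hy => rw [map_add, map_add, hx, hy]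

end Graded

section Functoriality

variable {A B C : Type u} [CommRing A] [CommRing B] [CommRing C]
  {S : Set (Valuation A (WithZero Γ))} {T : Set (Valuation B (WithZero Γ))}
  {U : Set (Valuation C (WithZero Γ))}

/-- The map induced on the components of degree `r` by a norm-decreasing morphism. -/
def pieceMap (f : A →+* B) (hf : ∀ w ∈ T, w.comap f ∈ S) (r : Additive Γ) :
    Piece S r →+ Piece T r :=
  QuotientAddGroup.map _ _
    ((f.toAddMonoidHom.comp (closedBall S r).subtype).codRestrict (closedBall T r)
      (fun a w hw => a.2 _ (hf w hw)))
    (fun _ ha w hw => ha _ (hf w hw))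

/-- The morphism `GRed S → GRed T` induced by `f`. -/
def redMap (f : A →+* B) (hf : ∀ w ∈ T, w.comap f ∈ S) : GRed S →+* GRed T :=
  DirectSum.toSemiring (fun r => (GRed.of T r).comp (pieceMap f hf r))
    (by
      refine congrArg (GRed.of T 0) ?_
      exact congrArg QuotientAddGroup.mk (Subtype.ext f.map_one))
    (by
      intro r s x y
      induction x using Piece.ind with
      | h a ha =>
        induction y using Piece.ind with
        | h b hb =>
          refine Eq.trans ?_ (DirectSum.of_mul_of _ _).symm
          refine congrArg (GRed.of T (r + s)) ?_
          exact congrArg QuotientAddGroup.mk (Subtype.ext (f.map_mul a b)))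

theorem redMap_of (f : A →+* B) (hf : ∀ w ∈ T, w.comap f ∈ S) (r : Additive Γ) (x : Piece S r) :
    redMap f hf (GRed.of S r x) = GRed.of T r (pieceMap f hf r x) :=
  DirectSum.toSemiring_of _ _ _ _ _

theorem redMap_mem (f : A →+* B) (hf : ∀ w ∈ T, w.comap f ∈ S) (r : Additive Γ) (x : GRed S)
    (hx : x ∈ redDeg S r) : redMap f hf x ∈ redDeg T r := by
  obtain ⟨x, rfl⟩ := hx
  exact ⟨_, (redMap_of f hf r x).symm⟩

theorem GRed.ringHom_ext {D : Type u} [CommRing D] {f g : GRed S →+* D}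
    (h : ∀ (r : Additive Γ) (x : Piece S r), f (GRed.of S r x) = g (GRed.of S r x)) : f = g :=
  DirectSum.ringHom_ext (f := f) (g := g) h

theorem redMap_id (h : ∀ w ∈ S, w.comap (RingHom.id A) ∈ S) :
    redMap (RingHom.id A) h = RingHom.id (GRed S) := by
  refine GRed.ringHom_ext fun r x => ?_
  rw [redMap_of]
  induction x using Piece.ind with
  | h a ha => rfl

theorem redMap_comp (f : A →+* B) (hf : ∀ w ∈ T, w.comap f ∈ S) (g : B →+* C)
    (hg : ∀ w ∈ U, w.comap g ∈ T) (h : ∀ w ∈ U, w.comap (g.comp f) ∈ S) :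
    redMap (g.comp f) h = (redMap g hg).comp (redMap f hf) := by
  refine GRed.ringHom_ext fun r x => ?_
  rw [RingHom.comp_apply, redMap_of, redMap_of, redMap_of]
  induction x using Piece.ind with
  | h a ha => rfl

end Functoriality

end Reduction

/-! ### Graded algebras over a graded ring -/

section GradedAlgebras

variable {Γ : Type u} [CommGroup Γ] [LinearOrder Γ]

/-- A graded algebra over the graded ring `R`, whose component of degree `γ` is `𝓡 γ`. -/
structure GrAlg (R : Type u) [CommRing R] (𝓡 : Additive Γ → AddSubgroup R) where
  carrier : Type u
  [commRing : CommRing carrier]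
  [algebra : Algebra R carrier]
  deg : Additive Γ → AddSubgroup carrier
  [graded : GradedRing deg]
  algebraMap_mem : ∀ (γ : Additive Γ) (x : R), x ∈ 𝓡 γ → algebraMap R carrier x ∈ deg γ

attribute [instance] GrAlg.commRing GrAlg.algebra GrAlg.graded

/-- Morphisms of graded algebras: algebra morphisms that preserve the degree. -/
@[ext]
structure GrAlg.Hom {R : Type u} [CommRing R] {𝓡 : Additive Γ → AddSubgroup R}
    (A B : GrAlg R 𝓡) where
  toAlgHom : A.carrier →ₐ[R] B.carrier
  map_mem : ∀ (γ : Additive Γ) (x : A.carrier), x ∈ A.deg γ → toAlgHom x ∈ B.deg γ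

instance {R : Type u} [CommRing R] {𝓡 : Additive Γ → AddSubgroup R} : Category (GrAlg R 𝓡) where
  Hom A B := GrAlg.Hom A B
  id A := ⟨AlgHom.id R A.carrier, fun _ _ h => h⟩
  comp f g := ⟨g.toAlgHom.comp f.toAlgHom, fun γ x h => g.map_mem γ _ (f.map_mem γ x h)⟩

/-- The component of degree `γ` of the tensor product of two graded algebras. -/
def tensorDeg {R A B : Type u} [CommRing R] [CommRing A] [CommRing B] [Algebra R A] [Algebra R B]
    (𝒜 : Additive Γ → AddSubgroup A) (ℬ : Additive Γ → AddSubgroup B) (γ : Additive Γ) :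
    AddSubgroup (A ⊗[R] B) :=
  AddSubgroup.closure {t | ∃ i j : Additive Γ, i + j = γ ∧ ∃ a ∈ 𝒜 i, ∃ b ∈ ℬ j, a ⊗ₜ[R] b = t}

/-- Étale graded algebras (the base being a graded field): finite ones whose module of
differentials is zero. A graded module has finite dimension (i.e. a finite homogeneous basis)
if and only if it is finitely generated, and the graded module of differentials is the usual one,
endowed with its natural grading. -/
def etaleGr {R : Type u} [CommRing R] (𝓡 : Additive Γ → AddSubgroup R) :
    ObjectProperty (GrAlg R 𝓡) :=
  fun A => Module.Finite R A.carrier ∧ Subsingleton (Ω[A.carrier⁄R])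

/-- `B` is split by `L`: the graded `L`-algebra `L ⊗ B` is isomorphic to a finite product of
copies of `L`. -/
def SplitBy {R : Type u} [CommRing R] {𝓡 : Additive Γ → AddSubgroup R} (B L : GrAlg R 𝓡) : Prop :=
  ∃ (n : ℕ) (e : (L.carrier ⊗[R] B.carrier) ≃ₐ[L.carrier] (Fin n → L.carrier)),
    ∀ (γ : Additive Γ) (x : L.carrier ⊗[R] B.carrier),
      x ∈ tensorDeg L.deg B.deg γ ↔ ∀ i, e x i ∈ L.deg γ

end GradedAlgebras

/-! ### Algebras over a valued field -/

section Valued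

variable {Γ : Type u} [CommGroup Γ] [LinearOrder Γ] [IsOrderedMonoid Γ]

/-- The valuation `w` on the `k`-algebra `A` extends the absolute value `v` of `k`. -/
class Extends {k A : Type u} [CommRing k] [CommRing A] [Algebra k A]
    (v : Valuation k (WithZero Γ)) (w : Valuation A (WithZero Γ)) : Prop where
  comap_eq : w.comap (algebraMap k A) = v

/-- The valued field `k` is henselian: its absolute value extends uniquely to every finite
extension of `k`. -/
def Henselian {k : Type u} [Field k] (v : Valuation k (WithZero Γ)) : Prop :=
  ∀ (L : Type u) [Field L] [Algebra k L] [FiniteDimensional k L],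
    ∃! w : Valuation L (WithZero Γ), Extends v w

/-- The valuations on `A` extending `v`. If `k` is henselian and `L` is an algebraic extension of
`k`, there is only one such valuation, the absolute value of `L`. If `k` is henselian and
`A` is a finite product of finite extensions `L_i` of `k`, these valuations are the
`(x_j)_j ↦ |x_i|`, and their maximum is the maximum norm `‖(x_j)_j‖ = max_j |x_j|` of `A`. -/
def extensions {k : Type u} [CommRing k] (v : Valuation k (WithZero Γ)) (A : Type u) [CommRing A]
    [Algebra k A] : Set (Valuation A (WithZero Γ)) :=
  {w | Extends v w}

theorem comap_mem_extensions {k A B : Type u} [CommRing k] {v : Valuation k (WithZero Γ)}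
    [CommRing A] [CommRing B] [Algebra k A] [Algebra k B] (f : A →ₐ[k] B) :
    ∀ w ∈ extensions v B, w.comap (f : A →+* B) ∈ extensions v A := fun w hw =>
  ⟨by
    rw [← hw.comap_eq, ← Valuation.comap_comp, AlgHom.comp_algebraMap]⟩

theorem comap_mem_singleton {k A : Type u} [CommRing k] {v : Valuation k (WithZero Γ)}
    [CommRing A] [Algebra k A] :
    ∀ w ∈ extensions v A, w.comap (algebraMap k A) ∈ ({v} : Set (Valuation k (WithZero Γ))) :=
  fun _ hw => hw.comap_eq

/-- The residue graded field of a valued field. -/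
abbrev ResField {k : Type u} [CommRing k] (v : Valuation k (WithZero Γ)) : Type u :=
  GRed ({v} : Set (Valuation k (WithZero Γ)))

/-- The grading of the residue graded field. -/
abbrev resDeg {k : Type u} [CommRing k] (v : Valuation k (WithZero Γ)) :
    Additive Γ → AddSubgroup (ResField v) :=
  redDeg ({v} : Set (Valuation k (WithZero Γ)))

/-- The graded reduction of a `k`-algebra `A` is an algebra over the residue graded field. -/
instance redAlgebra {k : Type u} [CommRing k] (v : Valuation k (WithZero Γ)) (A : Type u)
    [CommRing A] [Algebra k A] : Algebra (ResField v) (GRed (extensions v A)) :=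
  (redMap (algebraMap k A) comap_mem_singleton).toAlgebra

/-- The residue graded field of a valued extension `K` of `k` is an algebra over the residue
graded field of `k`. -/
instance resAlgebra {k K : Type u} [CommRing k] [CommRing K] [Algebra k K]
    (v : Valuation k (WithZero Γ)) (vK : Valuation K (WithZero Γ)) [Extends v vK] :
    Algebra (ResField v) (ResField vK) :=
  (redMap (algebraMap k K) (by
    rintro w rfl
    exact Extends.comap_eq)).toAlgebra

/-- The functor `A ↦ Ã` from `k`-algebras to graded algebras over the residue graded field. -/
def red {k : Type u} [CommRing k] (v : Valuation k (WithZero Γ)) :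
    CommAlgCat.{u} k ⥤ GrAlg (ResField v) (resDeg v) where
  obj A :=
    { carrier := GRed (extensions v A)
      deg := redDeg (extensions v A)
      algebraMap_mem := redMap_mem _ _ }
  map {A B} f :=
    { toAlgHom :=
        { redMap (f.hom : A →+* B) (comap_mem_extensions f.hom) with
          commutes' := fun x => by
            change redMap (f.hom : A →+* B) (comap_mem_extensions f.hom)
              (redMap (algebraMap k A) comap_mem_singleton x) =
              redMap (algebraMap k B) comap_mem_singleton x
            rw [← RingHom.comp_apply, ← redMap_comp]
            · congr 2
              exact f.hom.comp_algebraMap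
            · intro w hw
              exact comap_mem_singleton _ (comap_mem_extensions f.hom w hw) }
      map_mem := redMap_mem _ _ }
  map_id A := GrAlg.Hom.ext (AlgHom.ext fun x => DFunLike.congr_fun (redMap_id _) x)
  map_comp f g :=
    GrAlg.Hom.ext (AlgHom.ext fun x => DFunLike.congr_fun (redMap_comp _ _ _ _ _) x)

theorem comap_includeRight_mem {k K E : Type u} [CommRing k] [CommRing K] [Algebra k K]
    [CommRing E] [Algebra k E] (v : Valuation k (WithZero Γ)) (vK : Valuation K (WithZero Γ))
    [h : Extends v vK] :
    ∀ w ∈ extensions vK (K ⊗[k] E),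
      w.comap (Algebra.TensorProduct.includeRight : E →ₐ[k] K ⊗[k] E).toRingHom ∈
        extensions v E := fun w hw =>
  ⟨by
    have h1 : (Algebra.TensorProduct.includeRight : E →ₐ[k] K ⊗[k] E).toRingHom.comp
        (algebraMap k E) = (algebraMap K (K ⊗[k] E)).comp (algebraMap k K) := by
      ext x
      exact (Algebra.TensorProduct.includeRight : E →ₐ[k] K ⊗[k] E).commutes x
    rw [← Valuation.comap_comp, h1, Valuation.comap_comp, hw.comap_eq, h.comap_eq]⟩

/-- The natural morphism from the reduction of `E` to the reduction of `K ⊗ E`, where `K` is a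
valued extension of `k`. -/
def redBaseChange {k K : Type u} [CommRing k] [CommRing K] [Algebra k K]
    (v : Valuation k (WithZero Γ)) (vK : Valuation K (WithZero Γ)) [Extends v vK]
    (E : Type u) [CommRing E] [Algebra k E] :
    GRed (extensions v E) →+* GRed (extensions vK (K ⊗[k] E)) :=
  redMap (Algebra.TensorProduct.includeRight : E →ₐ[k] K ⊗[k] E).toRingHom
    (comap_includeRight_mem v vK)

/-- The action of the `k`-automorphisms of `L`, seen in the category of `k`-algebras. -/
def galEnd (k L : Type u) [Field k] [Field L] [Algebra k L] :
    Gal(L/k) →* End (CommAlgCat.of k L) where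
  toFun g := CommAlgCat.ofHom (g : L →ₐ[k] L)
  map_one' := rfl
  map_mul' _ _ := rfl

/-- The action of `Gal(L/k)` on the graded reduction of `L`. -/
def galRed {k : Type u} [Field k] (v : Valuation k (WithZero Γ)) (L : Type u) [Field L]
    [Algebra k L] : Gal(L/k) →* End ((red v).obj (CommAlgCat.of k L)) :=
  ((red v).mapEnd (CommAlgCat.of k L)).comp (galEnd k L)

/-- The graded inertia group `I_grad(L/k)`. -/
def inertia {k : Type u} [Field k] (v : Valuation k (WithZero Γ)) (L : Type u) [Field L]
    [Algebra k L] : Subgroup Gal(L/k) :=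
  (galRed v L).ker

/-- The graded inertia group `I_grad(kˢ/k)`: the projective limit, inside
`Gal(kˢ/k) = lim Gal(L/k)`, of the `I_grad(L/k)` where `L` runs through the finite Galois
subextensions of the separable closure `ks` of `k`. -/
def sepInertia {k : Type u} [Field k] (v : Valuation k (WithZero Γ)) (ks : Type u) [Field ks]
    [Algebra k ks] : Subgroup Gal(ks/k) :=
  ⨅ L : FiniteGaloisIntermediateField k ks,
    (inertia v L).comap (AlgEquiv.restrictNormalHom (F := k) (K₁ := ks) L)

/-- The maximal tamely ramified extension `M` of `k` in its separable closure `ks`. -/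
def maxTame {k : Type u} [Field k] (v : Valuation k (WithZero Γ)) (ks : Type u) [Field ks]
    [Algebra k ks] : IntermediateField k ks :=
  IntermediateField.fixedField (sepInertia v ks)

/-- `E` is a tamely ramified étale `k`-algebra: it is étale, and `M ⊗ E` is a finite product of
copies of `M`. -/
def IsTameEtale {k : Type u} [Field k] (v : Valuation k (WithZero Γ)) (ks : Type u) [Field ks]
    [Algebra k ks] (E : Type u) [CommRing E] [Algebra k E] : Prop :=
  Algebra.Etale k E ∧
    ∃ n : ℕ, Nonempty ((maxTame v ks ⊗[k] E) ≃ₐ[maxTame v ks] (Fin n → maxTame v ks))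

/-- The tamely ramified étale `k`-algebras. -/
def tameEtale {k : Type u} [Field k] (v : Valuation k (WithZero Γ)) (ks : Type u) [Field ks]
    [Algebra k ks] : ObjectProperty (CommAlgCat.{u} k) :=
  fun E => IsTameEtale v ks E

/-- The reduction `M̃` of the maximal tamely ramified extension. -/
abbrev redMaxTame {k : Type u} [Field k] (v : Valuation k (WithZero Γ)) (ks : Type u) [Field ks]
    [Algebra k ks] : GrAlg (ResField v) (resDeg v) :=
  (red v).obj (CommAlgCat.of k (maxTame v ks))

end Valued

/-! ### Sets with an action of a Galois group -/

section Actions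

/-- Given an action of `G` on the object `X`, the contravariant functor `Y ↦ Hom(Y, X)` with
values in `G`-sets. -/
def homAction {𝒞 : Type*} [Category.{u} 𝒞] {G : Type u} [Group G] (X : 𝒞) (ρ : G →* End X) :
    𝒞ᵒᵖ ⥤ Action (Type u) G where
  obj Y :=
    { V := Y.unop ⟶ X
      ρ :=
        { toFun := fun g => TypeCat.ofHom fun f : Y.unop ⟶ X => f ≫ End.asHom (ρ g)
          map_one' := by
            refine TypeCat.homEquiv.injective (funext fun f => ?_)
            change f ≫ End.asHom (ρ 1) = f
            rw [map_one]
            exact Category.comp_id f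
          map_mul' := fun g h => by
            refine TypeCat.homEquiv.injective (funext fun f => ?_)
            change f ≫ End.asHom (ρ (g * h)) = (f ≫ End.asHom (ρ h)) ≫ End.asHom (ρ g)
            rw [map_mul, Category.assoc]
            rfl } }
  map {Y Z} φ :=
    { hom := TypeCat.ofHom fun f : Y.unop ⟶ X => φ.unop ≫ f
      comm := fun g => by
        ext f
        exact (Category.assoc φ.unop f (End.asHom (ρ g))).symm }
  map_id Y := by
    ext f
    exact Category.id_comp (X := Y.unop) f
  map_comp φ ψ := by
    ext f
    exact Category.assoc ψ.unop φ.unop f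

/-- The natural transformation `Hom(Y, X) → Hom(F Y, F X)`. -/
def homActionMap {𝒞 𝒟 : Type*} [Category.{u} 𝒞] [Category.{u} 𝒟] (F : 𝒞 ⥤ 𝒟) {G : Type u}
    [Group G] (X : 𝒞) (ρ : G →* End X) :
    homAction X ρ ⟶ F.op ⋙ homAction (F.obj X) ((F.mapEnd X).comp ρ) where
  app Y :=
    { hom := TypeCat.ofHom fun f : Y.unop ⟶ X => F.map f
      comm := fun g => by
        ext f
        exact F.map_comp f (End.asHom (ρ g)) }
  naturality Y Z φ := by
    ext f
    exact F.map_comp φ.unop f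

/-- Finite discrete `G`-sets: finite sets with an action of `G` whose stabilizers are open. -/
def finDiscrete (G : Type u) [Group G] [TopologicalSpace G] :
    ObjectProperty (Action (Type u) G) :=
  fun X => Finite X.V ∧ ∀ x : X.V, IsOpen {g : G | X.ρ g x = x}

end Actions

end GradedRamification

end

noncomputable section
namespace GradedRamification

/-! ### Valuations on algebraic extensions and on finite algebras -/

section ValuationExtension

variable {Γ : Type u} [CommGroup Γ] [LinearOrder Γ] [IsOrderedMonoid Γ]

/-! The reduction of M plays the part of a separable closure for graded algebras, and the rest is
counting. By Dedekind's independence of characters, an algebra free of rank n has at most n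
morphisms to a domain. If n distinct morphisms to a graded field preserve degrees, the matrix of
their values on a homogeneous basis has a homogeneous nonzero determinant. This determinant is a
unit, so the n morphisms split the algebra (`bijective_evalAll_of_homogeneous`).

Splitting by the reduction of M. Inertia moves x ≠ 0 by less than |x|, while a root that is simple
modulo the maximal ideal is alone in its residue class (`eq_of_isRoot_of_sub_lt`); so inertia fixes
such roots. Hence the residue field of M is separably closed, and the value group of M is closed in
Γ under division by integers prime to the residue characteristic p. A character, with values in ℤ/p,
of the group of degrees of B modulo those of M gives a derivation of B. Since Ω = 0, all these
characters vanish, and the degrees of B are degrees of M (`degree_mem_of_etale`). A homogeneous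
basis can then be rescaled to degree zero, which reduces the splitting to the classical case over
the residue field of M (`exists_algHom_of_etaleGr`).

Reduction of tame algebras. An automorphism of the reduction of a Galois extension L of K that fixes
the classes of K lifts to Gal(L/K): this is the surjectivity of a decomposition group, for the Rees
ring ⨁ L_{≤ r} and the kernel of its projection to the reduction (`exists_galois_cls_eq`). It gives
Gal(M/k) ≃ Π, and it shows that an automorphism of M that is trivial on the reduction of a subfield
F fixes F (`eq_of_trivial_on_reduction`). Hence distinct points E → M have distinct reductions
(`IsTameEtale.redAlgHom_injective`). Together with Dedekind's bound and the lifting of independent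
families, this forces E and its reduction to have the same dimension and the same points.

Equivalences. Both functors of points are fully faithful by Galois descent; on the graded side one
needs that the invariants of the reduction of M are the reduction of k
(`exists_algebraMap_eq_of_fixed`). Products of fixed fields realize every finite Galois set with
open stabilizers. The reduction functor is an equivalence because the functors of points on both
sides are. For the extension of scalars, the determinant of a reduced basis of E in a homogeneous
basis of the reduction of K ⊗ E is homogeneous and nonzero, hence a unit. -/

theorem Extends.apply {k A : Type u} [CommRing k] [CommRing A] [Algebra k A]
    {v : Valuation k (WithZero Γ)} {w : Valuation A (WithZero Γ)} (h : Extends v w) (x : k) :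
    w (algebraMap k A x) = v x :=
  DFunLike.congr_fun h.comap_eq x

/-- The valuation of an algebraic extension of a henselian field. -/
theorem Henselian.exists_extends_of_isAlgebraic {k : Type u} [Field k]
    {v : Valuation k (WithZero Γ)} (hv : Henselian v) (L : Type u) [Field L] [Algebra k L]
    [Algebra.IsAlgebraic k L] : ∃ w : Valuation L (WithZero Γ), Extends v w := by
  classical
  have hfin : ∀ s : Finset L, FiniteDimensional k (IntermediateField.adjoin k (s : Set L)) :=
    fun s => IntermediateField.finiteDimensional_adjoin
      (fun x _ => (Algebra.IsAlgebraic.isAlgebraic (R := k) x).isIntegral)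
  choose w hw _ using fun s : Finset L => hv (IntermediateField.adjoin k (s : Set L))
  have hle : ∀ s t : Finset L, s ⊆ t →
      IntermediateField.adjoin k (s : Set L) ≤ IntermediateField.adjoin k (t : Set L) :=
    fun s t h => IntermediateField.adjoin.mono k _ _ (by exact_mod_cast h)
  -- Uniqueness on the finite extension k(s) forces the valuation of k(t) to restrict to that of
  -- k(s), so the valuations glue along the directed union of the k(s).
  have hcomp : ∀ (s t : Finset L) (h : s ⊆ t) (x : IntermediateField.adjoin k (s : Set L)),
      w t (IntermediateField.inclusion (hle s t h) x) = w s x := by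
    intro s t h x
    have h1 : (w t).comap (IntermediateField.inclusion (hle s t h) :
        _ →+* IntermediateField.adjoin k (t : Set L)) = w s := by
      refine (hv (IntermediateField.adjoin k (s : Set L))).unique
        (comap_mem_extensions _ _ (hw t)) (hw s)
    rw [← h1]; rfl
  have hmem : ∀ (s : Finset L) (x : L), x ∈ s → x ∈ IntermediateField.adjoin k (s : Set L) :=
    fun s x h => IntermediateField.subset_adjoin _ _ (by exact_mod_cast h)
  let f : L → WithZero Γ := fun x => w {x} ⟨x, hmem {x} x (Finset.mem_singleton_self x)⟩
  have hf : ∀ (s : Finset L) (x : L) (hx : x ∈ IntermediateField.adjoin k (s : Set L)),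
      f x = w s ⟨x, hx⟩ := by
    intro s x hx
    have h1 := hcomp {x} (insert x s) (by simp) ⟨x, hmem {x} x (Finset.mem_singleton_self x)⟩
    have h2 := hcomp s (insert x s) (by simp) ⟨x, hx⟩
    exact h1.symm.trans h2
  refine ⟨{ toFun := f, map_zero' := ?_, map_one' := ?_, map_mul' := ?_, map_add_le_max' := ?_ },
    ⟨Valuation.ext fun x => ?_⟩⟩
  · rw [hf ∅ 0 (zero_mem _)]; exact map_zero (w ∅)
  · rw [hf ∅ 1 (one_mem _)]; exact map_one (w ∅)
  · intro x y
    have hx := hmem {x, y} x (by simp)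
    have hy := hmem {x, y} y (by simp)
    rw [hf {x, y} x hx, hf {x, y} y hy, hf {x, y} (x * y) (mul_mem hx hy), ← map_mul]
    rfl
  · intro x y
    have hx := hmem {x, y} x (by simp)
    have hy := hmem {x, y} y (by simp)
    rw [hf {x, y} x hx, hf {x, y} y hy, hf {x, y} (x + y) (add_mem hx hy)]
    exact (w {x, y}).map_add ⟨x, hx⟩ ⟨y, hy⟩
  · change f (algebraMap k L x) = v x
    rw [hf ∅ _ (algebraMap_mem _ x)]
    exact (hw ∅).apply x

/-- The valuation of an algebraic extension of a henselian field is unique. -/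
theorem Henselian.extends_unique {k : Type u} [Field k]
    {v : Valuation k (WithZero Γ)} (hv : Henselian v) {L : Type u} [Field L] [Algebra k L]
    [Algebra.IsAlgebraic k L] {w w' : Valuation L (WithZero Γ)} (h : Extends v w)
    (h' : Extends v w') : w = w' := by
  ext x
  have : FiniteDimensional k (IntermediateField.adjoin k ({x} : Set L)) :=
    IntermediateField.adjoin.finiteDimensional
      (Algebra.IsAlgebraic.isAlgebraic (R := k) x).isIntegral
  have h1 := (hv (IntermediateField.adjoin k ({x} : Set L))).unique
    (comap_mem_extensions (IntermediateField.val _) _ h)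
    (comap_mem_extensions (IntermediateField.val _) _ h')
  exact DFunLike.congr_fun h1 ⟨x, IntermediateField.mem_adjoin_simple_self k x⟩

theorem Henselian.exists_extensions_eq {k : Type u} [Field k]
    {v : Valuation k (WithZero Γ)} (hv : Henselian v) (L : Type u) [Field L] [Algebra k L]
    [Algebra.IsAlgebraic k L] : ∃ w : Valuation L (WithZero Γ), extensions v L = {w} := by
  obtain ⟨w, hw⟩ := hv.exists_extends_of_isAlgebraic L
  exact ⟨w, Set.eq_singleton_iff_unique_mem.2 ⟨hw, fun w' h' => hv.extends_unique h' hw⟩⟩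

theorem extends_of_extensions_eq {k : Type u} [CommRing k] {v : Valuation k (WithZero Γ)}
    {L : Type u} [CommRing L] [Algebra k L] {w : Valuation L (WithZero Γ)}
    (h : extensions v L = {w}) : Extends v w :=
  h.symm.subset rfl

/-- A valuation pulled back along a k-morphism again extends v. When there is only one extension on
each side, every k-morphism is therefore an isometry. -/
theorem comap_eq_of_extensions_eq {k : Type u} [CommRing k] {v : Valuation k (WithZero Γ)}
    {L L' : Type u} [CommRing L] [Algebra k L] [CommRing L'] [Algebra k L']
    {w : Valuation L (WithZero Γ)} {w' : Valuation L' (WithZero Γ)}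
    (h : extensions v L = {w}) (h' : extensions v L' = {w'}) (f : L →ₐ[k] L') (x : L) :
    w' (f x) = w x := by
  have h1 : w'.comap (f : L →+* L') ∈ extensions v L :=
    comap_mem_extensions f _ (h'.symm.subset rfl)
  rw [h] at h1
  exact DFunLike.congr_fun h1 x

/-- If finitely many points of `E` in algebraic extensions of `k` separate the elements of the
finite `k`-algebra `E`, the valuations on `E` are those given by these points. -/
theorem Henselian.extensions_eq_range {k : Type u} [Field k]
    {v : Valuation k (WithZero Γ)} (hv : Henselian v) {L : Type u} [Field L] [Algebra k L]
    {w : Valuation L (WithZero Γ)} (hw : Extends v w)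
    {E : Type u} [CommRing E] [Algebra k E] [Module.Finite k E]
    {X : Type*} [Finite X] (φ : X → (E →ₐ[k] L)) (hφ : ∀ a, (∀ x, φ x a = 0) → a = 0) :
    extensions v E = Set.range fun x => w.comap (φ x : E →+* L) := by
  ext w'
  constructor
  · intro h'
    have h' : Extends v w' := h'
    have hP : w'.supp.IsPrime := inferInstance
    have : Fintype X := Fintype.ofFinite X
    -- The kernels of the φ x intersect in 0, which lies in the prime ideal `w'.supp`, so this ideal
    -- contains one of them. As E is artinian, that kernel is maximal and equals the support; both
    -- valuations then live on the field E / P, where the extension of v is unique.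
    obtain ⟨x, -, hx⟩ : ∃ x ∈ (Finset.univ : Finset X), RingHom.ker (φ x) ≤ w'.supp := by
      rw [← Ideal.IsPrime.inf_le' hP]
      intro a ha
      rw [hφ a fun x => ?_]
      · exact zero_mem _
      · exact (Submodule.mem_finsetInf.1 ha) x (Finset.mem_univ x)
    have hmax : (RingHom.ker (φ x)).IsMaximal := by
      have : (RingHom.ker (φ x)).IsPrime := RingHom.ker_isPrime _
      have hart : IsArtinianRing E := isArtinian_of_tower k inferInstance
      infer_instance
    have heq : RingHom.ker (φ x) = w'.supp := hmax.eq_of_le hP.ne_top hx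
    let P := RingHom.ker (φ x)
    let : Field (E ⧸ P) := Ideal.Quotient.field P
    have e1 : Extends v (w'.onQuot (J := P) heq.le) := ⟨by
      rw [← h'.comap_eq]
      ext a
      rfl⟩
    have e2 : Extends v (w.comap (Ideal.kerLiftAlg (φ x) : E ⧸ P →+* L)) :=
      comap_mem_extensions _ _ hw
    have e3 := (hv (E ⧸ P)).unique e1 e2
    refine ⟨x, ?_⟩
    ext a
    exact (DFunLike.congr_fun e3 (Ideal.Quotient.mk P a)).symm
  · rintro ⟨x, rfl⟩
    exact comap_mem_extensions _ _ hw

end ValuationExtension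
end GradedRamification
end

noncomputable section
namespace GradedRamification

/-! ### Classes of elements in the graded reduction; graded fields -/

section Classes

set_option linter.unusedSectionVars false

variable {Γ : Type u} [CommGroup Γ] [LinearOrder Γ] [IsOrderedMonoid Γ]

open Classical in
/-- The class of `a` in the component of degree `r`, and `0` if the norm of `a` exceeds `r`. -/
def cls {A : Type u} [CommRing A] (S : Set (Valuation A (WithZero Γ))) (r : Additive Γ) (a : A) :
    GRed S :=
  if h : a ∈ closedBall S r then GRed.of S r (Piece.mk r a h) else 0

variable {A B : Type u} [CommRing A] [CommRing B] {S : Set (Valuation A (WithZero Γ))}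
  {T : Set (Valuation B (WithZero Γ))} {r s : Additive Γ} {a b : A}

theorem cls_of_mem (h : a ∈ closedBall S r) : cls S r a = GRed.of S r (Piece.mk r a h) :=
  dif_pos h

theorem cls_of_notMem (h : a ∉ closedBall S r) : cls S r a = 0 :=
  dif_neg h

theorem cls_mem (S : Set (Valuation A (WithZero Γ))) (r : Additive Γ) (a : A) :
    cls S r a ∈ redDeg S r := by
  by_cases h : a ∈ closedBall S r
  · rw [cls_of_mem h]; exact ⟨_, rfl⟩
  · rw [cls, dif_neg h]; exact zero_mem _

theorem exists_cls_of_mem {x : GRed S} (hx : x ∈ redDeg S r) :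
    ∃ a ∈ closedBall S r, cls S r a = x := by
  obtain ⟨y, rfl⟩ := hx
  induction y using Piece.ind with
  | h a ha => exact ⟨a, ha, cls_of_mem ha⟩

theorem GRed.of_injective : Function.Injective (GRed.of S r) :=
  DirectSum.of_injective r

theorem cls_add (ha : a ∈ closedBall S r) (hb : b ∈ closedBall S r) :
    cls S r (a + b) = cls S r a + cls S r b := by
  rw [cls_of_mem ha, cls_of_mem hb, cls_of_mem (add_mem ha hb), ← map_add]
  rfl

theorem cls_sub (ha : a ∈ closedBall S r) (hb : b ∈ closedBall S r) :
    cls S r (a - b) = cls S r a - cls S r b := by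
  rw [cls_of_mem ha, cls_of_mem hb, cls_of_mem (sub_mem ha hb), ← map_sub]
  rfl

theorem openBall_le : openBall S r ≤ closedBall S r := fun _ h w hw => (h w hw).le

theorem cls_eq_zero_iff (ha : a ∈ closedBall S r) : cls S r a = 0 ↔ a ∈ openBall S r := by
  rw [cls_of_mem ha, ← map_zero (GRed.of S r), GRed.of_injective.eq_iff]
  exact (QuotientAddGroup.eq_zero_iff _).trans AddSubgroup.mem_addSubgroupOf

theorem cls_of_mem_openBall (ha : a ∈ openBall S r) : cls S r a = 0 :=
  (cls_eq_zero_iff (openBall_le ha)).2 ha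

theorem cls_zero : cls S r 0 = 0 := cls_of_mem_openBall (zero_mem _)

theorem cls_eq_iff (ha : a ∈ closedBall S r) (hb : b ∈ closedBall S r) :
    cls S r a = cls S r b ↔ a - b ∈ openBall S r := by
  rw [← sub_eq_zero, ← cls_sub ha hb, cls_eq_zero_iff (sub_mem ha hb)]

theorem cls_mul (ha : a ∈ closedBall S r) (hb : b ∈ closedBall S s) :
    cls S (r + s) (a * b) = cls S r a * cls S s b := by
  rw [cls_of_mem ha, cls_of_mem hb, cls_of_mem (mul_mem_closedBall ha hb)]
  exact (DirectSum.of_mul_of (A := Piece S) (Piece.mk r a ha) (Piece.mk s b hb)).symm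

theorem cls_one : cls S 0 1 = 1 := cls_of_mem one_mem_closedBall

theorem cls_sum {ι : Type*} (t : Finset ι) (f : ι → A) (h : ∀ i ∈ t, f i ∈ closedBall S r) :
    cls S r (∑ i ∈ t, f i) = ∑ i ∈ t, cls S r (f i) := by
  classical
  induction t using Finset.induction_on with
  | empty => simp [cls_zero]
  | insert i t hi ih =>
    rw [Finset.sum_insert hi, Finset.sum_insert hi, cls_add (h i (by simp))
      (sum_mem fun j hj => h j (by simp [hj])), ih fun j hj => h j (by simp [hj])]

theorem redMap_cls (f : A →+* B) (hf : ∀ w ∈ T, w.comap f ∈ S) (ha : a ∈ closedBall S r) :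
    redMap f hf (cls S r a) = cls T r (f a) := by
  have hb : f a ∈ closedBall T r := fun w hw => ha _ (hf w hw)
  rw [cls_of_mem ha, cls_of_mem hb, redMap_of]
  rfl

theorem GRed.ringHom_ext_cls {D : Type u} [CommRing D] {f g : GRed S →+* D}
    (h : ∀ (r : Additive Γ), ∀ a ∈ closedBall S r, f (cls S r a) = g (cls S r a)) : f = g := by
  refine GRed.ringHom_ext fun r x => ?_
  obtain ⟨a, ha, h'⟩ := exists_cls_of_mem (S := S) (r := r) (x := GRed.of S r x) ⟨x, rfl⟩
  rw [← h', h r a ha]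

theorem exists_radius_eq {γ : WithZero Γ} (h : γ ≠ 0) : ∃ r : Additive Γ, radius r = γ := by
  obtain ⟨g, rfl⟩ := WithZero.ne_zero_iff_exists.1 h
  exact ⟨Additive.ofMul g, rfl⟩

theorem radius_ne_zero (r : Additive Γ) : radius r ≠ 0 := (radius_pos r).ne'

theorem radius_neg (r : Additive Γ) : radius (-r) = (radius r)⁻¹ := rfl

theorem radius_nsmul (n : ℕ) (r : Additive Γ) : radius (n • r) = radius r ^ n := by
  induction n with
  | zero => simp [radius_zero]
  | succ n ih => rw [succ_nsmul, radius_add, ih, pow_succ]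

end Classes

section Fields

variable {Γ : Type u} [CommGroup Γ] [LinearOrder Γ]

/-- A graded field: a nontrivial graded ring whose nonzero homogeneous elements are invertible. -/
structure IsGradedField {R : Type u} [CommRing R] (𝓡 : Additive Γ → AddSubgroup R) : Prop where
  nontrivial : Nontrivial R
  exists_mul_eq_one : ∀ (γ : Additive Γ) (x : R), x ∈ 𝓡 γ → x ≠ 0 → ∃ y ∈ 𝓡 (-γ), x * y = 1

variable [IsOrderedMonoid Γ] {A : Type u} [CommRing A] {w : Valuation A (WithZero Γ)}
  {r : Additive Γ} {a b : A}

theorem mem_closedBall_singleton :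
    a ∈ closedBall ({w} : Set (Valuation A (WithZero Γ))) r ↔ w a ≤ radius r := by
  simp [closedBall, ← SetLike.mem_coe]

theorem mem_openBall_singleton :
    a ∈ openBall ({w} : Set (Valuation A (WithZero Γ))) r ↔ w a < radius r := by
  simp [openBall, ← SetLike.mem_coe]

/-- A representative of a nonzero class in degree γ has value exactly γ, so its inverse has a class
in degree −γ. -/
theorem isGradedField_redDeg {K : Type u} [Field K] (w : Valuation K (WithZero Γ)) :
    IsGradedField (redDeg ({w} : Set (Valuation K (WithZero Γ)))) where
  nontrivial := ⟨1, 0, fun h => by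
    rw [← cls_one, cls_eq_zero_iff one_mem_closedBall, mem_openBall_singleton] at h
    simp [radius_zero] at h⟩
  exists_mul_eq_one γ x hx h0 := by
    obtain ⟨a, ha, rfl⟩ := exists_cls_of_mem hx
    have hw : w a = radius γ := by
      refine le_antisymm (mem_closedBall_singleton.1 ha) (not_lt.1 fun h => h0 ?_)
      exact cls_of_mem_openBall (mem_openBall_singleton.2 h)
    have ha0 : a ≠ 0 := fun h => radius_ne_zero γ (by rw [← hw, h, map_zero])
    refine ⟨cls _ (-γ) a⁻¹, cls_mem _ _ _, ?_⟩
    rw [← cls_mul ha, mul_inv_cancel₀ ha0, add_neg_cancel, cls_one]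
    rw [mem_closedBall_singleton, map_inv₀, hw, radius_neg]

end Fields
end GradedRamification
end

noncomputable section
namespace GradedRamification

/-! ### Graded algebras over a graded field -/

section GradedModules

set_option linter.unusedSectionVars false

variable {Γ : Type u} [CommGroup Γ] [LinearOrder Γ]

section Proj

variable {A B : Type*} [CommRing A] [CommRing B] (𝓐 : Additive Γ → AddSubgroup A)
  (𝓑 : Additive Γ → AddSubgroup B) [GradedRing 𝓐] [GradedRing 𝓑]

theorem proj_of_mem {γ : Additive Γ} {x : A} (h : x ∈ 𝓐 γ) : GradedRing.proj 𝓐 γ x = x := by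
  rw [GradedRing.proj_apply, DirectSum.decompose_of_mem_same _ h]

theorem proj_of_mem_ne {γ δ : Additive Γ} {x : A} (h : x ∈ 𝓐 γ) (hne : γ ≠ δ) :
    GradedRing.proj 𝓐 δ x = 0 := by
  rw [GradedRing.proj_apply, DirectSum.decompose_of_mem_ne _ h hne]

theorem proj_mem (γ : Additive Γ) (x : A) : GradedRing.proj 𝓐 γ x ∈ 𝓐 γ :=
  (DirectSum.decompose 𝓐 x γ).2

variable {𝓐} in
theorem induction_homogeneous {p : A → Prop} (h0 : p 0)
    (hom : ∀ γ, ∀ x ∈ 𝓐 γ, p x) (hadd : ∀ x y, p x → p y → p (x + y)) (x : A) : p x :=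
  DirectSum.Decomposition.inductionOn 𝓐 h0 (fun {γ} m => hom γ m.1 m.2) (fun x y => hadd x y) x

theorem proj_map (f : A →+ B) (hf : ∀ γ, ∀ x ∈ 𝓐 γ, f x ∈ 𝓑 γ) (γ : Additive Γ) (x : A) :
    GradedRing.proj 𝓑 γ (f x) = f (GradedRing.proj 𝓐 γ x) := by
  induction x using induction_homogeneous (𝓐 := 𝓐) with
  | h0 => simp
  | hom δ x hx =>
    by_cases h : δ = γ
    · subst h
      rw [proj_of_mem _ hx, proj_of_mem _ (hf _ _ hx)]
    · rw [proj_of_mem_ne _ hx h, proj_of_mem_ne _ (hf _ _ hx) h, map_zero]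
  | hadd x y hx hy => simp only [map_add, hx, hy]

theorem proj_mul_left {γ δ : Additive Γ} {a : A} (ha : a ∈ 𝓐 δ) (x : A) :
    GradedRing.proj 𝓐 γ (a * x) = a * GradedRing.proj 𝓐 (γ - δ) x := by
  rw [GradedRing.proj_apply, GradedRing.proj_apply,
    ← DirectSum.coe_decompose_mul_add_of_left_mem 𝓐 ha, add_sub_cancel]

theorem exists_proj_ne_zero {x : A} (hx : x ≠ 0) : ∃ γ, GradedRing.proj 𝓐 γ x ≠ 0 := by
  by_contra! h
  refine hx ((DirectSum.decompose 𝓐).injective ?_)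
  ext γ
  simpa [GradedRing.proj_apply] using h γ

/-- An element is homogeneous if its other components are zero. -/
theorem mem_of_proj_eq_zero {γ : Additive Γ} {x : A}
    (h : ∀ δ, δ ≠ γ → GradedRing.proj 𝓐 δ x = 0) : x ∈ 𝓐 γ := by
  have : x - GradedRing.proj 𝓐 γ x = 0 := by
    by_contra hne
    obtain ⟨δ, hδ⟩ := exists_proj_ne_zero 𝓐 hne
    rw [map_sub] at hδ
    by_cases hd : δ = γ
    · subst hd
      rw [proj_of_mem _ (proj_mem 𝓐 δ x), sub_self] at hδ
      exact hδ rfl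
    · rw [h δ hd, proj_of_mem_ne _ (proj_mem 𝓐 γ x) (Ne.symm hd), sub_self] at hδ
      exact hδ rfl
  rw [sub_eq_zero.1 this]
  exact proj_mem _ _ _

end Proj

variable {R : Type u} [CommRing R] {𝓡 : Additive Γ → AddSubgroup R} [GradedRing 𝓡]
  {B : Type u} [CommRing B] [Algebra R B] {𝓑 : Additive Γ → AddSubgroup B} [GradedRing 𝓑]

theorem IsGradedField.isUnit (h : IsGradedField 𝓡) {γ : Additive Γ} {x : R} (hx : x ∈ 𝓡 γ)
    (h0 : x ≠ 0) : IsUnit x := by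
  obtain ⟨y, -, hy⟩ := h.exists_mul_eq_one γ x hx h0
  exact IsUnit.of_mul_eq_one _ hy

/-- Since Γ is totally ordered, primality of the homogeneous ideal 0 can be tested on homogeneous
elements, and these are zero or invertible. -/
theorem IsGradedField.isDomain [IsOrderedMonoid Γ] (h : IsGradedField 𝓡) : IsDomain R := by
  have := h.nontrivial
  have hP : (⊥ : Ideal R).IsPrime := by
    refine Ideal.IsHomogeneous.isPrime_of_homogeneous_mem_or_mem (𝒜 := 𝓡) ?_ bot_ne_top ?_
    · exact Ideal.IsHomogeneous.bot 𝓡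
    · rintro x y ⟨γ, hx⟩ - hxy
      rw [Ideal.mem_bot] at *
      by_contra! hne
      exact hne.2 ((h.isUnit hx hne.1).mul_right_eq_zero.1 hxy)
  exact IsDomain.of_bot_isPrime R

theorem proj_smul_of_mem (hB : ∀ (γ : Additive Γ) (x : R), x ∈ 𝓡 γ → algebraMap R B x ∈ 𝓑 γ)
    {γ δ : Additive Γ} (c : R) {x : B} (hx : x ∈ 𝓑 δ) :
    GradedRing.proj 𝓑 γ (c • x) = GradedRing.proj 𝓡 (γ - δ) c • x := by
  rw [Algebra.smul_def, Algebra.smul_def, mul_comm, proj_mul_left 𝓑 hx, mul_comm]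
  congr 1
  exact proj_map 𝓡 𝓑 (algebraMap R B).toAddMonoidHom hB _ _

theorem proj_mem_span (hB : ∀ (γ : Additive Γ) (x : R), x ∈ 𝓡 γ → algebraMap R B x ∈ 𝓑 γ)
    {t : Set B} (ht : ∀ x ∈ t, ∃ γ, x ∈ 𝓑 γ) {y : B} (hy : y ∈ Submodule.span R t)
    (γ : Additive Γ) : GradedRing.proj 𝓑 γ y ∈ Submodule.span R t := by
  induction hy using Submodule.span_induction generalizing γ with
  | mem x hx =>
    obtain ⟨δ, hδ⟩ := ht x hx
    by_cases h : δ = γ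
    · subst h
      rw [proj_of_mem _ hδ]
      exact Submodule.subset_span hx
    · rw [proj_of_mem_ne _ hδ h]
      exact zero_mem _
  | zero => rw [map_zero]; exact zero_mem _
  | add x y _ _ hx hy => rw [map_add]; exact add_mem (hx γ) (hy γ)
  | smul c x _ hx =>
    induction c using induction_homogeneous (𝓐 := 𝓡) with
    | h0 => simp
    | hom δ c hc =>
      rw [Algebra.smul_def, proj_mul_left 𝓑 (hB _ _ hc), ← Algebra.smul_def]
      exact Submodule.smul_mem _ _ (hx _)
    | hadd c d hc hd => rw [add_smul, map_add]; exact add_mem hc hd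

/-- A graded algebra over a graded field has a homogeneous basis. -/
theorem IsGradedField.exists_homogeneous_basis (h : IsGradedField 𝓡)
    (hB : ∀ (γ : Additive Γ) (x : R), x ∈ 𝓡 γ → algebraMap R B x ∈ 𝓑 γ) :
    ∃ (ι : Type u) (d : ι → Additive Γ) (b : Module.Basis ι R B), ∀ i, b i ∈ 𝓑 (d i) := by
  obtain ⟨s, hs, hmax⟩ := exists_maximal_linearIndepOn R
    (fun x : {x : B // ∃ γ, x ∈ 𝓑 γ} => (x : B))
  have hhom : ∀ x ∈ (fun x : {x : B // ∃ γ, x ∈ 𝓑 γ} => (x : B)) '' s, ∃ γ, x ∈ 𝓑 γ := by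
    rintro _ ⟨x, -, rfl⟩
    exact x.2
  have hmem : ∀ x : {x : B // ∃ γ, x ∈ 𝓑 γ}, (x : B) ∈
      Submodule.span R ((fun x : {x : B // ∃ γ, x ∈ 𝓑 γ} => (x : B)) '' s) := by
    intro x
    by_cases hx : x ∈ s
    · exact Submodule.subset_span ⟨x, hx, rfl⟩
    -- Outside the maximal family, some a • x with a ≠ 0 lies in the span. The span is stable under
    -- projection to components, so it contains the product of x by a nonzero component of a, which
    -- is invertible.
    obtain ⟨a, ha, hax⟩ := hmax x hx
    obtain ⟨γ, hγ⟩ := x.2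
    obtain ⟨δ, hδ⟩ := exists_proj_ne_zero 𝓡 ha
    have h1 := proj_mem_span hB hhom hax (δ + γ)
    rw [proj_smul_of_mem hB a hγ, add_sub_cancel_right] at h1
    obtain ⟨y, -, hy⟩ := h.exists_mul_eq_one _ _ (proj_mem 𝓡 δ a) hδ
    have h2 := Submodule.smul_mem _ y h1
    rwa [smul_smul, mul_comm, hy, one_smul] at h2
  have hspan : ⊤ ≤ Submodule.span R (Set.range fun x : s => ((x : {x : B // ∃ γ, x ∈ 𝓑 γ}) : B)) := by
    rintro y -
    have : (Set.range fun x : s => ((x : {x : B // ∃ γ, x ∈ 𝓑 γ}) : B)) =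
        (fun x : {x : B // ∃ γ, x ∈ 𝓑 γ} => (x : B)) '' s := by
      ext; simp
    rw [this]
    induction y using induction_homogeneous (𝓐 := 𝓑) with
    | h0 => exact zero_mem _
    | hom γ y hy => exact hmem ⟨y, γ, hy⟩
    | hadd x y hx hy => exact add_mem hx hy
  have hs' : LinearIndependent R fun x : s => ((x : {x : B // ∃ γ, x ∈ 𝓑 γ}) : B) := hs
  refine ⟨s, fun x => x.1.2.choose, Module.Basis.mk hs' hspan, ?_⟩
  intro i
  rw [Module.Basis.mk_apply]
  exact i.1.2.choose_spec

theorem IsGradedField.free (h : IsGradedField 𝓡)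
    (hB : ∀ (γ : Additive Γ) (x : R), x ∈ 𝓡 γ → algebraMap R B x ∈ 𝓑 γ) : Module.Free R B := by
  obtain ⟨ι, d, b, -⟩ := h.exists_homogeneous_basis hB
  exact Module.Free.of_basis b

theorem IsGradedField.faithfullyFlat (h : IsGradedField 𝓡) (h' : IsGradedField 𝓑)
    (hB : ∀ (γ : Additive Γ) (x : R), x ∈ 𝓡 γ → algebraMap R B x ∈ 𝓑 γ) :
    Module.FaithfullyFlat R B := by
  have := h.free hB
  have := h.nontrivial
  have := h'.nontrivial
  infer_instance

theorem IsGradedField.exists_finite_homogeneous_basis [Module.Finite R B] (h : IsGradedField 𝓡)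
    (hB : ∀ (γ : Additive Γ) (x : R), x ∈ 𝓡 γ → algebraMap R B x ∈ 𝓑 γ) :
    ∃ (ι : Type u) (_ : Fintype ι) (d : ι → Additive Γ) (b : Module.Basis ι R B),
      ∀ i, b i ∈ 𝓑 (d i) := by
  obtain ⟨ι, d, b, hb⟩ := h.exists_homogeneous_basis hB
  have := h.nontrivial
  have := Module.Finite.finite_basis b
  exact ⟨ι, Fintype.ofFinite ι, d, b, hb⟩

theorem prod_mem_graded {ι : Type*} (s : Finset ι) (x : ι → R) (d : ι → Additive Γ)
    (hx : ∀ i ∈ s, x i ∈ 𝓡 (d i)) : ∏ i ∈ s, x i ∈ 𝓡 (∑ i ∈ s, d i) := by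
  classical
  induction s using Finset.induction_on with
  | empty => simpa using SetLike.one_mem_graded 𝓡
  | insert i s hi ih =>
    rw [Finset.prod_insert hi, Finset.sum_insert hi]
    exact SetLike.mul_mem_graded (hx i (by simp)) (ih fun j hj => hx j (by simp [hj]))

/-- Each Leibniz term takes one entry in every column, so all terms have the same degree. Over a
graded field such a determinant is a unit as soon as it is nonzero. -/
theorem det_mem_graded {ι : Type*} [Fintype ι] [DecidableEq ι] (m : Matrix ι ι R)
    (d : ι → Additive Γ) (hm : ∀ i j, m i j ∈ 𝓡 (d j)) : m.det ∈ 𝓡 (∑ j, d j) := by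
  rw [Matrix.det_apply]
  refine sum_mem fun σ _ => ?_
  rw [Units.smul_def]
  refine zsmul_mem ?_ _
  have h1 := prod_mem_graded (𝓡 := 𝓡) Finset.univ (fun i => m (σ i) i) d (fun i _ => hm _ _)
  exact h1

end GradedModules

/-! ### Points of an algebra with values in a domain -/

section Splitting

variable {R D B X : Type*} [CommRing R] [CommRing D] [Algebra R D] [CommRing B] [Algebra R B]

/-- The `D`-algebra morphism `D ⊗ B → D^X` given by a family of morphisms `B → D`. -/
def evalAll (φ : X → (B →ₐ[R] D)) : D ⊗[R] B →ₐ[D] (X → D) :=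
  AlgHom.pi fun x => Algebra.TensorProduct.lift (Algebra.ofId D D) (φ x)
    (fun _ _ => Commute.all _ _)

theorem evalAll_tmul (φ : X → (B →ₐ[R] D)) (d : D) (b : B) (x : X) :
    evalAll φ (d ⊗ₜ b) x = d * φ x b := by
  simp [evalAll]

theorem linearIndependent_algHom [IsDomain D] {φ : X → (B →ₐ[R] D)}
    (hφ : Function.Injective φ) : LinearIndependent D (fun x : X => (fun a => φ x a : B → D)) := by
  have h := (linearIndependent_monoidHom B D).comp
    (fun x => ((φ x : B →+* D) : B →* D)) (fun x y h => hφ (by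
      ext b
      exact DFunLike.congr_fun h b))
  exact h

variable {J : Type*} [Fintype J] (b : Module.Basis J R B)

/-- A relation between the values on the basis extends by linearity to all of B, so Dedekind's
independence of characters already holds for these finite vectors. This bounds the number of points
by the rank. -/
theorem linearIndependent_algHom_basis [IsDomain D] {φ : X → (B →ₐ[R] D)}
    (hφ : Function.Injective φ) : LinearIndependent D (fun x : X => (fun j => φ x (b j) : J → D)) := by
  rw [linearIndependent_iff']
  intro s g hg
  have h0 : LinearIndependent D (fun x : X => (fun a => φ x a : B → D)) :=
    linearIndependent_algHom hφ
  have key := linearIndependent_iff'.1 h0 s g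
  have hj : ∀ j, ∑ x ∈ s, g x * φ x (b j) = 0 := fun j => by
    have := congrFun hg j
    rwa [Finset.sum_apply] at this
  have ha : ∀ a x, φ x a = ∑ j, b.repr a j • φ x (b j) := fun a x => by
    conv_lhs => rw [← b.sum_repr a, map_sum]
    exact Finset.sum_congr rfl fun j _ => map_smul (φ x) _ _
  refine key (funext fun a => ?_)
  rw [Finset.sum_apply]
  change ∑ x ∈ s, g x * φ x a = 0
  have h1 : ∀ x ∈ s, g x * φ x a = ∑ j, b.repr a j • (g x * φ x (b j)) := fun x _ => by
    rw [ha, Finset.mul_sum]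
    exact Finset.sum_congr rfl fun j _ => mul_smul_comm _ _ _
  rw [Finset.sum_congr rfl h1, Finset.sum_comm]
  refine Finset.sum_eq_zero fun j _ => ?_
  rw [← Finset.smul_sum, hj, smul_zero]

include b in
theorem card_algHom_le [IsDomain D] [Fintype X] {φ : X → (B →ₐ[R] D)}
    (hφ : Function.Injective φ) : Fintype.card X ≤ Fintype.card J := by
  simpa using (linearIndependent_algHom_basis b hφ).fintype_card_le_finrank

include b in
theorem finite_algHom_of_basis [IsDomain D] : Finite (B →ₐ[R] D) := by
  by_contra h
  rw [not_finite_iff_infinite] at h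
  obtain ⟨s, hs⟩ := Infinite.exists_subset_card_eq (B →ₐ[R] D) (Fintype.card J + 1)
  have := card_algHom_le b (X := s) (φ := fun x => x.1) Subtype.val_injective
  simp [hs] at this

theorem det_ne_zero_of_injective [IsDomain D] [DecidableEq J] {φ : J → (B →ₐ[R] D)}
    (hφ : Function.Injective φ) : (Matrix.of fun x j => φ x (b j)).det ≠ 0 := by
  intro h0
  obtain ⟨v, hv, hv0⟩ := Matrix.exists_vecMul_eq_zero_iff.2 h0
  refine hv ?_
  have h1 := linearIndependent_algHom_basis b hφ
  rw [Fintype.linearIndependent_iff] at h1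
  ext x
  refine h1 v ?_ x
  ext j
  simpa [Matrix.vecMul, dotProduct] using congrFun hv0 j

/-- In the basis of D ⊗ B given by b, evaluation at the points is multiplication by the matrix of
the φ x (b j). -/
theorem bijective_evalAll [DecidableEq J] {φ : J → (B →ₐ[R] D)}
    (hdet : IsUnit (Matrix.of fun x j => φ x (b j)).det) : Function.Bijective (evalAll φ) := by
  set m : Matrix J J D := Matrix.of fun x j => φ x (b j) with hm
  have h1 : ∀ t, evalAll φ t = m.mulVec ((b.baseChange D).equivFun t) := by
    intro t
    ext x
    rw [← (b.baseChange D).sum_repr t]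
    simp only [map_sum, map_smul, Finset.sum_apply, Pi.smul_apply, Module.Basis.baseChange_apply,
      evalAll_tmul, Matrix.mulVec, dotProduct, Module.Basis.equivFun_apply,
      Matrix.of_apply, hm, smul_eq_mul]
    simp [mul_comm]
  have h2 : (evalAll φ : D ⊗[R] B → (J → D)) = m.mulVec ∘ (b.baseChange D).equivFun :=
    funext h1
  rw [h2]
  refine Function.Bijective.comp ?_ (b.baseChange D).equivFun.bijective
  exact ⟨Matrix.mulVec_injective_of_isUnit ((Matrix.isUnit_iff_isUnit_det m).2 hdet),
    Matrix.mulVec_surjective_iff_isUnit.2 ((Matrix.isUnit_iff_isUnit_det m).2 hdet)⟩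

end Splitting

end GradedRamification
end

noncomputable section
namespace GradedRamification

section Splitting

variable {R D B X J : Type*} [CommRing R] [CommRing D] [Algebra R D] [CommRing B] [Algebra R B]
  [Fintype J]

/-- If `D ⊗ B` is a product of `n` copies of the domain `D`, its `n` coordinates are the
morphisms from `B` to `D`. -/
theorem exists_coordinates [IsDomain D] (b : Module.Basis J R B) {n : ℕ}
    (e : (D ⊗[R] B) ≃ₐ[D] (Fin n → D)) :
    ∃ ψ : Fin n → (B →ₐ[R] D), (∀ i a, ψ i a = e (1 ⊗ₜ a) i) ∧ Function.Bijective ψ ∧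
      Fintype.card J = n := by
  have hcard : Fintype.card J = n := by
    have h1 := Module.finrank_eq_card_basis (b.baseChange D)
    rw [e.toLinearEquiv.finrank_eq, Module.finrank_fin_fun] at h1
    exact h1.symm
  let ψ : Fin n → (B →ₐ[R] D) := fun i =>
    (((Pi.evalAlgHom D (fun _ : Fin n => D) i).comp e.toAlgHom).restrictScalars R).comp
      Algebra.TensorProduct.includeRight
  have hψ : ∀ i a, ψ i a = e (1 ⊗ₜ a) i := fun _ _ => rfl
  -- If ψ i = ψ j, the coordinates i and j agree on all of D ⊗ B by D-linearity; the idempotent of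
  -- index i contradicts this.
  have hinj : Function.Injective ψ := by
    intro i j hij
    have h1 : ∀ t, e t i = e t j := by
      intro t
      induction t with
      | zero => simp
      | add x y hx hy => simp only [map_add, Pi.add_apply, hx, hy]
      | tmul d a =>
        have h2 : d ⊗ₜ[R] a = d • ((1 : D) ⊗ₜ[R] a) := by
          rw [TensorProduct.smul_tmul', smul_eq_mul, mul_one]
        rw [h2, map_smul, Pi.smul_apply, Pi.smul_apply, ← hψ, ← hψ, hij]
    by_contra hne
    have h3 := h1 (e.symm (Pi.single i 1))
    rw [AlgEquiv.apply_symm_apply, Pi.single_eq_same, Pi.single_eq_of_ne (Ne.symm hne)] at h3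
    exact one_ne_zero h3
  have : Finite (B →ₐ[R] D) := finite_algHom_of_basis b
  have : Fintype (B →ₐ[R] D) := Fintype.ofFinite _
  refine ⟨ψ, hψ, (Fintype.bijective_iff_injective_and_card ψ).2 ⟨hinj, ?_⟩, hcard⟩
  refine le_antisymm (Fintype.card_le_of_injective ψ hinj) ?_
  rw [Fintype.card_fin, ← hcard]
  exact card_algHom_le b (φ := id) Function.injective_id

-- Elements with the same values at all points agree after base change to D. Comparing coordinates
-- in a basis, they agree in B because R embeds in D.
omit [Fintype J] in
theorem eq_of_forall_algHom_eq (b : Module.Basis J R B)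
    (hinj : Function.Injective (algebraMap R D)) {φ : X → (B →ₐ[R] D)}
    (hφ : Function.Bijective (evalAll φ)) {a a' : B} (h : ∀ x, φ x a = φ x a') : a = a' := by
  have h1 : (1 : D) ⊗ₜ[R] a = 1 ⊗ₜ a' := by
    refine hφ.1 (funext fun x => ?_)
    rw [evalAll_tmul, evalAll_tmul, h]
  refine b.repr.injective (Finsupp.ext fun j => hinj ?_)
  have h2 := congrArg (fun t => (b.baseChange D).repr t j) h1
  simpa [Module.Basis.baseChange_repr_tmul, Algebra.smul_def] using h2

/-- Galois descent: an equivariant function is given by an element. -/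
theorem exists_of_equivariant (b : Module.Basis J R B) {φ : X → (B →ₐ[R] D)}
    (hφ : Function.Bijective (evalAll φ)) {G : Type*} (ρ : G → (D →ₐ[R] D))
    (hinv : ∀ d, (∀ g, ρ g d = d) → ∃ r, algebraMap R D r = d) (act : G → X → X)
    (hsurj : ∀ g, Function.Surjective (act g)) (hact : ∀ g x a, φ (act g x) a = ρ g (φ x a))
    (f : X → D) (hf : ∀ g x, f (act g x) = ρ g (f x)) : ∃ a, ∀ x, φ x a = f x := by
  -- The function f comes from a unique t in D ⊗ B. Equivariance makes t invariant under the ρ g ⊗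
  -- 1, so its coordinates in b are invariant, hence come from R.
  obtain ⟨t, ht⟩ := hφ.2 f
  have h1 : ∀ g x s, evalAll φ (Algebra.TensorProduct.map (ρ g) (AlgHom.id R B) s) (act g x) =
      ρ g (evalAll φ s x) := by
    intro g x s
    induction s with
    | zero => simp
    | add y z hy hz => simp only [map_add, Pi.add_apply, hy, hz]
    | tmul d a =>
      rw [Algebra.TensorProduct.map_tmul, evalAll_tmul, evalAll_tmul, map_mul, hact]
      rfl
  have h2 : ∀ g, Algebra.TensorProduct.map (ρ g) (AlgHom.id R B) t = t := by
    intro g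
    refine hφ.1 (funext fun x => ?_)
    obtain ⟨y, rfl⟩ := hsurj g x
    rw [h1, ht, hf]
  have h3 : ∀ g s j, (b.baseChange D).repr
      (Algebra.TensorProduct.map (ρ g) (AlgHom.id R B) s) j = ρ g ((b.baseChange D).repr s j) := by
    intro g s j
    induction s with
    | zero => simp
    | add y z hy hz => simp only [map_add, Finsupp.add_apply, hy, hz]
    | tmul d a =>
      rw [Algebra.TensorProduct.map_tmul, Module.Basis.baseChange_repr_tmul,
        Module.Basis.baseChange_repr_tmul, map_smul]
      rfl
  choose r hr using fun j => hinv ((b.baseChange D).repr t j) (fun g => by rw [← h3, h2])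
  refine ⟨∑ j, r j • b j, fun x => ?_⟩
  rw [← ht, ← (b.baseChange D).sum_repr t, map_sum, map_sum, Finset.sum_apply]
  refine Finset.sum_congr rfl fun j _ => ?_
  rw [map_smul, map_smul, Pi.smul_apply, Module.Basis.baseChange_apply, evalAll_tmul, ← hr,
    one_mul, smul_eq_mul, Algebra.smul_def]

end Splitting

/-! ### Splitting by a graded field -/

section GradedSplitting

variable {Γ : Type u} [CommGroup Γ] [LinearOrder Γ]

/-- A degree-preserving and jointly injective family of maps detects the degrees of a
tensor product. -/
theorem mem_tensorDeg_iff {R A B C : Type u} [CommRing R] [CommRing A] [CommRing B] [CommRing C]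
    [Algebra R A] [Algebra R B] (𝓐 : Additive Γ → AddSubgroup A) (𝓑 : Additive Γ → AddSubgroup B)
    (𝓒 : Additive Γ → AddSubgroup C) [GradedRing 𝓐] [GradedRing 𝓑] [GradedRing 𝓒] {I : Type*}
    (ψ : I → (A ⊗[R] B →+ C)) (hψ : ∀ t, (∀ i, ψ i t = 0) → t = 0)
    (hdeg : ∀ i γ δ, ∀ a ∈ 𝓐 γ, ∀ b ∈ 𝓑 δ, ψ i (a ⊗ₜ b) ∈ 𝓒 (γ + δ)) (γ : Additive Γ)
    (t : A ⊗[R] B) : t ∈ tensorDeg 𝓐 𝓑 γ ↔ ∀ i, ψ i t ∈ 𝓒 γ := by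
  constructor
  · intro ht i
    induction ht using AddSubgroup.closure_induction with
    | mem x hx =>
      obtain ⟨p, q, rfl, a, ha, b, hb, rfl⟩ := hx
      exact hdeg i p q a ha b hb
    | zero => rw [map_zero]; exact zero_mem _
    | add x y _ _ hx hy => rw [map_add]; exact add_mem hx hy
    | neg x _ hx => rw [map_neg]; exact neg_mem hx
  -- The components of degree γ of all the ψ i s come from a single s' in the component of degree γ
  -- of the tensor product. Joint injectivity then identifies t with its own s'.
  · have key : ∀ s : A ⊗[R] B, ∃ s' ∈ tensorDeg 𝓐 𝓑 γ,
        ∀ i, GradedRing.proj 𝓒 γ (ψ i s) = ψ i s' := by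
      intro s
      induction s with
      | zero => exact ⟨0, zero_mem _, by simp⟩
      | add x y hx hy =>
        obtain ⟨x', hx', h1⟩ := hx
        obtain ⟨y', hy', h2⟩ := hy
        exact ⟨x' + y', add_mem hx' hy', fun i => by simp only [map_add, h1, h2]⟩
      | tmul a b =>
        induction a using induction_homogeneous (𝓐 := 𝓐) with
        | h0 => exact ⟨0, zero_mem _, by simp⟩
        | hadd x y hx hy =>
          obtain ⟨x', hx', h1⟩ := hx
          obtain ⟨y', hy', h2⟩ := hy
          exact ⟨x' + y', add_mem hx' hy', fun i => by simp only [map_add, add_tmul, h1, h2]⟩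
        | hom p a ha =>
          induction b using induction_homogeneous (𝓐 := 𝓑) with
          | h0 => exact ⟨0, zero_mem _, by simp⟩
          | hadd x y hx hy =>
            obtain ⟨x', hx', h1⟩ := hx
            obtain ⟨y', hy', h2⟩ := hy
            exact ⟨x' + y', add_mem hx' hy', fun i => by simp only [map_add, tmul_add, h1, h2]⟩
          | hom q b hb =>
            by_cases hpq : p + q = γ
            · subst hpq
              exact ⟨a ⊗ₜ b, AddSubgroup.subset_closure ⟨p, q, rfl, a, ha, b, hb, rfl⟩,
                fun i => proj_of_mem _ (hdeg i p q a ha b hb)⟩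
            · exact ⟨0, zero_mem _, fun i => by
                rw [proj_of_mem_ne _ (hdeg i p q a ha b hb) hpq, map_zero]⟩
    intro ht
    obtain ⟨s, hs, h1⟩ := key t
    have h2 : t - s = 0 := hψ _ fun i => by
      rw [map_sub, ← h1, proj_of_mem _ (ht i), sub_self]
    rwa [sub_eq_zero.1 h2]

variable [IsOrderedMonoid Γ] {R : Type u} [CommRing R] {𝓡 : Additive Γ → AddSubgroup R}

/-- The determinant of the values on a homogeneous basis is nonzero by Dedekind and homogeneous,
hence invertible. Thus over a graded field, as over a field, it suffices to find as many points as
the rank. -/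
theorem bijective_evalAll_of_homogeneous {D B : GrAlg R 𝓡} (hD : IsGradedField D.deg)
    {J : Type*} [Fintype J] {d : J → Additive Γ} (b : Module.Basis J R B.carrier)
    (hb : ∀ j, b j ∈ B.deg (d j)) {X : Type*} {φ : X → (B.carrier →ₐ[R] D.carrier)}
    (hφ : Function.Injective φ) (hdeg : ∀ x γ, ∀ a ∈ B.deg γ, φ x a ∈ D.deg γ) (e : X ≃ J) :
    Function.Bijective (evalAll φ) := by
  classical
  have := hD.isDomain
  have h1 : Function.Bijective (evalAll (φ ∘ e.symm)) := by
    refine bijective_evalAll b (hD.isUnit (det_mem_graded _ d ?_)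
      (det_ne_zero_of_injective b (hφ.comp e.symm.injective)))
    intro i j
    exact hdeg _ _ _ (hb j)
  have h2 : (evalAll φ : D.carrier ⊗[R] B.carrier → (X → D.carrier)) =
      (fun f x => f (e x)) ∘ evalAll (φ ∘ e.symm) := by
    ext t x
    induction t with
    | zero => simp
    | add y z hy hz => simp only [map_add, Pi.add_apply, hy, hz, Function.comp_apply]
    | tmul d a => simp [evalAll_tmul]
  rw [h2]
  exact (Equiv.arrowCongr e.symm (Equiv.refl D.carrier)).bijective.comp h1

theorem splitBy_of_algHom {D B : GrAlg R 𝓡} (hD : IsGradedField D.deg)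
    {J : Type*} [Fintype J] {d : J → Additive Γ} (b : Module.Basis J R B.carrier)
    (hb : ∀ j, b j ∈ B.deg (d j)) {φ : J → (B.carrier →ₐ[R] D.carrier)}
    (hφ : Function.Injective φ) (hdeg : ∀ x γ, ∀ a ∈ B.deg γ, φ x a ∈ D.deg γ) :
    SplitBy B D := by
  let ε := Fintype.equivFin J
  have h1 := bijective_evalAll_of_homogeneous hD b hb (φ := φ ∘ ε.symm)
    (hφ.comp ε.symm.injective) (fun x => hdeg _) ε.symm
  refine ⟨_, AlgEquiv.ofBijective _ h1, fun γ t => ?_⟩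
  refine mem_tensorDeg_iff D.deg B.deg D.deg
    (fun i => (Pi.evalAddMonoidHom _ i).comp (evalAll (φ ∘ ε.symm)).toAddMonoidHom) ?_ ?_ γ t
  · intro t ht
    exact h1.1 ((funext ht).trans (map_zero (evalAll (φ ∘ ε.symm))).symm)
  · intro i γ δ a ha c hc
    change evalAll (φ ∘ ε.symm) (a ⊗ₜ c) i ∈ _
    rw [evalAll_tmul]
    exact SetLike.mul_mem_graded ha (hdeg _ _ _ hc)

end GradedSplitting

end GradedRamification
end

noncomputable section
namespace GradedRamification

/-! ### Lifting automorphisms of the reduction to the Galois group -/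

section Decomposition

/-- If the profinite group `G` acts continuously on the discrete ring `B` and `θ` is a morphism
from `B` onto a domain, the automorphisms of this domain that fix the images of the invariants
come from `G`. -/
theorem exists_smul_eq_of_profinite {B C : Type*} {G : Type u} [Group G] [TopologicalSpace G]
    [CompactSpace G] [TotallyDisconnectedSpace G] [IsTopologicalGroup G] [CommRing B]
    [MulSemiringAction G B] (hG : ∀ b : B, IsOpen (MulAction.stabilizer G b : Set G))
    [CommRing C] [IsDomain C] (θ : B →+* C) (hθ : Function.Surjective θ) (φ : C ≃+* C)
    (hφ : ∀ b : B, (∀ g : G, g • b = b) → φ (θ b) = θ b) :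
    ∃ g : G, ∀ b, θ (g • b) = φ (θ b) := by
  let : TopologicalSpace B := ⊥
  have : DiscreteTopology B := ⟨rfl⟩
  have : ContinuousSMul G B := continuousSMul_iff_stabilizer_isOpen.2 hG
  let A := FixedPoints.subring B G
  have : Algebra.IsInvariant A B G := ⟨fun b hb => ⟨⟨b, hb⟩, rfl⟩⟩
  let Q : Ideal B := RingHom.ker θ
  have : Q.IsPrime := RingHom.ker_isPrime θ
  let P : Ideal A := Q.under A
  have : Q.LiesOver P := ⟨rfl⟩
  let e : B ⧸ Q ≃+* C := RingHom.quotientKerEquivOfSurjective hθ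
  have he : ∀ b, e (Ideal.Quotient.mk Q b) = θ b := fun b => rfl
  let σ : (B ⧸ Q) ≃ₐ[A ⧸ P] (B ⧸ Q) := AlgEquiv.ofRingEquiv (f := e.trans (φ.trans e.symm)) (by
    intro a
    obtain ⟨a, rfl⟩ := Ideal.Quotient.mk_surjective a
    change e.symm (φ (e (Ideal.Quotient.mk Q (a : B)))) = Ideal.Quotient.mk Q (a : B)
    rw [he, hφ _ a.2, ← he, RingEquiv.symm_apply_apply])
  -- The decomposition group of the prime ker θ surjects onto the automorphisms of B / ker θ over
  -- the image of the invariants, and φ is transported to such an automorphism.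
  obtain ⟨g, hg⟩ := Ideal.Quotient.stabilizerHom_surjective_of_profinite (G := G) P Q σ
  refine ⟨g.1, fun b => ?_⟩
  have h1 : σ (Ideal.Quotient.mk Q b) = Ideal.Quotient.mk Q (g.1 • b) := by
    rw [← hg]
    rfl
  rw [← he, ← h1]
  change e (e.symm (φ (e (Ideal.Quotient.mk Q b)))) = _
  rw [RingEquiv.apply_symm_apply, he]

variable {Γ : Type u} [CommGroup Γ] [LinearOrder Γ] [IsOrderedMonoid Γ]

instance closedBall_gradedMonoid {A : Type u} [CommRing A] (S : Set (Valuation A (WithZero Γ))) :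
    SetLike.GradedMonoid (closedBall S) where
  one_mem := one_mem_closedBall
  mul_mem _ _ _ _ ha hb := mul_mem_closedBall ha hb

/-- The Rees ring `⨁_r A_{≤ r}`. -/
abbrev Rees {A : Type u} [CommRing A] (S : Set (Valuation A (WithZero Γ))) : Type u :=
  DirectSum (Additive Γ) fun r => closedBall S r

/-- The inclusion of `A_{≤ r}` in the Rees ring. -/
abbrev Rees.of {A : Type u} [CommRing A] (S : Set (Valuation A (WithZero Γ))) (r : Additive Γ) :
    closedBall S r →+ Rees S :=
  DirectSum.of (fun r => closedBall S r) r

/-- The projection of the Rees ring onto the graded reduction. -/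
def reesProj {A : Type u} [CommRing A] (S : Set (Valuation A (WithZero Γ))) : Rees S →+* GRed S :=
  DirectSum.toSemiring (fun r => (GRed.of S r).comp (QuotientAddGroup.mk' _))
    rfl (fun {r s} a b =>
      (DirectSum.of_mul_of (A := Piece S) (Piece.mk r a.1 a.2) (Piece.mk s b.1 b.2)).symm)

theorem reesProj_of {A : Type u} [CommRing A] (S : Set (Valuation A (WithZero Γ)))
    (r : Additive Γ) (a : closedBall S r) : reesProj S (Rees.of S r a) = cls S r a := by
  rw [cls_of_mem a.2]
  exact DirectSum.toSemiring_of _ _ _ _ _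

theorem reesProj_surjective {A : Type u} [CommRing A] (S : Set (Valuation A (WithZero Γ))) :
    Function.Surjective (reesProj S) := by
  intro x
  induction x using GRed.ind with
  | h0 => exact ⟨0, map_zero _⟩
  | hof r x =>
    obtain ⟨a, ha, h⟩ := exists_cls_of_mem (S := S) (r := r) (x := GRed.of S r x) ⟨x, rfl⟩
    exact ⟨Rees.of S r ⟨a, ha⟩, by rw [reesProj_of, h]⟩
  | hadd x y hx hy =>
    obtain ⟨a, rfl⟩ := hx
    obtain ⟨b, rfl⟩ := hy
    exact ⟨a + b, map_add _ _ _⟩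

/-- The endomorphism of the Rees ring given by a norm-preserving endomorphism. -/
def reesMap {A : Type u} [CommRing A] {S : Set (Valuation A (WithZero Γ))} (f : A →+* A)
    (hf : ∀ w ∈ S, w.comap f ∈ S) : Rees S →+* Rees S :=
  DirectSum.toSemiring (fun r => (Rees.of S r).comp
      ((f.toAddMonoidHom.comp (closedBall S r).subtype).codRestrict (closedBall S r)
        (fun a w hw => a.2 _ (hf w hw))))
    (congrArg (Rees.of S 0) (Subtype.ext f.map_one))
    (fun {r s} a b => (congrArg (Rees.of S (r + s)) (Subtype.ext (f.map_mul a b))).trans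
      (DirectSum.of_mul_of _ _).symm)

theorem reesMap_of {A : Type u} [CommRing A] {S : Set (Valuation A (WithZero Γ))} (f : A →+* A)
    (hf : ∀ w ∈ S, w.comap f ∈ S) (r : Additive Γ) (a : closedBall S r) :
    reesMap f hf (Rees.of S r a) = Rees.of S r ⟨f a, fun w hw => a.2 _ (hf w hw)⟩ :=
  DirectSum.toSemiring_of _ _ _ _ _

theorem coe_reesMap_apply {A : Type u} [CommRing A] {S : Set (Valuation A (WithZero Γ))}
    (f : A →+* A) (hf : ∀ w ∈ S, w.comap f ∈ S) (x : Rees S) (r : Additive Γ) :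
    ((reesMap f hf x) r : A) = f (x r) := by
  induction x using DirectSum.induction_on with
  | zero => simp
  | of s a =>
    rw [reesMap_of]
    by_cases h : s = r
    · subst h
      rw [DirectSum.of_eq_same, DirectSum.of_eq_same]
    · rw [DirectSum.of_eq_of_ne _ _ _ (Ne.symm h), DirectSum.of_eq_of_ne _ _ _ (Ne.symm h)]
      simp
  | add x y hx hy =>
    rw [map_add, DirectSum.add_apply, DirectSum.add_apply, AddSubgroup.coe_add, hx, hy,
      AddSubgroup.coe_add, map_add]

/-- The automorphisms of the graded reduction of a Galois extension `L` of `K` that fix the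
classes of the elements of `K` come from the Galois group. -/
theorem exists_galois_cls_eq {K L : Type u} [Field K] [Field L] [Algebra K L] [IsGalois K L]
    (w : Valuation L (WithZero Γ)) (hw : ∀ (g : Gal(L/K)) x, w (g x) = w x)
    (φ : GRed ({w} : Set (Valuation L (WithZero Γ))) ≃+*
      GRed ({w} : Set (Valuation L (WithZero Γ))))
    (hφ : ∀ r (x : K), φ (cls {w} r (algebraMap K L x)) = cls {w} r (algebraMap K L x)) :
    ∃ g : Gal(L/K), ∀ r (x : L), w x ≤ radius r → φ (cls {w} r x) = cls {w} r (g x) := by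
  classical
  let S : Set (Valuation L (WithZero Γ)) := {w}
  have hS : ∀ g : Gal(L/K), ∀ w' ∈ S, w'.comap (g : L →+* L) ∈ S := by
    intro g w' hw'
    rw [show w' = w from hw']
    exact Valuation.ext fun x => hw g x
  -- The reduction is the quotient of the Rees ring by a prime ideal, and invariant elements of the
  -- Rees ring have their components in K. This gives the lifting problem the shape of a
  -- decomposition group.
  let act : MulSemiringAction Gal(L/K) (Rees S) :=
    { smul := fun g x => reesMap (g : L →+* L) (hS g) x
      one_smul := fun x => by
        ext r
        exact coe_reesMap_apply _ _ x r
      mul_smul := fun g h x => by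
        ext r
        refine (coe_reesMap_apply _ _ x r).trans ?_
        refine Eq.trans ?_ (coe_reesMap_apply _ _ _ r).symm
        exact congrArg g (coe_reesMap_apply (h : L →+* L) (hS h) x r).symm
      smul_zero := fun g => map_zero (reesMap (g : L →+* L) (hS g))
      smul_add := fun g => map_add (reesMap (g : L →+* L) (hS g))
      smul_one := fun g => map_one (reesMap (g : L →+* L) (hS g))
      smul_mul := fun g => map_mul (reesMap (g : L →+* L) (hS g)) }
  have hsmul : ∀ (g : Gal(L/K)) (x : Rees S) r, ((g • x) r : L) = g (x r) := fun g x r =>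
    coe_reesMap_apply _ _ x r
  have hopen : ∀ x : Rees S, IsOpen (MulAction.stabilizer Gal(L/K) x : Set Gal(L/K)) := by
    intro x
    induction x using DirectSum.induction_on with
    | zero =>
      convert isOpen_univ
      ext g
      simp
    | of r a =>
      refine Subgroup.isOpen_mono ?_ (stabilizer_isOpen_of_isIntegral (K := K) (a : L))
      intro g hg
      refine (reesMap_of _ _ r a).trans (congrArg _ (Subtype.ext hg))
    | add x y hx hy =>
      refine Subgroup.isOpen_mono (H₁ := MulAction.stabilizer Gal(L/K) x ⊓
        MulAction.stabilizer Gal(L/K) y) ?_ (hx.inter hy)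
      rintro g ⟨h1, h2⟩
      rw [MulAction.mem_stabilizer_iff, smul_add]
      exact congrArg₂ _ h1 h2
  have : IsDomain (GRed S) := (isGradedField_redDeg w).isDomain
  -- The components of an invariant element lie in K by Galois theory, and φ fixes their classes.
  obtain ⟨g, hg⟩ := exists_smul_eq_of_profinite hopen (reesProj S) (reesProj_surjective S) φ (by
    intro x hx
    rw [← DirectSum.sum_support_of x]
    simp only [map_sum]
    refine Finset.sum_congr rfl fun r _ => ?_
    obtain ⟨y, hy⟩ := (InfiniteGalois.mem_range_algebraMap_iff_fixed (k := K) ((x r : L))).2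
      (fun g => by rw [← hsmul, hx])
    rw [reesProj_of, ← hy]
    exact hφ r y)
  refine ⟨g, fun r x hx => ?_⟩
  have h1 := hg (Rees.of S r ⟨x, mem_closedBall_singleton.2 hx⟩)
  rw [reesProj_of] at h1
  rw [← h1]
  change reesProj S (reesMap _ _ _) = _
  rw [reesMap_of, reesProj_of]
  rfl

end Decomposition

end GradedRamification
end

noncomputable section
namespace GradedRamification

/-! ### The graded inertia group and the field M -/

section Inertia

set_option linter.unusedSectionVars false

variable {Γ : Type u} [CommGroup Γ] [LinearOrder Γ] [IsOrderedMonoid Γ]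

section General

variable {k : Type u} [Field k] {v : Valuation k (WithZero Γ)}

theorem mem_closedBall_extensions {A : Type u} [CommRing A] [Algebra k A]
    {w : Valuation A (WithZero Γ)} (hw : extensions v A = {w}) {r : Additive Γ} {a : A} :
    a ∈ closedBall (extensions v A) r ↔ w a ≤ radius r := by
  rw [hw, mem_closedBall_singleton]

theorem mem_openBall_extensions {A : Type u} [CommRing A] [Algebra k A]
    {w : Valuation A (WithZero Γ)} (hw : extensions v A = {w}) {r : Additive Γ} {a : A} :
    a ∈ openBall (extensions v A) r ↔ w a < radius r := by
  rw [hw, mem_openBall_singleton]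

theorem cls_algebraMap {A : Type u} [CommRing A] [Algebra k A] {r : Additive Γ} {x : k}
    (hx : v x ≤ radius r) :
    algebraMap (ResField v) (GRed (extensions v A)) (cls {v} r x) =
      cls (extensions v A) r (algebraMap k A x) :=
  redMap_cls _ _ (mem_closedBall_singleton.2 hx)

/-- The morphism between graded reductions given by a morphism of `k`-algebras. -/
def redAlgHom {A B : Type u} [CommRing A] [Algebra k A] [CommRing B] [Algebra k B]
    (v : Valuation k (WithZero Γ)) (f : A →ₐ[k] B) :
    GRed (extensions v A) →ₐ[ResField v] GRed (extensions v B) :=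
  ((red v).map (CommAlgCat.ofHom f)).toAlgHom

theorem map_mem_closedBall {A B : Type u} [CommRing A] [Algebra k A] [CommRing B] [Algebra k B]
    (f : A →ₐ[k] B) {r : Additive Γ} {a : A} (ha : a ∈ closedBall (extensions v A) r) :
    f a ∈ closedBall (extensions v B) r := fun w hw =>
  ha _ (comap_mem_extensions f w hw)

theorem redAlgHom_cls {A B : Type u} [CommRing A] [Algebra k A] [CommRing B] [Algebra k B]
    (f : A →ₐ[k] B) {r : Additive Γ} {a : A} (ha : a ∈ closedBall (extensions v A) r) :
    redAlgHom v f (cls (extensions v A) r a) = cls (extensions v B) r (f a) :=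
  redMap_cls _ _ ha

theorem redAlgHom_mem {A B : Type u} [CommRing A] [Algebra k A] [CommRing B] [Algebra k B]
    (f : A →ₐ[k] B) {r : Additive Γ} {x : GRed (extensions v A)}
    (hx : x ∈ redDeg (extensions v A) r) : redAlgHom v f x ∈ redDeg (extensions v B) r :=
  ((red v).map (CommAlgCat.ofHom f)).map_mem r x hx

/-- Morphisms from a graded reduction are determined by the images of classes. -/
theorem redAlgHom_ext {A : Type u} [CommRing A] [Algebra k A] {C : Type u} [CommRing C]
    [Algebra (ResField v) C] {f g : GRed (extensions v A) →ₐ[ResField v] C}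
    (h : ∀ (r : Additive Γ), ∀ a ∈ closedBall (extensions v A) r,
      f (cls (extensions v A) r a) = g (cls (extensions v A) r a)) : f = g :=
  AlgHom.coe_ringHom_injective (GRed.ringHom_ext_cls h)

theorem redAlgHom_comp {A B C : Type u} [CommRing A] [Algebra k A] [CommRing B] [Algebra k B]
    [CommRing C] [Algebra k C] (g : B →ₐ[k] C) (f : A →ₐ[k] B) :
    redAlgHom v (g.comp f) = (redAlgHom v g).comp (redAlgHom v f) :=
  redAlgHom_ext fun r a ha => by
    rw [redAlgHom_cls (g.comp f) ha, AlgHom.comp_apply, AlgHom.comp_apply, redAlgHom_cls f ha,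
      redAlgHom_cls g (map_mem_closedBall f ha)]

theorem redAlgHom_id {A : Type u} [CommRing A] [Algebra k A] :
    redAlgHom v (AlgHom.id k A) = AlgHom.id _ _ :=
  redAlgHom_ext fun r a ha => by
    rw [redAlgHom_cls _ ha, AlgHom.id_apply, AlgHom.id_apply]

/-- It suffices to compare the images of the class of x in degree |x|: they agree exactly when f x −
g x lies in the open ball of that radius. Inertia becomes a metric condition. -/
theorem redAlgHom_eq_iff {A B : Type u} [Field A] [Algebra k A] [Field B] [Algebra k B]
    {wA : Valuation A (WithZero Γ)} (hA : extensions v A = {wA})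
    {wB : Valuation B (WithZero Γ)} (hB : extensions v B = {wB}) (f g : A →ₐ[k] B) :
    redAlgHom v f = redAlgHom v g ↔ ∀ x ≠ 0, wB (f x - g x) < wA x := by
  constructor
  · intro h x hx
    obtain ⟨r, hr⟩ := exists_radius_eq ((Valuation.ne_zero_iff wA).2 hx)
    have hxr : x ∈ closedBall (extensions v A) r := (mem_closedBall_extensions hA).2 hr.ge
    have h1 := DFunLike.congr_fun h (cls (extensions v A) r x)
    rw [redAlgHom_cls _ hxr, redAlgHom_cls _ hxr,
      cls_eq_iff (map_mem_closedBall f hxr) (map_mem_closedBall g hxr),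
      mem_openBall_extensions hB, hr] at h1
    exact h1
  · intro h
    refine redAlgHom_ext fun r a ha => ?_
    have ha' := (mem_closedBall_extensions hA).1 ha
    rw [redAlgHom_cls _ ha, redAlgHom_cls _ ha,
      cls_eq_iff (map_mem_closedBall f ha) (map_mem_closedBall g ha), mem_openBall_extensions hB]
    by_cases h0 : a = 0
    · subst h0
      simpa using radius_pos r
    · exact (h a h0).trans_le ha'

theorem galRed_eq_iff {L : Type u} [Field L] [Algebra k L] {w : Valuation L (WithZero Γ)}
    (hw : extensions v L = {w}) (g h : Gal(L/k)) :
    galRed v L g = galRed v L h ↔ ∀ x ≠ 0, w (g x - h x) < w x := by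
  refine Iff.trans ?_ (redAlgHom_eq_iff hw hw (g : L →ₐ[k] L) (h : L →ₐ[k] L))
  exact ⟨fun h => congrArg GrAlg.Hom.toAlgHom h, fun h => GrAlg.Hom.ext h⟩

/-- The set `extensions v L` is a singleton only propositionally, and the type `GRed` depends on it,
so the substitution is isolated here. -/
theorem exists_galois_cls_eq' {K L : Type u} [Field K] [Field L] [Algebra K L] [IsGalois K L]
    (w : Valuation L (WithZero Γ)) (hw : ∀ (g : Gal(L/K)) x, w (g x) = w x)
    {S : Set (Valuation L (WithZero Γ))} (hS : S = {w}) (φ : GRed S ≃+* GRed S)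
    (hφ : ∀ r (x : K), φ (cls S r (algebraMap K L x)) = cls S r (algebraMap K L x)) :
    ∃ g : Gal(L/K), ∀ r (x : L), w x ≤ radius r → φ (cls S r x) = cls S r (g x) := by
  subst hS
  exact exists_galois_cls_eq w hw φ hφ

end General

variable {k : Type u} [Field k] {v : Valuation k (WithZero Γ)} (hv : Henselian v)
  {ks : Type u} [Field ks] [Algebra k ks] [IsSepClosure k ks] {w : Valuation ks (WithZero Γ)}
  (hw : extensions v ks = {w})

include hw in
theorem valuation_galois_apply (g : Gal(ks/k)) (x : ks) : w (g x) = w x :=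
  comap_eq_of_extensions_eq hw hw (g : ks →ₐ[k] ks) x

-- Every x lies in a finite Galois subextension, whose valuation is the restriction of w. Inertia
-- can thus be tested in `ks` itself, without the projective limit.
include hv hw in
theorem mem_sepInertia_iff (g : Gal(ks/k)) :
    g ∈ sepInertia v ks ↔ ∀ x ≠ 0, w (g x - x) < w x := by
  have key : ∀ L : FiniteGaloisIntermediateField k ks,
      AlgEquiv.restrictNormalHom (F := k) (K₁ := ks) L g ∈ inertia v L ↔
        ∀ x ∈ L.toIntermediateField, x ≠ 0 → w (g x - x) < w x := by
    intro L
    obtain ⟨wL, hL⟩ := hv.exists_extensions_eq L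
    have hwL : ∀ x : L, w x = wL x := fun x =>
      comap_eq_of_extensions_eq hL hw (IntermediateField.val L.toIntermediateField) x
    rw [inertia, MonoidHom.mem_ker, ← map_one (galRed v L), galRed_eq_iff hL]
    constructor
    · intro h x hx h0
      have h1 := h ⟨x, hx⟩ (fun h => h0 (congrArg Subtype.val h))
      rw [← hwL, ← hwL] at h1
      simpa [AlgEquiv.restrictNormalHom_apply] using h1
    · intro h x h0
      have h1 := h x x.2 (fun h => h0 (Subtype.ext h))
      rw [← hwL, ← hwL]
      simpa [AlgEquiv.restrictNormalHom_apply] using h1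
  simp only [sepInertia, Subgroup.mem_iInf, Subgroup.mem_comap, key]
  constructor
  · intro h x hx
    exact h (FiniteGaloisIntermediateField.adjoin k {x}) x
      (FiniteGaloisIntermediateField.subset_adjoin k {x} rfl) hx
  · intro h L x _ hx
    exact h x hx

theorem sepInertia_normal (v : Valuation k (WithZero Γ)) (ks : Type u) [Field ks] [Algebra k ks] :
    (sepInertia v ks).Normal := by
  refine Subgroup.normal_iInf_normal fun L => ?_
  have : (inertia v L).Normal := MonoidHom.normal_ker _
  infer_instance

theorem isClosed_sepInertia (v : Valuation k (WithZero Γ)) (ks : Type u) [Field ks] [Algebra k ks]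
    [IsGalois k ks] : IsClosed (sepInertia v ks : Set Gal(ks/k)) := by
  rw [sepInertia, Subgroup.coe_iInf]
  refine isClosed_iInter fun L => ?_
  exact IsClosed.preimage (t := (inertia v L : Set Gal(L/k)))
    (InfiniteGalois.restrictNormalHom_continuous L.toIntermediateField) (isClosed_discrete _)

/-- The inertia group is closed, as an intersection of preimages under continuous maps to discrete
groups, so the infinite Galois correspondence recovers it from its fixed field. -/
theorem fixingSubgroup_maxTame (v : Valuation k (WithZero Γ)) (ks : Type u) [Field ks]
    [Algebra k ks] [IsGalois k ks] : (maxTame v ks).fixingSubgroup = sepInertia v ks :=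
  InfiniteGalois.fixingSubgroup_fixedField ⟨sepInertia v ks, isClosed_sepInertia v ks⟩

instance isGalois_maxTame (v : Valuation k (WithZero Γ)) (ks : Type u) [Field ks]
    [Algebra k ks] [IsGalois k ks] : IsGalois k (maxTame v ks) := by
  rw [← InfiniteGalois.normal_iff_isGalois, fixingSubgroup_maxTame]
  exact sepInertia_normal v ks

include hv hw in
theorem mem_maxTame_iff (x : ks) :
    x ∈ maxTame v ks ↔ ∀ g : Gal(ks/k), (∀ y ≠ 0, w (g y - y) < w y) → g x = x := by
  simp only [maxTame, IntermediateField.mem_fixedField_iff, mem_sepInertia_iff hv hw]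

/-- The action of an automorphism of a valued field on its graded reduction. -/
def redEquiv {L : Type u} [Field L] [Algebra k L] (v : Valuation k (WithZero Γ))
    (g : Gal(L/k)) : GRed (extensions v L) ≃ₐ[ResField v] GRed (extensions v L) :=
  AlgEquiv.ofAlgHom (redAlgHom v (g : L →ₐ[k] L)) (redAlgHom v (g.symm : L →ₐ[k] L))
    (by rw [← redAlgHom_comp, AlgEquiv.comp_symm, redAlgHom_id])
    (by rw [← redAlgHom_comp, AlgEquiv.symm_comp, redAlgHom_id])

theorem redEquiv_cls {L : Type u} [Field L] [Algebra k L] (g : Gal(L/k)) {r : Additive Γ} {a : L}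
    (ha : a ∈ closedBall (extensions v L) r) :
    redEquiv v g (cls (extensions v L) r a) = cls (extensions v L) r (g a) :=
  redAlgHom_cls _ ha

include hv hw in
/-- An automorphism of the separable closure that acts trivially on the graded reduction of `F`
is the product of an element of the inertia group and an automorphism that fixes `F`. -/
theorem exists_fixing_mul_inv_mem_sepInertia (F : IntermediateField k ks) (g : Gal(ks/k))
    (hg : ∀ x ∈ F, x ≠ 0 → w (g x - x) < w x) :
    ∃ τ : Gal(ks/k), (∀ x ∈ F, τ x = x) ∧ g * τ⁻¹ ∈ sepInertia v ks := by
  have hinv : ∀ (τ : Gal(ks/F)) x, w (τ x) = w x := fun τ x =>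
    valuation_galois_apply hw (τ.restrictScalars k) x
  have hball : ∀ {r} {x : ks}, w x ≤ radius r → x ∈ closedBall (extensions v ks) r :=
    (mem_closedBall_extensions hw).2
  -- The action of g on the reduction of `ks` fixes the classes of F, so it is induced by some τ
  -- that fixes F. Then g and τ have the same action on the reduction. When x is too large for the
  -- degree r, `cls` is zero by convention and there is nothing to check.
  obtain ⟨τ, hτ⟩ := exists_galois_cls_eq' (K := F) w hinv hw (redEquiv v g).toRingEquiv (by
    intro r x
    by_cases hx : w x ≤ radius r
    · have hgx : w (g x) ≤ radius r := by rwa [valuation_galois_apply hw]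
      refine (redEquiv_cls g (hball hx)).trans ?_
      refine (cls_eq_iff (hball hgx) (hball hx)).2 ?_
      rw [mem_openBall_extensions hw]
      by_cases h0 : (x : ks) = 0
      · rw [h0]
        simpa using radius_pos r
      · exact (hg x x.2 h0).trans_le hx
    · have hx' : algebraMap F ks x ∉ closedBall (extensions v ks) r :=
        fun h => hx ((mem_closedBall_extensions hw).1 h)
      rw [cls_of_notMem hx', map_zero])
  refine ⟨τ.restrictScalars k, fun x hx => τ.commutes ⟨x, hx⟩, ?_⟩
  rw [mem_sepInertia_iff hv hw]
  intro x hx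
  obtain ⟨y, rfl⟩ := τ.surjective x
  have hy : y ≠ 0 := fun h => hx (by rw [h, map_zero])
  have h1 : ((τ.restrictScalars k)⁻¹ : Gal(ks/k)) (τ y) = y := AlgEquiv.symm_apply_apply τ y
  rw [AlgEquiv.mul_apply, h1, hinv]
  obtain ⟨r, hr⟩ := exists_radius_eq ((Valuation.ne_zero_iff w).2 hy)
  have h2 := (redEquiv_cls g (hball hr.ge)).symm.trans (hτ r y hr.ge)
  rw [cls_eq_iff (hball (by rw [valuation_galois_apply hw]; exact hr.ge))
    (hball (by rw [hinv]; exact hr.ge)), mem_openBall_extensions hw, hr] at h2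
  exact h2

include hv hw in
/-- An automorphism of `M` that acts trivially on the graded reduction of `F ⊆ M` fixes `F`. -/
theorem eq_of_trivial_on_reduction {wM : Valuation (maxTame v ks) (WithZero Γ)}
    (hM : extensions v (maxTame v ks) = {wM})
    (F : IntermediateField k (maxTame v ks)) (h : Gal(maxTame v ks/k))
    (hh : ∀ x ∈ F, x ≠ 0 → wM (h x - x) < wM x) : ∀ x ∈ F, h x = x := by
  obtain ⟨g, hg⟩ := AlgEquiv.restrictNormalHom_surjective (F := k) (K₁ := maxTame v ks) ks h
  have hgx : ∀ x : maxTame v ks, g x = h x := fun x => by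
    rw [← hg, AlgEquiv.restrictNormalHom_apply]
  have hwM : ∀ x : maxTame v ks, w x = wM x := fun x =>
    comap_eq_of_extensions_eq hM hw (IntermediateField.val (maxTame v ks)) x
  obtain ⟨τ, hτ, hgτ⟩ := exists_fixing_mul_inv_mem_sepInertia hv hw (IntermediateField.lift F) g (by
    intro x hx h0
    obtain ⟨y, hy, rfl⟩ := hx
    have h1 := hh y hy (fun h => h0 (by rw [h, map_zero]))
    change w (g (y : ks) - (y : ks)) < w (y : ks)
    rw [hgx, hwM]
    have h2 : ((h y : maxTame v ks) : ks) - (y : ks) = ((h y - y : maxTame v ks) : ks) := rfl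
    rw [h2, hwM]
    exact h1)
  intro x hx
  -- The product g τ⁻¹ lies in the inertia group, hence fixes M, while τ fixes F; so g fixes F.
  rw [← fixingSubgroup_maxTame] at hgτ
  have h3 : (g * τ⁻¹) (x : ks) = x := hgτ x
  have h4 : τ (x : ks) = x := hτ _ ((IntermediateField.mem_lift x).2 hx)
  have h5 : (τ⁻¹ : Gal(ks/k)) (x : ks) = x := by
    conv_lhs => rw [← h4]
    exact AlgEquiv.symm_apply_apply τ _
  rw [AlgEquiv.mul_apply, h5, hgx] at h3
  exact Subtype.ext h3

/-- The isomorphism between the targets of two surjective morphisms with the same kernel. -/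
theorem exists_mulEquiv_of_ker_eq {G H A : Type*} [Group G] [Group H] [Group A] (p : G →* H)
    (f : G →* A) (hp : Function.Surjective p) (hf : Function.Surjective f) (h : p.ker = f.ker) :
    ∃ π : H ≃* A, ∀ g, π (p g) = f g := by
  let e := (QuotientGroup.quotientMulEquivOfEq h).trans
    (QuotientGroup.quotientKerEquivOfSurjective f hf)
  refine ⟨(QuotientGroup.quotientKerEquivOfSurjective p hp).symm.trans e, fun g => ?_⟩
  have h1 : (QuotientGroup.quotientKerEquivOfSurjective p hp).symm (p g) =
      QuotientGroup.mk g := by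
    rw [MulEquiv.symm_apply_eq]
    rfl
  rw [MulEquiv.trans_apply, h1]
  rfl

/-- The action of the Galois group on the graded reduction, by automorphisms. -/
def galAut (v : Valuation k (WithZero Γ)) (L : Type u) [Field L] [Algebra k L] :
    Gal(L/k) →* Aut ((red v).obj (CommAlgCat.of k L)) :=
  (Aut.unitsEndEquivAut _).toMonoidHom.comp (galRed v L).toHomUnits

theorem galAut_hom {L : Type u} [Field L] [Algebra k L] (g : Gal(L/k)) :
    (galAut v L g).hom = galRed v L g := rfl

include hv in
/-- `Gal(M/k)` is the group of automorphisms of the graded reduction of the separable closure. -/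
theorem exists_galois_equiv_aut (ks : Type u) [Field ks] [Algebra k ks] [IsSepClosure k ks] :
    ∃ π : Gal(maxTame v ks/k) ≃* Aut ((red v).obj (CommAlgCat.of k ks)),
      ∀ (g : Gal(ks/k)) (h : Gal(maxTame v ks/k)),
        (∀ x : maxTame v ks, g (x : ks) = (h x : ks)) → (π h).hom = galRed v ks g := by
  obtain ⟨w, hw⟩ := hv.exists_extensions_eq ks
  have hker : (galAut v ks).ker = sepInertia v ks := by
    ext g
    have h1 : galAut v ks g = 1 ↔ galRed v ks g = galRed v ks 1 :=
      ⟨fun h => by rw [← galAut_hom, h, map_one]; rfl, fun h => Iso.ext (by rw [galAut_hom, h, map_one]; rfl)⟩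
    rw [MonoidHom.mem_ker, h1, galRed_eq_iff hw, mem_sepInertia_iff hv hw]
    rfl
  have hsurj : Function.Surjective (galAut v ks) := by
    intro φ
    have hinv : ∀ (τ : Gal(ks/k)) x, w (τ x) = w x := valuation_galois_apply hw
    let e : GRed (extensions v ks) ≃ₐ[ResField v] GRed (extensions v ks) :=
      AlgEquiv.ofAlgHom φ.hom.toAlgHom φ.inv.toAlgHom (congrArg GrAlg.Hom.toAlgHom φ.inv_hom_id)
        (congrArg GrAlg.Hom.toAlgHom φ.hom_inv_id)
    -- Over the base k, the condition on classes is the linearity of φ over the reduction of k.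
    obtain ⟨g, hg⟩ := exists_galois_cls_eq' (K := k) w hinv hw e.toRingEquiv (by
      intro r x
      by_cases hx : v x ≤ radius r
      · rw [← cls_algebraMap hx]
        exact φ.hom.toAlgHom.commutes _
      · rw [cls_of_notMem, map_zero]
        rw [mem_closedBall_extensions hw, (extends_of_extensions_eq hw).apply]
        exact hx)
    refine ⟨g, Iso.ext ?_⟩
    rw [galAut_hom]
    refine GrAlg.Hom.ext (redAlgHom_ext fun r a ha => ?_)
    refine (redAlgHom_cls (g : ks →ₐ[k] ks) ha).trans ?_
    exact (hg r a ((mem_closedBall_extensions hw).1 ha)).symm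
  obtain ⟨π, hπ⟩ := exists_mulEquiv_of_ker_eq
    (AlgEquiv.restrictNormalHom (F := k) (K₁ := ks) (maxTame v ks)) (galAut v ks)
    (AlgEquiv.restrictNormalHom_surjective ks) hsurj
    (by rw [hker, IntermediateField.restrictNormalHom_ker, fixingSubgroup_maxTame])
  refine ⟨π, fun g h hgh => ?_⟩
  have h1 : AlgEquiv.restrictNormalHom (F := k) (K₁ := ks) (maxTame v ks) g = h := by
    ext x
    rw [AlgEquiv.restrictNormalHom_apply, hgh]
  rw [← h1, hπ, galAut_hom]

end Inertia
end GradedRamification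
end

noncomputable section
namespace GradedRamification

/-! ### Residue field and value group of M -/

section Hensel

variable {Γ : Type u} [CommGroup Γ] [LinearOrder Γ] [IsOrderedMonoid Γ]

open Polynomial

/-- A simple root modulo the maximal ideal lifts at most once. -/
theorem eq_of_isRoot_of_sub_lt {K : Type*} [Field K] (w : Valuation K (WithZero Γ))
    (f : w.integer[X]) {x y : w.integer} (hx : f.eval x = 0) (hy : f.eval y = 0)
    (hxy : w (y - x) < 1) (hd : w ((f.derivative.eval x : w.integer) : K) = 1) : y = x := by
  -- Since f vanishes at x and y, dividing the expansion by y − x ≠ 0 gives f'(x) = −c (y − x), of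
  -- norm less than 1.
  obtain ⟨c, hc⟩ := f.binomExpansion x (y - x)
  rw [add_sub_cancel, hx, hy, zero_add] at hc
  by_contra hne
  have h1 : f.derivative.eval x + c * (y - x) = 0 := by
    refine ((mul_eq_zero (a := y - x)).1 ?_).resolve_left (sub_ne_zero.2 hne)
    rw [hc]; ring
  have h2 : ((f.derivative.eval x : w.integer) : K) = -((c : K) * ((y : K) - x)) := by
    have h3 := congrArg Subtype.val (eq_neg_of_add_eq_zero_left h1)
    simpa using h3
  rw [h2, Valuation.map_neg, map_mul] at hd
  have h4 : w (c : K) * w ((y : K) - x) < 1 :=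
    mul_lt_one_of_nonneg_of_lt_one_right c.2 zero_le hxy
  exact h4.ne hd

theorem valuation_eval_lt_one {K : Type*} [Field K] (w : Valuation K (WithZero Γ))
    {E : K[X]} (hE : ∀ i, w (E.coeff i) < 1) {α : K} (hα : w α ≤ 1) : w (E.eval α) < 1 := by
  rw [eval_eq_sum, Polynomial.sum]
  refine Valuation.map_sum_lt _ one_ne_zero fun i _ => ?_
  rw [map_mul, map_pow]
  exact mul_lt_one_of_nonneg_of_lt_one_left zero_le (hE i) (pow_le_one' hα i)

theorem valuation_eval_le_one {K : Type*} [Field K] (w : Valuation K (WithZero Γ))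
    {E : K[X]} (hE : ∀ i, w (E.coeff i) ≤ 1) {α : K} (hα : w α ≤ 1) : w (E.eval α) ≤ 1 := by
  rw [eval_eq_sum, Polynomial.sum]
  refine Valuation.map_sum_le _ fun i _ => ?_
  rw [map_mul, map_pow]
  exact mul_le_one' (hE i) (pow_le_one' hα i)

/-- The ring of integers of a valuation is integrally closed. -/
theorem valuation_root_le_one {K : Type*} [Field K] (w : Valuation K (WithZero Γ))
    {q : K[X]} (hq : q.Monic) (hq1 : ∀ i, w (q.coeff i) ≤ 1) {α : K} (h0 : q.eval α = 0) :
    w α ≤ 1 := by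
  refine (Valuation.integer.integers w).mem_of_integral ?_
  obtain ⟨p, hp, -, hpm⟩ := lifts_and_natDegree_eq_and_monic
    (f := algebraMap w.integer K) (p := q)
    ((lifts_iff_coeff_lifts _).2 fun i => ⟨⟨q.coeff i, hq1 i⟩, rfl⟩) hq
  refine ⟨p, hpm, ?_⟩
  rw [eval₂_eq_eval_map, hp, h0]

/-- If `q` and its derivative are coprime modulo the maximal ideal, the derivative of `q` has
norm `1` at the roots of `q`. -/
theorem valuation_derivative_eq_one {K : Type*} [Field K] (w : Valuation K (WithZero Γ))
    {q a b : K[X]} (hq : q.Monic) (hq1 : ∀ i, w (q.coeff i) ≤ 1) (hb : ∀ i, w (b.coeff i) ≤ 1)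
    (hE : ∀ i, w ((a * q + b * derivative q - 1).coeff i) < 1)
    {α : K} (h0 : q.eval α = 0) : w ((derivative q).eval α) = 1 := by
  have hα := valuation_root_le_one w hq hq1 h0
  have hd : w ((derivative q).eval α) ≤ 1 := by
    refine valuation_eval_le_one w (fun i => ?_) hα
    rw [coeff_derivative, map_mul]
    refine mul_le_one' (hq1 _) ?_
    exact_mod_cast (natCast_mem w.integer (i + 1) : _ ∈ w.integer)
  refine le_antisymm hd ?_
  -- At a root of q the term a q vanishes, so b q' is 1 plus an element of norm less than 1; as b
  -- has norm at most 1 there, q' has norm at least 1.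
  have h1 := valuation_eval_lt_one w hE hα
  rw [eval_sub, eval_add, eval_mul, eval_mul, h0, mul_zero, zero_add, eval_one] at h1
  have h2 : w (b.eval α * (derivative q).eval α) = 1 := by
    have h3 := w.map_one_add_of_lt h1
    rwa [add_sub_cancel] at h3
  rw [← h2, map_mul]
  exact mul_le_of_le_one_left' (valuation_eval_le_one w hb hα)

variable {k : Type u} [Field k] {v : Valuation k (WithZero Γ)}

/-- The projection of the ring of integers onto the component of degree zero. -/
def integerToDegZero {L : Type u} [Field L] [Algebra k L] {wL : Valuation L (WithZero Γ)}
    (hL : extensions v L = {wL}) : wL.integer →+* redDeg (extensions v L) 0 where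
  toFun a := ⟨cls (extensions v L) 0 a, cls_mem _ _ _⟩
  map_one' := Subtype.ext cls_one
  map_zero' := Subtype.ext cls_zero
  map_add' a b := Subtype.ext (cls_add ((mem_closedBall_extensions hL).2 a.2)
    ((mem_closedBall_extensions hL).2 b.2))
  map_mul' a b := Subtype.ext (by
    have h := cls_mul (S := extensions v L) (r := 0) (s := 0)
      ((mem_closedBall_extensions hL).2 a.2) ((mem_closedBall_extensions hL).2 b.2)
    rw [add_zero] at h
    exact h)

theorem integerToDegZero_surjective {L : Type u} [Field L] [Algebra k L]
    {wL : Valuation L (WithZero Γ)} (hL : extensions v L = {wL}) :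
    Function.Surjective (integerToDegZero hL) := by
  rintro ⟨x, hx⟩
  obtain ⟨a, ha, rfl⟩ := exists_cls_of_mem hx
  exact ⟨⟨a, (mem_closedBall_extensions hL).1 ha⟩, rfl⟩

theorem integerToDegZero_eq_zero_iff {L : Type u} [Field L] [Algebra k L]
    {wL : Valuation L (WithZero Γ)} (hL : extensions v L = {wL}) (a : wL.integer) :
    integerToDegZero hL a = 0 ↔ wL a < 1 := by
  have h1 := mem_openBall_extensions hL (r := 0) (a := (a : L))
  rw [radius_zero] at h1
  have h2 : (a : L) ∈ closedBall (extensions v L) (0 : Additive Γ) :=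
    (mem_closedBall_extensions hL).2 a.2
  exact Subtype.ext_iff.trans ((cls_eq_zero_iff h2).trans h1)

variable (hv : Henselian v) {ks : Type u} [Field ks] [Algebra k ks] [IsSepClosure k ks]

include hv in
/-- The residue field of the maximal tamely ramified extension is separably closed. -/
theorem exists_root_degZero_maxTame (f : (redDeg (extensions v (maxTame v ks)) 0)[X])
    (hf : f.Monic) (hfs : f.Separable) (hdeg : f.natDegree ≠ 0) : ∃ x, f.eval x = 0 := by
  obtain ⟨w, hw⟩ := hv.exists_extensions_eq ks
  obtain ⟨wM, hM⟩ := hv.exists_extensions_eq (maxTame v ks)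
  have hsc : IsSepClosed ks := IsSepClosure.sep_closed k
  let ρ := integerToDegZero hM
  have hρ : Function.Surjective ρ := integerToDegZero_surjective hM
  -- The polynomial f lifts to a monic q over the integers of M, and its Bézout relation with f' to
  -- one that holds modulo the maximal ideal.
  obtain ⟨q, hqf, hqd, hqm⟩ := lifts_and_natDegree_eq_and_monic (f := ρ) (p := f)
    ((lifts_iff_coeff_lifts _).2 fun i => hρ _) hf
  obtain ⟨a₀, b₀, hab⟩ := hfs
  obtain ⟨a, rfl⟩ := Polynomial.map_surjective ρ hρ a₀
  obtain ⟨b, rfl⟩ := Polynomial.map_surjective ρ hρ b₀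
  have hE : ∀ i, wM ((a * q + b * derivative q - 1).coeff i) < 1 := by
    intro i
    rw [← integerToDegZero_eq_zero_iff hM, ← coeff_map]
    change (Polynomial.map ρ _).coeff i = 0
    rw [Polynomial.map_sub, Polynomial.map_add, Polynomial.map_mul, Polynomial.map_mul,
      ← derivative_map, hqf, hab, Polynomial.map_one, sub_self, coeff_zero]
  -- In every valued extension N of M, the derivative of q has norm 1 at the roots of q. For N an
  -- algebraic closure this makes q separable, so it has a root in `ks`; for N = `ks` it makes this
  -- root simple modulo the maximal ideal.
  have key : ∀ (N : Type u) [Field N] [Algebra (maxTame v ks) N] (wN : Valuation N (WithZero Γ))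
      (_ : ∀ x : maxTame v ks, wN (algebraMap _ N x) = wM x) (α : N),
      (q.map ((algebraMap (maxTame v ks) N).comp wM.integer.subtype)).eval α = 0 →
      wN ((derivative (q.map ((algebraMap (maxTame v ks) N).comp wM.integer.subtype))).eval α) =
        1 := by
    intro N _ _ wN hN α hα
    have hcoe : ∀ x : wM.integer,
        wN (((algebraMap (maxTame v ks) N).comp wM.integer.subtype) x) = wM x := fun x => hN x
    refine valuation_derivative_eq_one wN
      (a := a.map ((algebraMap (maxTame v ks) N).comp wM.integer.subtype))
      (b := b.map ((algebraMap (maxTame v ks) N).comp wM.integer.subtype)) (hqm.map _)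
      (fun i => ?_) (fun i => ?_) (fun i => ?_) hα
    · rw [coeff_map, hcoe]; exact (q.coeff i).2
    · rw [coeff_map, hcoe]; exact (b.coeff i).2
    · have h1 := hE i
      rw [← hcoe, ← coeff_map, Polynomial.map_sub, Polynomial.map_add, Polynomial.map_mul,
        Polynomial.map_mul, ← derivative_map, Polynomial.map_one] at h1
      exact h1
  have hsep : (q.map wM.integer.subtype).Separable := by
    let N := AlgebraicClosure (maxTame v ks)
    have : Algebra.IsAlgebraic k N := Algebra.IsAlgebraic.trans k (maxTame v ks) N
    obtain ⟨wN, hN⟩ := hv.exists_extensions_eq N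
    have hN' : ∀ x : maxTame v ks, wN (algebraMap _ N x) = wM x := fun x =>
      comap_eq_of_extensions_eq hM hN (IsScalarTower.toAlgHom k (maxTame v ks) N) x
    refine (isCoprime_iff_aeval_ne_zero_of_isAlgClosed _ N _ _).2 fun α => ?_
    by_contra! h
    rw [aeval_def, eval₂_eq_eval_map, Polynomial.map_map, aeval_def, eval₂_eq_eval_map,
      ← derivative_map, Polynomial.map_map] at h
    have h1 := key N wN hN' α h.1
    rw [h.2, map_zero] at h1
    exact zero_ne_one h1
  have hwM : ∀ x : maxTame v ks, w x = wM x := fun x =>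
    comap_eq_of_extensions_eq hM hw (IntermediateField.val (maxTame v ks)) x
  obtain ⟨x, hx⟩ := IsSepClosed.exists_root
    ((q.map wM.integer.subtype).map (algebraMap (maxTame v ks) ks)) (by
      rw [degree_map]
      intro h
      rw [hqm.degree_map, degree_eq_natDegree hqm.ne_zero, hqd] at h
      exact hdeg (by exact_mod_cast h)) (hsep.map)
  rw [IsRoot, Polynomial.map_map] at hx
  have hx1 : w x ≤ 1 := valuation_root_le_one w (hqm.map _) (fun i => by
    rw [coeff_map]
    exact (hwM _).trans_le (q.coeff i).2) hx
  have hxd := key ks w hwM x hx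
  let j : wM.integer →+* w.integer :=
    ((algebraMap (maxTame v ks) ks).comp wM.integer.subtype).codRestrict w.integer
      fun a => (hwM _).trans_le a.2
  have hj : ∀ (p : wM.integer[X]) (y : w.integer), ((Polynomial.eval y (p.map j) : w.integer) : ks) =
      (p.map ((algebraMap (maxTame v ks) ks).comp wM.integer.subtype)).eval (y : ks) := by
    intro p y
    rw [← Subring.coe_subtype, ← eval_map_apply, Polynomial.map_map]
    rfl
  have hxM : x ∈ maxTame v ks := by
    refine (mem_maxTame_iff hv hw x).2 fun g hg => ?_
    have hgM : ∀ y : maxTame v ks, g y = y := by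
      have h1 : g ∈ (maxTame v ks).fixingSubgroup := by
        rw [fixingSubgroup_maxTame, mem_sepInertia_iff hv hw]
        exact hg
      exact fun y => h1 y
    by_cases h0 : x = 0
    · rw [h0, map_zero]
    have hgx : w (g x) ≤ 1 := by rwa [valuation_galois_apply hw]
    -- As g fixes M, g x is another root of q. It is at distance less than |x| ≤ 1 from x, so the
    -- two roots coincide.
    refine congrArg Subtype.val (eq_of_isRoot_of_sub_lt w (q.map j) (x := ⟨x, hx1⟩)
      (y := ⟨g x, hgx⟩) (Subtype.ext ?_) (Subtype.ext ?_) ((hg x h0).trans_le hx1) ?_)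
    · rw [hj]; exact hx
    · rw [hj]
      have h2 : ((algebraMap (maxTame v ks) ks).comp wM.integer.subtype) =
          (g : ks →+* ks).comp ((algebraMap (maxTame v ks) ks).comp wM.integer.subtype) := by
        ext y
        exact (hgM y).symm
      rw [h2, ← Polynomial.map_map]
      change eval ((g : ks →+* ks) x) _ = 0
      rw [eval_map_apply, hx, map_zero]
    · rw [derivative_map, hj, ← derivative_map]
      exact hxd
  have hxM1 : wM ⟨x, hxM⟩ ≤ 1 := by
    rw [← hwM]; exact hx1
  refine ⟨ρ ⟨⟨x, hxM⟩, hxM1⟩, ?_⟩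
  rw [← hqf, eval_map_apply]
  have h3 : q.eval ⟨⟨x, hxM⟩, hxM1⟩ = 0 := by
    refine Subtype.ext (Subtype.ext ?_)
    have h4 := eval_map_apply (f := ((algebraMap (maxTame v ks) ks).comp wM.integer.subtype))
      (p := q) (x := ⟨⟨x, hxM⟩, hxM1⟩)
    exact h4.symm.trans hx
  rw [h3, map_zero]

include hv in
/-- The value group of the maximal tamely ramified extension is closed under division by the
integers that are invertible in the residue field. -/
theorem exists_ne_zero_of_nsmul (n : ℕ) (hn : (n : GRed (extensions v (maxTame v ks))) ≠ 0)
    (γ : Additive Γ)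
    (h : ∃ x ∈ redDeg (extensions v (maxTame v ks)) (n • γ), x ≠ 0) :
    ∃ x ∈ redDeg (extensions v (maxTame v ks)) γ, x ≠ 0 := by
  obtain ⟨w, hw⟩ := hv.exists_extensions_eq ks
  obtain ⟨wM, hM⟩ := hv.exists_extensions_eq (maxTame v ks)
  have hsc : IsSepClosed ks := IsSepClosure.sep_closed k
  have hwM : ∀ x : maxTame v ks, w x = wM x := fun x =>
    comap_eq_of_extensions_eq hM hw (IntermediateField.val (maxTame v ks)) x
  have hwn : wM (n : maxTame v ks) = 1 := by
    refine le_antisymm (natCast_mem wM.integer n) (not_lt.1 fun hlt => hn ?_)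
    have h1 := (integerToDegZero_eq_zero_iff hM (n : wM.integer)).2 (by exact_mod_cast hlt)
    rw [map_natCast] at h1
    exact congrArg Subtype.val h1
  have hn0 : n ≠ 0 := by
    rintro rfl
    simp at hn
  obtain ⟨y, hy, hy0⟩ := h
  obtain ⟨a, ha, rfl⟩ := exists_cls_of_mem hy
  have hwa : wM a = radius γ ^ n := by
    rw [← radius_nsmul]
    refine le_antisymm ((mem_closedBall_extensions hM).1 ha) (not_lt.1 fun hlt => hy0 ?_)
    exact cls_of_mem_openBall ((mem_openBall_extensions hM).2 hlt)
  have : NeZero (n : ks) := ⟨fun h0 => by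
    have h1 : w (n : ks) = 1 := by
      rw [← hwn, ← hwM]; simp
    rw [h0, map_zero] at h1
    exact zero_ne_one h1⟩
  -- A nonzero element of degree γ is obtained as the class of an n-th root of a, where a has norm γ
  -- ^ n. The root exists in `ks` because n ≠ 0 there, and it remains to see that inertia fixes it.
  obtain ⟨x, hx⟩ := IsSepClosed.exists_pow_nat_eq (a : ks) n
  have hx0 : x ≠ 0 := by
    rintro rfl
    rw [zero_pow hn0] at hx
    have h1 := hwM a
    rw [← hx, map_zero, hwa] at h1
    exact pow_ne_zero n (radius_ne_zero γ) h1.symm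
  have hwx : w x = radius γ := by
    refine (pow_left_inj₀ zero_le zero_le hn0).1 ?_
    rw [← map_pow, hx, hwM, hwa]
  have hxM : x ∈ maxTame v ks := by
    refine (mem_maxTame_iff hv hw x).2 fun g hg => ?_
    have hgM : g (a : ks) = a := by
      have h1 : g ∈ (maxTame v ks).fixingSubgroup := by
        rw [fixingSubgroup_maxTame, mem_sepInertia_iff hv hw]
        exact hg
      exact h1 a
    have hζ : w (g x / x) ≤ 1 := by
      rw [map_div₀, valuation_galois_apply hw, div_self ((Valuation.ne_zero_iff w).2 hx0)]
    -- The quotient g x / x is an n-th root of unity congruent to 1, and X ^ n − 1 has at 1 the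
    -- derivative n, of norm 1; so g x = x.
    have h2 := eq_of_isRoot_of_sub_lt w (X ^ n - 1) (x := 1) (y := ⟨g x / x, hζ⟩) (by simp)
      (Subtype.ext (by
        simp only [eval_sub, eval_pow, eval_X, eval_one]
        change (g x / x) ^ n - 1 = 0
        rw [div_pow, ← map_pow, hx, hgM, div_self, sub_self]
        rw [← hx]
        exact pow_ne_zero n hx0)) (by
        change w (g x / x - 1) < 1
        rw [div_sub_one hx0, map_div₀]
        exact (div_lt_one₀ (zero_lt_iff.2 ((Valuation.ne_zero_iff w).2 hx0))).2 (hg x hx0)) (by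
        simp only [derivative_sub, derivative_X_pow, derivative_one, sub_zero, eval_mul, eval_C,
          eval_pow, eval_X, one_pow, mul_one]
        rw [← hwn, ← hwM]
        simp)
    have h3 := congrArg Subtype.val h2
    change g x / x = 1 at h3
    exact (div_eq_one_iff_eq hx0).1 h3
  have hxγ : wM ⟨x, hxM⟩ = radius γ := by rw [← hwM]; exact hwx
  refine ⟨cls _ γ ⟨x, hxM⟩, cls_mem _ _ _, fun h0 => ?_⟩
  rw [cls_eq_zero_iff ((mem_closedBall_extensions hM).2 hxγ.le), mem_openBall_extensions hM, hxγ]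
    at h0
  exact lt_irrefl _ h0

end Hensel
end GradedRamification
end

noncomputable section

namespace GradedRamification

/-! ### Characters of finitely generated abelian groups -/

section Characters

theorem exists_character_apply_ne_zero {V : Type*} [AddCommGroup V] {p : ℕ} [Fact p.Prime]
    (hV : ∀ x : V, p • x = 0) {x : V} (hx : x ≠ 0) : ∃ χ : V →+ ZMod p, χ x ≠ 0 := by
  have := AddCommGroup.zmodModule hV
  have hfree : Module.Free (ZMod p) V := Module.Free.of_divisionRing (ZMod p) V
  by_contra! h
  refine hx ((Module.forall_dual_apply_eq_zero_iff (ZMod p) x).1 fun f => h f.toAddMonoidHom)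

/-- A nontrivial finitely generated group without torsion prime to `p` has a nontrivial character
with values in `ℤ/pℤ`. -/
theorem exists_character_ne_zero {N : Type*} [AddCommGroup N] [AddGroup.FG N] [Nontrivial N]
    {p : ℕ} (hp : p = 0 ∨ p.Prime) (htors : ∀ (n : ℕ) (x : N), ¬ p ∣ n → n • x = 0 → x = 0) :
    ∃ χ : N →+ ZMod p, χ ≠ 0 := by
  have hfin : Module.Finite ℤ N := Module.Finite.iff_addGroup_fg.2 inferInstance
  rcases hp with rfl | hp
  -- Here `ZMod 0` is ℤ, and the hypothesis says that N is torsion-free, hence free: its characters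
  -- separate its elements.
  · have h0 : Module.IsTorsionFree ℤ N := by
      refine ⟨fun n hn x y hxy => ?_⟩
      have hn0 : n ≠ 0 := by
        rintro rfl
        exact one_ne_zero (hn.1 (by simp : (0 : ℤ) * 1 = 0 * 0))
      have h1 : n • (x - y) = 0 := by
        rw [smul_sub, sub_eq_zero]
        exact hxy
      refine sub_eq_zero.1 (htors n.natAbs _ ?_ ?_)
      · rw [zero_dvd_iff, Int.natAbs_eq_zero]
        exact hn0
      · rw [← natCast_zsmul]
        rcases Int.natAbs_eq n with h | h
        · rw [← h, h1]
        · rw [← neg_eq_zero, ← neg_zsmul, ← h, h1]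
    have hfree : Module.Free ℤ N := Module.free_of_finite_type_torsion_free'
    obtain ⟨x, hx⟩ := exists_ne (0 : N)
    by_contra! h
    refine hx ((Module.forall_dual_apply_eq_zero_iff ℤ x).1 fun f => ?_)
    exact DFunLike.congr_fun (h f.toAddMonoidHom) x
  · have : Fact p.Prime := ⟨hp⟩
    let P : AddSubgroup N := (nsmulAddMonoidHom p : N →+ N).range
    -- If pN = N, Nakayama gives an integer r congruent to 1 modulo p that kills N, against the
    -- absence of torsion prime to p. Otherwise N / pN is a nonzero vector space over ℤ/p and has a
    -- nonzero linear form.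
    by_cases htop : P = ⊤
    · exfalso
      obtain ⟨r, hr1, hr2⟩ := Submodule.exists_sub_one_mem_and_smul_eq_zero_of_fg_of_le_smul
        (Ideal.span {(p : ℤ)}) (⊤ : Submodule ℤ N) hfin.1 (by
          intro x _
          obtain ⟨y, hy⟩ : x ∈ P := htop ▸ AddSubgroup.mem_top x
          rw [← hy]
          change p • y ∈ _
          rw [← natCast_zsmul]
          exact Submodule.smul_mem_smul (Ideal.mem_span_singleton_self _) trivial)
      rw [Ideal.mem_span_singleton] at hr1
      obtain ⟨x, hx⟩ := exists_ne (0 : N)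
      refine hx (htors r.natAbs x ?_ ?_)
      · intro h
        have h1 : (p : ℤ) ∣ r := Int.natCast_dvd.2 h
        have h2 : (p : ℤ) ∣ 1 := by
          have := dvd_sub h1 hr1
          rwa [sub_sub_cancel] at this
        exact hp.one_lt.ne' (Nat.eq_one_of_dvd_one (by exact_mod_cast h2))
      · have h1 := hr2 x trivial
        rw [← natCast_zsmul]
        rcases Int.natAbs_eq r with h | h
        · rw [← h, h1]
        · rw [← neg_eq_zero, ← neg_zsmul, ← h, h1]
    · obtain ⟨x, hx⟩ : ∃ x, x ∉ P := by
        by_contra! h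
        exact htop (eq_top_iff.2 fun x _ => h x)
      by_contra! h
      have h1 : (QuotientAddGroup.mk x : N ⧸ P) ≠ 0 :=
        fun h1 => hx ((QuotientAddGroup.eq_zero_iff _).1 h1)
      obtain ⟨f, hf⟩ := exists_character_apply_ne_zero (p := p) (V := N ⧸ P) (fun y => by
        induction y using QuotientAddGroup.induction_on with
        | H y => exact (QuotientAddGroup.eq_zero_iff _).2 ⟨y, rfl⟩) h1
      exact hf (DFunLike.congr_fun (h (f.comp (QuotientAddGroup.mk' P))) x)

end Characters

/-! ### Degrees of an étale graded algebra -/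

section Tame

set_option linter.unusedSectionVars false

variable {Γ : Type u} [CommGroup Γ] [LinearOrder Γ]
  {R : Type u} [CommRing R] {𝓡 : Additive Γ → AddSubgroup R} [GradedRing 𝓡]

/-- The degrees of the nonzero homogeneous elements of a graded field. -/
def IsGradedField.degrees (h : IsGradedField 𝓡) : AddSubgroup (Additive Γ) where
  carrier := {γ | ∃ x ∈ 𝓡 γ, x ≠ 0}
  zero_mem' := by
    have := h.nontrivial
    exact ⟨1, SetLike.one_mem_graded 𝓡, one_ne_zero⟩
  add_mem' := by
    rintro γ δ ⟨x, hx, hx0⟩ ⟨y, hy, hy0⟩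
    exact ⟨x * y, SetLike.mul_mem_graded hx hy,
      fun h0 => hy0 ((h.isUnit hx hx0).mul_right_eq_zero.1 h0)⟩
  neg_mem' := by
    rintro γ ⟨x, hx, hx0⟩
    obtain ⟨y, hy, hxy⟩ := h.exists_mul_eq_one γ x hx hx0
    have := h.nontrivial
    refine ⟨y, hy, ?_⟩
    rintro rfl
    rw [mul_zero] at hxy
    exact zero_ne_one hxy

variable {B : Type u} [CommRing B] [Algebra R B] {𝓑 : Additive Γ → AddSubgroup B} [GradedRing 𝓑]
  {J : Type*} [Fintype J] {d : J → Additive Γ} (b : Module.Basis J R B)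

theorem repr_mem_of_mem (hB : ∀ (γ : Additive Γ) (x : R), x ∈ 𝓡 γ → algebraMap R B x ∈ 𝓑 γ)
    (hb : ∀ j, b j ∈ 𝓑 (d j)) {γ : Additive Γ} {x : B} (hx : x ∈ 𝓑 γ) (j : J) :
    b.repr x j ∈ 𝓡 (γ - d j) := by
  have h1 : x = ∑ j, GradedRing.proj 𝓡 (γ - d j) (b.repr x j) • b j := by
    conv_lhs => rw [← proj_of_mem 𝓑 hx, ← b.sum_repr x, map_sum]
    exact Finset.sum_congr rfl fun j _ => proj_smul_of_mem hB _ (hb j)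
  rw [h1, b.repr_sum_self]
  exact proj_mem _ _ _

variable {p : ℕ} [CharP R p]

variable (d) in
/-- The subgroup generated by the classes of the degrees `d j`. -/
abbrev classGroup (H : AddSubgroup (Additive Γ)) : AddSubgroup (Additive Γ ⧸ H) :=
  AddSubgroup.closure (Set.range fun j => (QuotientAddGroup.mk (d j) : Additive Γ ⧸ H))

variable (d) in
/-- The class of the degree `d j`. -/
def classGroup.of (H : AddSubgroup (Additive Γ)) (j : J) : classGroup d H :=
  ⟨_, AddSubgroup.subset_closure ⟨j, rfl⟩⟩

/-- The derivation of a graded algebra attached to a character of its group of degrees. -/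
def characterDerivation (hB : ∀ (γ : Additive Γ) (x : R), x ∈ 𝓡 γ → algebraMap R B x ∈ 𝓑 γ)
    (hb : ∀ j, b j ∈ 𝓑 (d j)) (H : AddSubgroup (Additive Γ))
    (hH : ∀ γ, ∀ x ∈ 𝓡 γ, x ≠ 0 → γ ∈ H)
    (χ : classGroup d H →+ ZMod p) : Derivation R B B :=
  Derivation.mk' (b.constr R fun j =>
    ZMod.castHom (dvd_refl p) R (χ (classGroup.of d H j)) • b j) (by
  -- On a nonzero homogeneous element of degree γ the map is multiplication by χ of the class of γ,
  -- because the basis elements that occur in it have degrees congruent to γ modulo H. The Leibniz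
  -- rule then expresses the additivity of χ.
  have key : ∀ γ, ∀ x ∈ 𝓑 γ, x ≠ 0 →
      ∃ h : (QuotientAddGroup.mk γ : Additive Γ ⧸ H) ∈ classGroup d H,
      b.constr R (fun j =>
        ZMod.castHom (dvd_refl p) R (χ (classGroup.of d H j)) • b j) x =
        ZMod.castHom (dvd_refl p) R (χ ⟨_, h⟩) • x := by
    intro γ x hx hx0
    have h1 : ∀ j, b.repr x j ≠ 0 →
        (QuotientAddGroup.mk (d j) : Additive Γ ⧸ H) = QuotientAddGroup.mk γ := by
      intro j hj
      have h2 := hH _ _ (repr_mem_of_mem b hB hb hx j) hj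
      refine QuotientAddGroup.eq.2 ?_
      rwa [neg_add_eq_sub]
    obtain ⟨j, hj⟩ : ∃ j, b.repr x j ≠ 0 := by
      by_contra! h0
      exact hx0 (b.repr.injective (Finsupp.ext fun j => by simp [h0]))
    have hN : (QuotientAddGroup.mk γ : Additive Γ ⧸ H) ∈ classGroup d H :=
      h1 j hj ▸ AddSubgroup.subset_closure ⟨j, rfl⟩
    refine ⟨hN, ?_⟩
    conv_rhs => rw [← b.sum_repr x, Finset.smul_sum]
    rw [Module.Basis.constr_apply_fintype]
    refine Finset.sum_congr rfl fun i _ => ?_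
    rw [Module.Basis.equivFun_apply, smul_comm]
    by_cases hi : b.repr x i = 0
    · simp [hi]
    · have h2 : classGroup.of d H i = ⟨_, hN⟩ :=
        Subtype.ext (h1 i hi)
      rw [h2]
  intro x y
  induction x using induction_homogeneous (𝓐 := 𝓑) with
  | h0 => simp
  | hadd x x' hx hx' =>
    rw [add_mul, map_add, hx, hx', map_add, add_smul, smul_add]
    abel
  | hom γ x hx =>
    induction y using induction_homogeneous (𝓐 := 𝓑) with
    | h0 => simp
    | hadd y y' hy hy' =>
      rw [mul_add, map_add, hy, hy', map_add, add_smul, smul_add]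
      abel
    | hom δ y hy =>
      by_cases hx0 : x = 0
      · simp [hx0]
      by_cases hy0 : y = 0
      · simp [hy0]
      obtain ⟨h1, h2⟩ := key γ x hx hx0
      obtain ⟨h3, h4⟩ := key δ y hy hy0
      rw [h2, h4]
      -- B may have zero divisors, and the description by χ covers only nonzero elements; when x y =
      -- 0 both sides vanish.
      by_cases hxy : x * y = 0
      · rw [hxy, map_zero, smul_eq_mul, smul_eq_mul, mul_smul_comm, mul_smul_comm, mul_comm y x,
          hxy, smul_zero, smul_zero, add_zero]
      obtain ⟨h5, h6⟩ := key (γ + δ) (x * y) (SetLike.mul_mem_graded hx hy) hxy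
      rw [h6]
      have h7 : (⟨_, h5⟩ : classGroup d H) =
          ⟨_, h1⟩ + ⟨_, h3⟩ := rfl
      rw [h7, map_add, map_add, add_smul, smul_eq_mul, smul_eq_mul, mul_smul_comm, mul_smul_comm,
        mul_comm y x, add_comm])

/-- The degrees of an étale graded algebra belong to any subgroup of `Γ` that contains the degrees
of the base and has no torsion prime to the characteristic in its quotient. -/
theorem degree_mem_of_etale (hR : IsGradedField 𝓡) [IsOrderedMonoid Γ]
    (hB : ∀ (γ : Additive Γ) (x : R), x ∈ 𝓡 γ → algebraMap R B x ∈ 𝓑 γ)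
    (hb : ∀ j, b j ∈ 𝓑 (d j)) (H : AddSubgroup (Additive Γ))
    (hH : ∀ γ, ∀ x ∈ 𝓡 γ, x ≠ 0 → γ ∈ H)
    (htors : ∀ (n : ℕ) (γ : Additive Γ), (n : R) ≠ 0 → n • γ ∈ H → γ ∈ H)
    [Subsingleton (Ω[B⁄R])] (j : J) : d j ∈ H := by
  have := hR.isDomain
  obtain ⟨p, hp⟩ := CharP.exists R
  by_contra hj
  have h1 : Nontrivial (classGroup d H) := by
    refine ⟨⟨classGroup.of d H j, 0, fun h => hj ?_⟩⟩
    exact (QuotientAddGroup.eq_zero_iff _).1 (congrArg Subtype.val h)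
  have h2 : AddGroup.FG (classGroup d H) := by
    rw [AddGroup.fg_iff_addSubgroup_fg]
    exact ⟨(Set.finite_range _).toFinset, by rw [Set.Finite.coe_toFinset]⟩
  -- The quotient of Γ by H has no torsion prime to p, and this passes to the subgroup generated by
  -- the classes of the degrees.
  obtain ⟨χ, hχ⟩ := exists_character_ne_zero (N := classGroup d H) (p := p)
    ((CharP.char_is_prime_or_zero R p).symm) (by
      rintro n ⟨x, hx⟩ hn h0
      refine Subtype.ext ?_
      have h3 : n • x = 0 := congrArg Subtype.val h0
      clear h0
      change x = 0
      clear hx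
      induction x using QuotientAddGroup.induction_on with
      | H γ =>
        refine (QuotientAddGroup.eq_zero_iff _).2 (htors n γ ?_ ?_)
        · rwa [Ne, CharP.cast_eq_zero_iff R p]
        · exact (QuotientAddGroup.eq_zero_iff _).1 h3)
  refine hχ ?_
  let D := characterDerivation b hB hb H hH χ
  -- Every derivation factors through Ω = 0. Reading D on b i, and since ℤ/p embeds in R, χ vanishes
  -- on each generator.
  have h4 : D = 0 := by
    ext x
    rw [← D.liftKaehlerDifferential_comp_D x, Subsingleton.elim (KaehlerDifferential.D R B x) 0,
      map_zero]
    rfl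
  have h5 : ∀ i, χ (classGroup.of d H i) = 0 := by
    intro i
    have h6 : D (b i) = ZMod.castHom (dvd_refl p) R
        (χ (classGroup.of d H i)) • b i := b.constr_basis R _ i
    rw [h4] at h6
    refine (ZMod.castHom_injective R) ?_
    rw [map_zero]
    have h7 := congrArg (fun x => b.repr x i) h6
    simpa using h7.symm
  ext ⟨x, hx⟩
  change χ ⟨x, hx⟩ = 0
  induction hx using AddSubgroup.closure_induction with
  | mem x hx =>
    obtain ⟨i, rfl⟩ := hx
    exact h5 i
  | zero => exact map_zero χ
  | add x y hx hy h8 h9 =>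
    have := map_add χ ⟨x, hx⟩ ⟨y, hy⟩
    rw [h8, h9, add_zero] at this
    exact this
  | neg x hx h8 =>
    have := map_neg χ ⟨x, hx⟩
    rw [h8, neg_zero] at this
    exact this

end Tame

end GradedRamification

end

noncomputable section

namespace GradedRamification

/-! ### Descent to a separably closed field of constants -/

section Descent

variable {κ D C J : Type*} [Field κ] [CommRing D] [Nontrivial D] [CommRing C] [Algebra κ D]
  [Algebra κ C] [Algebra D C] [IsScalarTower κ D C] [Fintype J]

/-- The subalgebra spanned by a family that is stable under products. -/
def spanSubalgebra (κ : Type*) {C J : Type*} [CommRing κ] [CommRing C] [Algebra κ C] (f : J → C)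
    (hone : 1 ∈ Submodule.span κ (Set.range f))
    (hmul : ∀ i j, f i * f j ∈ Submodule.span κ (Set.range f)) : Subalgebra κ C :=
  Submodule.toSubalgebra (Submodule.span κ (Set.range f)) hone (fun x y hx hy => by
    induction hx, hy using Submodule.span_induction₂ with
    | mem_mem x y hx hy =>
      obtain ⟨i, rfl⟩ := hx
      obtain ⟨j, rfl⟩ := hy
      exact hmul i j
    | zero_left => rw [zero_mul]; exact zero_mem _
    | zero_right => rw [mul_zero]; exact zero_mem _
    | add_left x y z _ _ _ hx hy => rw [add_mul]; exact add_mem hx hy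
    | add_right x y z _ _ _ hx hy => rw [mul_add]; exact add_mem hx hy
    | smul_left r x y _ _ h => rw [smul_mul_assoc]; exact Submodule.smul_mem _ _ h
    | smul_right r x y _ _ h => rw [mul_smul_comm]; exact Submodule.smul_mem _ _ h)

/-- An unramified algebra with a basis whose structure constants belong to a separably closed field
is split. -/
theorem exists_algHom_of_formallyUnramified [IsSepClosed κ] (f : Module.Basis J D C)
    (hone : 1 ∈ Submodule.span κ (Set.range f))
    (hmul : ∀ i j, f i * f j ∈ Submodule.span κ (Set.range f))
    [hC : Algebra.FormallyUnramified D C] :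
    ∃ η : J → (C →ₐ[D] D), Function.Injective η ∧
      ∀ i j, η i (f j) ∈ Set.range (algebraMap κ D) := by
  -- C is the base change to D of the κ-algebra C₀ spanned by the basis. Unramifiedness descends
  -- along the faithfully flat κ → D, and a finite unramified algebra over a separably closed field
  -- is a product of copies of this field.
  let C₀ := spanSubalgebra κ f hone hmul
  have hmem : ∀ j, f j ∈ C₀ := fun j => Submodule.subset_span ⟨j, rfl⟩
  have hinj : Function.Injective (algebraMap κ D) := (algebraMap κ D).injective
  have hli : LinearIndependent κ (fun j => (⟨f j, hmem j⟩ : C₀)) := by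
    have h1 : LinearIndependent κ f := f.linearIndependent.restrict_scalars (by
      intro x y hxy
      refine hinj ?_
      simpa [Algebra.smul_def] using hxy)
    exact LinearIndependent.of_comp C₀.val.toLinearMap h1
  have hsp : ⊤ ≤ Submodule.span κ (Set.range fun j => (⟨f j, hmem j⟩ : C₀)) := by
    rintro ⟨x, hx⟩ -
    have hx' : x ∈ Submodule.span κ (Set.range f) := hx
    obtain ⟨c, rfl⟩ := (Submodule.mem_span_range_iff_exists_fun κ).1 hx'
    refine (Submodule.mem_span_range_iff_exists_fun κ).2 ⟨c, Subtype.ext ?_⟩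
    simp
  let f₀ : Module.Basis J κ C₀ := Module.Basis.mk hli hsp
  have hf₀ : ∀ j, (f₀ j : C) = f j := fun j => by rw [Module.Basis.mk_apply]
  let m : D ⊗[κ] C₀ →ₐ[D] C := Algebra.TensorProduct.lift (Algebra.ofId D C) C₀.val
    (fun _ _ => Commute.all _ _)
  have hm : ∀ d x, m (d ⊗ₜ x) = d • (x : C) := fun d x => by
    simp [m, Algebra.ofId_apply, Algebra.smul_def]
  have hmbij : Function.Bijective m := by
    have h1 : m.toLinearMap = ((f₀.baseChange D).equiv f (Equiv.refl J)).toLinearMap := by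
      refine (f₀.baseChange D).ext fun j => ?_
      rw [LinearEquiv.coe_coe, Module.Basis.equiv_apply, Module.Basis.baseChange_apply]
      refine (hm 1 (f₀ j)).trans ?_
      rw [one_smul, hf₀]
      rfl
    have h2 : (m : D ⊗[κ] C₀ → C) = (f₀.baseChange D).equiv f (Equiv.refl J) :=
      funext fun x => LinearMap.congr_fun h1 x
    rw [h2]
    exact LinearEquiv.bijective _
  let e : D ⊗[κ] C₀ ≃ₐ[D] C := AlgEquiv.ofBijective m hmbij
  have hD : Algebra.FormallyUnramified D (D ⊗[κ] C₀) :=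
    Algebra.FormallyUnramified.of_equiv e.symm
  have hff : Module.FaithfullyFlat κ D := inferInstance
  have hfin : Module.Finite κ C₀ := Module.Finite.of_basis f₀
  have hu : Algebra.FormallyUnramified κ C₀ :=
    Algebra.FormallyUnramified.of_formallyUnramified_tensorProduct_of_faithfullyFlat D
  have het : Algebra.FormallyEtale κ C₀ :=
    Algebra.FormallyEtale.iff_formallyUnramified_of_field.2 hu
  let ε := Algebra.FormallyEtale.equivPiOfIsSepClosed κ C₀
  have hps : Finite (PrimeSpectrum C₀) := by
    have : IsArtinianRing C₀ := isArtinian_of_tower κ inferInstance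
    infer_instance
  let _ : Fintype (PrimeSpectrum C₀) := Fintype.ofFinite _
  have hcard : Fintype.card J = Fintype.card (PrimeSpectrum C₀) := by
    rw [← Module.finrank_eq_card_basis f₀, ε.toLinearEquiv.finrank_eq,
      Module.finrank_fintype_fun_eq_card]
  let s : J ≃ PrimeSpectrum C₀ := Fintype.equivOfCardEq hcard
  let θ : J → (C₀ →ₐ[κ] κ) := fun j => (Pi.evalAlgHom κ (fun _ => κ) (s j)).comp ε.toAlgHom
  have hθ : Function.Injective θ := by
    classical
    intro i j hij
    by_contra hne
    have h1 := DFunLike.congr_fun hij (ε.symm (Pi.single (s i) 1))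
    simp only [θ, AlgHom.comp_apply, AlgEquiv.coe_toAlgHom, AlgEquiv.apply_symm_apply,
      Pi.evalAlgHom_apply, Pi.single_eq_same] at h1
    rw [Pi.single_eq_of_ne (fun h => hne (s.injective h).symm)] at h1
    exact one_ne_zero h1
  let η : J → (C →ₐ[D] D) := fun j => (Algebra.TensorProduct.lift (AlgHom.id D D)
    ((Algebra.ofId κ D).comp (θ j)) (fun _ _ => Commute.all _ _)).comp e.symm.toAlgHom
  have hη : ∀ i (x : C₀), η i x = algebraMap κ D (θ i x) := by
    intro i x
    have h1 : e.symm (x : C) = 1 ⊗ₜ x := by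
      rw [AlgEquiv.symm_apply_eq]
      exact ((hm 1 x).trans (one_smul _ _)).symm
    simp only [η, AlgHom.comp_apply, AlgEquiv.coe_toAlgHom, h1, Algebra.TensorProduct.lift_tmul,
      map_one, one_mul]
    rfl
  refine ⟨η, fun i j hij => hθ (AlgHom.ext fun x => hinj ?_), fun i j => ⟨θ i ⟨f j, hmem j⟩, ?_⟩⟩
  · rw [← hη, ← hη, hij]
  · rw [← hη]

end Descent

/-! ### Splitting étale graded algebras -/

section GradedEtale

open Polynomial

variable {Γ : Type u} [CommGroup Γ] [LinearOrder Γ] [IsOrderedMonoid Γ]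
  {R : Type u} [CommRing R] {𝓡 : Additive Γ → AddSubgroup R} [GradedRing 𝓡]

omit [IsOrderedMonoid Γ] in
theorem IsGradedField.isField_zero (h : IsGradedField 𝓡) : IsField (𝓡 0) := by
  have := h.nontrivial
  refine ⟨⟨0, 1, fun h0 => zero_ne_one (congrArg Subtype.val h0)⟩, mul_comm, ?_⟩
  rintro ⟨x, hx⟩ hx0
  obtain ⟨y, hy, hxy⟩ := h.exists_mul_eq_one 0 x hx (fun h0 => hx0 (Subtype.ext h0))
  rw [neg_zero] at hy
  exact ⟨⟨y, hy⟩, Subtype.ext hxy⟩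

theorem isSepClosed_of_exists_root {κ : Type*} [CommRing κ] (hκ : IsField κ)
    (hroot : ∀ f : κ[X], f.Monic → f.Separable → f.natDegree ≠ 0 → ∃ x, f.eval x = 0) :
    @IsSepClosed κ hκ.toField := by
  let _ := hκ.toField
  refine IsSepClosed.of_exists_root κ fun f hf hirr hsep => hroot f hf hsep ?_
  exact hirr.natDegree_pos.ne'

/-- An étale graded algebra is split by a graded field whose field of elements of degree zero is
separably closed, and whose group of degrees has no torsion prime to the characteristic in its
quotient. -/
theorem exists_algHom_of_etaleGr (hR : IsGradedField 𝓡) {D : GrAlg R 𝓡}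
    (hD : IsGradedField D.deg)
    (hroot : ∀ f : (D.deg 0)[X], f.Monic → f.Separable → f.natDegree ≠ 0 → ∃ x, f.eval x = 0)
    (htors : ∀ (n : ℕ) (γ : Additive Γ), (n : D.carrier) ≠ 0 →
      (∃ x ∈ D.deg (n • γ), x ≠ 0) → ∃ x ∈ D.deg γ, x ≠ 0)
    {B : GrAlg R 𝓡} (hB : etaleGr 𝓡 B) :
    ∃ (J : Type u) (_ : Fintype J) (d : J → Additive Γ) (b : Module.Basis J R B.carrier)
      (φ : J → (B.carrier →ₐ[R] D.carrier)), (∀ j, b j ∈ B.deg (d j)) ∧ Function.Injective φ ∧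
        ∀ x γ, ∀ a ∈ B.deg γ, φ x a ∈ D.deg γ := by
  obtain ⟨hfin, hΩ⟩ := hB
  have hRn := hR.nontrivial
  have hDn := hD.nontrivial
  obtain ⟨J, hJ, d, b, hb⟩ := hR.exists_finite_homogeneous_basis B.algebraMap_mem
  have hff : Module.FaithfullyFlat R D.carrier := hR.faithfullyFlat hD D.algebraMap_mem
  have hinj : Function.Injective (algebraMap R D.carrier) := FaithfulSMul.algebraMap_injective _ _
  -- Since the degrees of B occur in D, there are units u j of D of degree −d j, and the u j ⊗ b j
  -- form a basis of D ⊗ B of total degree zero.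
  have hd : ∀ j, -(d j) ∈ hD.degrees := fun j => neg_mem <|
    degree_mem_of_etale b hR B.algebraMap_mem hb hD.degrees
      (fun γ x hx hx0 => ⟨_, D.algebraMap_mem γ x hx,
        fun h0 => hx0 (hinj (h0.trans (map_zero _).symm))⟩)
      (fun n γ hn h => htors n γ (fun h0 => hn (hinj (by rw [map_natCast, h0, map_zero]))) h) j
  choose u hu hu0 using hd
  have huv : ∀ j, ∃ y ∈ D.deg (d j), u j * y = 1 := fun j => by
    obtain ⟨y, hy, h⟩ := hD.exists_mul_eq_one _ _ (hu j) (hu0 j)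
    exact ⟨y, by rwa [neg_neg] at hy, h⟩
  choose y hy huy using huv
  let _ : Field (D.deg 0) := hD.isField_zero.toField
  have hsc : IsSepClosed (D.deg 0) := isSepClosed_of_exists_root hD.isField_zero hroot
  let f : Module.Basis J D.carrier (D.carrier ⊗[R] B.carrier) :=
    (b.baseChange D.carrier).isUnitSMul (fun j => hD.isUnit (hu j) (hu0 j))
  have hf : ∀ j, f j = u j ⊗ₜ b j := fun j => by
    rw [Module.Basis.isUnitSMul_apply, Module.Basis.baseChange_apply, TensorProduct.smul_tmul',
      smul_eq_mul, mul_one]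
  have key : ∀ γ δ, ∀ a ∈ D.deg γ, ∀ x ∈ B.deg δ, a ⊗ₜ[R] x = ∑ j,
      (a * algebraMap R D.carrier (b.repr x j) * y j) • f j := by
    intro γ δ a ha x hx
    conv_lhs => rw [← b.sum_repr x, tmul_sum]
    refine Finset.sum_congr rfl fun j _ => ?_
    rw [hf, TensorProduct.smul_tmul', smul_eq_mul, mul_assoc, mul_comm (y j), huy, mul_one,
      ← TensorProduct.smul_tmul, Algebra.smul_def, mul_comm]
  have key2 : ∀ γ δ, ∀ a ∈ D.deg γ, ∀ x ∈ B.deg δ, ∀ j,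
      a * algebraMap R D.carrier (b.repr x j) * y j ∈ D.deg (γ + δ) := by
    intro γ δ a ha x hx j
    have h1 := SetLike.mul_mem_graded (SetLike.mul_mem_graded ha
      (D.algebraMap_mem _ _ (repr_mem_of_mem b B.algebraMap_mem hb hx j))) (hy j)
    rwa [add_assoc, sub_add_cancel] at h1
  -- A tensor of total degree zero has its coordinates in D₀. In particular the structure constants
  -- of the new basis lie in the separably closed field D₀.
  have key3 : ∀ γ, ∀ a ∈ D.deg γ, ∀ x ∈ B.deg (-γ),
      a ⊗ₜ[R] x ∈ Submodule.span (D.deg 0) (Set.range f) := by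
    intro γ a ha x hx
    rw [key γ _ a ha x hx]
    refine Submodule.sum_mem _ fun j _ => ?_
    have h1 := key2 γ _ a ha x hx j
    rw [add_neg_cancel] at h1
    exact Submodule.smul_mem _ (⟨_, h1⟩ : D.deg 0) (Submodule.subset_span ⟨j, rfl⟩)
  have hBu : Algebra.FormallyUnramified R B.carrier := ⟨hΩ⟩
  obtain ⟨η, hη, hη0⟩ := exists_algHom_of_formallyUnramified (κ := D.deg 0) f
    (key3 0 1 (SetLike.one_mem_graded _) 1 (by
      rw [neg_zero]
      exact SetLike.one_mem_graded _))
    (fun i j => by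
      rw [hf, hf, Algebra.TensorProduct.tmul_mul_tmul]
      refine key3 (-(d i) + -(d j)) _ (SetLike.mul_mem_graded (hu i) (hu j)) _ ?_
      rw [neg_add, neg_neg, neg_neg]
      exact SetLike.mul_mem_graded (hb i) (hb j))
  refine ⟨J, hJ, d, b, fun j => ((η j).restrictScalars R).comp
    Algebra.TensorProduct.includeRight, hb, fun i j hij => hη ?_, ?_⟩
  · refine Algebra.TensorProduct.ext (by ext) ?_
    exact hij
  -- The coordinates of 1 ⊗ x in the basis f are homogeneous of degree γ and η j sends this basis
  -- into D₀, so degrees are preserved.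
  · intro j γ x hx
    change η j (1 ⊗ₜ x) ∈ D.deg γ
    rw [key 0 γ 1 (SetLike.one_mem_graded _) x hx, map_sum]
    refine sum_mem fun i _ => ?_
    have h1 := key2 0 γ 1 (SetLike.one_mem_graded _) x hx i
    obtain ⟨c, hc⟩ := hη0 j i
    rw [map_smul, ← hc]
    have h2 := SetLike.mul_mem_graded h1 c.2
    rwa [zero_add, add_zero] at h2

end GradedEtale

section MaxTame

variable {Γ : Type u} [CommGroup Γ] [LinearOrder Γ] [IsOrderedMonoid Γ]
  {k : Type u} [Field k] {v : Valuation k (WithZero Γ)} (hv : Henselian v)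
  (ks : Type u) [Field ks] [Algebra k ks] [IsSepClosure k ks]

include hv in
theorem isGradedField_redMaxTame : IsGradedField (redMaxTame v ks).deg := by
  obtain ⟨wM, hM⟩ := hv.exists_extensions_eq (maxTame v ks)
  change IsGradedField (redDeg (extensions v (maxTame v ks)))
  rw [hM]
  exact isGradedField_redDeg wM

include hv in
theorem exists_algHom_redMaxTame {B : GrAlg (ResField v) (resDeg v)} (hB : etaleGr (resDeg v) B) :
    ∃ (J : Type u) (_ : Fintype J) (d : J → Additive Γ)
      (b : Module.Basis J (ResField v) B.carrier)
      (φ : J → (B.carrier →ₐ[ResField v] (redMaxTame v ks).carrier)),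
        (∀ j, b j ∈ B.deg (d j)) ∧ Function.Injective φ ∧
        ∀ x γ, ∀ a ∈ B.deg γ, φ x a ∈ (redMaxTame v ks).deg γ :=
  exists_algHom_of_etaleGr (isGradedField_redDeg v) (isGradedField_redMaxTame hv ks)
    (exists_root_degZero_maxTame hv) (fun n γ hn h => exists_ne_zero_of_nsmul hv n hn γ h) hB

include hv in
theorem splitBy_redMaxTame {B : GrAlg (ResField v) (resDeg v)} (hB : etaleGr (resDeg v) B) :
    SplitBy B (redMaxTame v ks) := by
  obtain ⟨J, _, d, b, φ, hb, hφ, hdeg⟩ := exists_algHom_redMaxTame hv ks hB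
  exact splitBy_of_algHom (isGradedField_redMaxTame hv ks) b hb hφ hdeg

end MaxTame

end GradedRamification

end

noncomputable section

namespace GradedRamification

/-! ### Tame étale algebras and their reductions -/

section Coordinates

variable {R D B J : Type*} [CommRing R] [CommRing D] [IsDomain D] [Algebra R D] [CommRing B]
  [Algebra R B] [Fintype J]

/-- If `D ⊗ B` is a finite product of copies of `D`, the coordinates are all the morphisms from `B`
to `D`. -/
theorem bijective_evalAll_of_algEquiv (b : Module.Basis J R B) {n : ℕ}
    (e : (D ⊗[R] B) ≃ₐ[D] (Fin n → D)) :
    Function.Bijective (evalAll (fun x : B →ₐ[R] D => x)) := by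
  obtain ⟨ψ, hψ, hbij, -⟩ := exists_coordinates b e
  let ε := Equiv.ofBijective ψ hbij
  have h : (evalAll (fun x : B →ₐ[R] D => x) : D ⊗[R] B → _) = fun t x => e t (ε.symm x) := by
    ext t x
    obtain ⟨i, rfl⟩ := ε.surjective x
    rw [ε.symm_apply_apply]
    induction t with
    | zero => simp
    | add y z hy hz => simp only [map_add, Pi.add_apply, hy, hz]
    | tmul d a =>
      have h2 : d ⊗ₜ[R] a = d • ((1 : D) ⊗ₜ[R] a) := by
        rw [TensorProduct.smul_tmul', smul_eq_mul, mul_one]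
      rw [evalAll_tmul, h2, map_smul, Pi.smul_apply, smul_eq_mul]
      exact congrArg (d * ·) (hψ i a)
  rw [h]
  exact (Equiv.arrowCongr ε (Equiv.refl D)).bijective.comp e.bijective

end Coordinates

section Tame

variable {Γ : Type u} [CommGroup Γ] [LinearOrder Γ] [IsOrderedMonoid Γ]
  {k : Type u} [Field k] {v : Valuation k (WithZero Γ)}
  {ks : Type u} [Field ks] [Algebra k ks] {E : Type u} [CommRing E] [Algebra k E]

theorem IsTameEtale.finite (hE : IsTameEtale v ks E) : Module.Finite k E := by
  have := hE.1
  exact Algebra.FormallyUnramified.finite_of_free k E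

theorem IsTameEtale.bijective_evalAll (hE : IsTameEtale v ks E) :
    Function.Bijective (evalAll (fun x : E →ₐ[k] maxTame v ks => x)) := by
  have := hE.finite
  obtain ⟨-, n, ⟨e⟩⟩ := hE
  exact bijective_evalAll_of_algEquiv (Module.finBasis k E) e

theorem IsTameEtale.finite_algHom (hE : IsTameEtale v ks E) : Finite (E →ₐ[k] maxTame v ks) := by
  have := hE.finite
  exact finite_algHom_of_basis (Module.finBasis k E)

theorem IsTameEtale.card_algHom (hE : IsTameEtale v ks E) :
    Nat.card (E →ₐ[k] maxTame v ks) = Module.finrank k E := by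
  have := hE.finite
  obtain ⟨-, n, ⟨e⟩⟩ := hE
  obtain ⟨ψ, -, hbij, hn⟩ := exists_coordinates (Module.finBasis k E) e
  rw [← Nat.card_eq_of_bijective ψ hbij, Nat.card_fin, ← hn, Fintype.card_fin]

theorem IsTameEtale.eq_zero (hE : IsTameEtale v ks E) {a : E}
    (ha : ∀ x : E →ₐ[k] maxTame v ks, x a = 0) : a = 0 := by
  have := hE.finite
  refine eq_of_forall_algHom_eq (Module.finBasis k E)
    (FaithfulSMul.algebraMap_injective k (maxTame v ks)) hE.bijective_evalAll fun x => ?_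
  rw [ha, map_zero]

theorem IsTameEtale.exists_of_equivariant [IsSepClosure k ks] (hE : IsTameEtale v ks E)
    (f : (E →ₐ[k] maxTame v ks) → maxTame v ks)
    (hf : ∀ (g : Gal(maxTame v ks/k)) x, f ((g : maxTame v ks →ₐ[k] maxTame v ks).comp x) = g (f x)) :
    ∃ a : E, ∀ x : E →ₐ[k] maxTame v ks, x a = f x := by
  have := hE.finite
  refine GradedRamification.exists_of_equivariant (Module.finBasis k E) hE.bijective_evalAll
    (fun g : Gal(maxTame v ks/k) => (g : maxTame v ks →ₐ[k] maxTame v ks))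
    (fun d hd => (InfiniteGalois.mem_range_algebraMap_iff_fixed d).2 hd)
    (fun g x => (g : maxTame v ks →ₐ[k] maxTame v ks).comp x) ?_ (fun g x a => rfl) f hf
  intro g x
  refine ⟨(g.symm : maxTame v ks →ₐ[k] maxTame v ks).comp x, AlgHom.ext fun a => ?_⟩
  exact g.apply_symm_apply (x a)

variable (hv : Henselian v) {wM : Valuation (maxTame v ks) (WithZero Γ)}
  (hM : extensions v (maxTame v ks) = {wM})

-- The points of E in M separate its elements, so every valuation of E comes from one of them, and
-- the norm of a is the maximum of the |x a|.
include hv hM in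
theorem IsTameEtale.extensions_eq (hE : IsTameEtale v ks E) :
    extensions v E = Set.range fun x : E →ₐ[k] maxTame v ks => wM.comap (x : E →+* maxTame v ks) := by
  have := hE.finite
  have := hE.finite_algHom
  exact hv.extensions_eq_range (extends_of_extensions_eq hM) (fun x => x) (fun a => hE.eq_zero)

include hv hM in
theorem IsTameEtale.mem_closedBall (hE : IsTameEtale v ks E) {r : Additive Γ} {a : E} :
    a ∈ closedBall (extensions v E) r ↔ ∀ x : E →ₐ[k] maxTame v ks, wM (x a) ≤ radius r := by
  rw [hE.extensions_eq hv hM]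
  exact Set.forall_mem_range

variable [IsSepClosure k ks]

-- If x and y have the same reduction, the idempotent of E that cuts out the Galois orbit of x shows
-- that y = g x for some g. Cutting elements of E down by this idempotent makes their norm equal to
-- their value at x, so g acts trivially on the reduction of the field x(E), hence fixes it.
include hv hM in
theorem IsTameEtale.redAlgHom_injective (hE : IsTameEtale v ks E) :
    Function.Injective (redAlgHom v : (E →ₐ[k] maxTame v ks) → _) := by
  classical
  obtain ⟨w, hw⟩ := hv.exists_extensions_eq ks
  have hg : ∀ (g : Gal(maxTame v ks/k)) c, wM (g c) = wM c := fun g c =>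
    comap_eq_of_extensions_eq hM hM (g : maxTame v ks →ₐ[k] maxTame v ks) c
  intro x y hxy
  -- The norm of a is attained at x, so the class of a in degree |x a| is defined, and the equality
  -- of the reductions can be tested on it.
  have key : ∀ a : E, x a ≠ 0 → (∀ z : E →ₐ[k] maxTame v ks, wM (z a) ≤ wM (x a)) →
      wM (y a - x a) < wM (x a) := by
    intro a ha hz
    obtain ⟨r, hr⟩ := exists_radius_eq ((Valuation.ne_zero_iff wM).2 ha)
    have h1 : a ∈ closedBall (extensions v E) r :=
      (hE.mem_closedBall hv hM).2 fun z => (hz z).trans hr.ge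
    have h2 := DFunLike.congr_fun hxy (cls (extensions v E) r a)
    rw [redAlgHom_cls _ h1, redAlgHom_cls _ h1,
      cls_eq_iff (map_mem_closedBall x h1) (map_mem_closedBall y h1),
      mem_openBall_extensions hM, hr] at h2
    rwa [Valuation.map_sub_swap]
  let P : (E →ₐ[k] maxTame v ks) → Prop := fun z =>
    ∃ g : Gal(maxTame v ks/k), z = (g : maxTame v ks →ₐ[k] maxTame v ks).comp x
  have hP : ∀ (g : Gal(maxTame v ks/k)) z,
      P ((g : maxTame v ks →ₐ[k] maxTame v ks).comp z) ↔ P z := by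
    intro g z
    constructor
    · rintro ⟨h, hh⟩
      refine ⟨g⁻¹ * h, AlgHom.ext fun a => ?_⟩
      have h1 := DFunLike.congr_fun hh a
      change g (z a) = h (x a) at h1
      change z a = g.symm (h (x a))
      rw [← h1, AlgEquiv.symm_apply_apply]
    · rintro ⟨h, rfl⟩
      exact ⟨g * h, rfl⟩
  -- The characteristic function of the orbit of x is equivariant, hence is given by an element of
  -- E.
  obtain ⟨ε, hε⟩ := hE.exists_of_equivariant (fun z => if P z then 1 else 0) (by
    intro g z
    simp only [hP g z]
    split_ifs <;> simp)
  have hPx : P x := ⟨1, rfl⟩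
  obtain ⟨g, rfl⟩ : P y := by
    by_contra hy
    have h1 := key ε (by rw [hε, if_pos hPx]; exact one_ne_zero) (by
      intro z
      rw [hε, hε, if_pos hPx, map_one]
      split_ifs
      · exact (map_one wM).le
      · rw [map_zero]; exact zero_le)
    rw [hε, hε, if_pos hPx, if_neg hy, zero_sub, Valuation.map_neg] at h1
    exact lt_irrefl _ h1
  have := hE.finite
  have hx : x.range.IsAlgebraic := fun c _ => Algebra.IsAlgebraic.isAlgebraic c
  have h2 := eq_of_trivial_on_reduction hv hw hM hx.toIntermediateField g (by
    rintro _ ⟨a, rfl⟩ ha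
    have h3 : ∀ z, z (a * ε) = if P z then z a else 0 := fun z => by
      rw [map_mul, hε, mul_ite, mul_one, mul_zero]
    have hy : P ((g : maxTame v ks →ₐ[k] maxTame v ks).comp x) := ⟨g, rfl⟩
    have h4 := key (a * ε)
    rw [h3, h3, if_pos hPx, if_pos hy] at h4
    refine h4 ha fun z => ?_
    rw [h3]
    split_ifs with hz
    · obtain ⟨h, rfl⟩ := hz
      exact (hg h (x a)).le
    · rw [map_zero]; exact zero_le)
  refine AlgHom.ext fun a => ?_
  exact (h2 (x a) ⟨a, rfl⟩).symm

omit [Algebra k ks] [IsSepClosure k ks] in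
/-- A family whose reduction is linearly independent is linearly independent. -/
theorem linearIndependent_of_cls {ι : Type*} {a : ι → E} {d : ι → Additive Γ}
    (ha : ∀ i, a i ∈ closedBall (extensions v E) (d i))
    (hli : LinearIndependent (ResField v) fun i => cls (extensions v E) (d i) (a i)) :
    LinearIndependent k a := by
  rw [linearIndependent_iff']
  intro s c hc
  by_contra! hne
  obtain ⟨i, hi, hi0⟩ := hne
  -- The index m is that of a dominant term. Taking the class of c j in degree t + d m − d j, where
  -- t is the degree of c m, puts all the terms in the same degree and keeps the coefficient of
  -- index m nonzero.
  obtain ⟨m, hm, hmax⟩ := Finset.exists_max_image s (fun i => v (c i) * radius (d i)) ⟨i, hi⟩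
  have hpos : v (c m) ≠ 0 := by
    intro h0
    have h1 := hmax i hi
    rw [h0, zero_mul, le_zero_iff, mul_eq_zero] at h1
    exact h1.elim ((Valuation.ne_zero_iff v).2 hi0) (radius_ne_zero _)
  obtain ⟨t, ht⟩ := exists_radius_eq hpos
  have hle : ∀ j ∈ s, v (c j) ≤ radius (t + d m - d j) := by
    intro j hj
    have h1 := hmax j hj
    rw [← ht, ← radius_add, ← sub_add_cancel (t + d m) (d j), radius_add] at h1
    exact le_of_mul_le_mul_right h1 (radius_pos _)
  have h2 : ∑ j ∈ s, cls {v} (t + d m - d j) (c j) • cls (extensions v E) (d j) (a j) = 0 := by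
    rw [← cls_zero (S := extensions v E) (r := t + d m), ← hc, cls_sum]
    · refine Finset.sum_congr rfl fun j hj => ?_
      rw [Algebra.smul_def, cls_algebraMap (hle j hj), ← cls_mul _ (ha j), sub_add_cancel,
        Algebra.smul_def]
      intro w hw
      rw [← hw.comap_eq] at hle
      exact hle j hj
    · intro j hj w hw
      have h3 : w (algebraMap k E (c j)) ≤ radius (t + d m - d j) := by
        have := hle j hj
        rwa [← hw.comap_eq] at this
      have h4 := mul_le_mul' h3 (ha j w hw)
      rwa [← radius_add, sub_add_cancel, ← map_mul, ← Algebra.smul_def] at h4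
  have h5 := linearIndependent_iff'.1 hli s _ h2 m hm
  have h6 : cls {v} (t + d m - d m) (c m) = 0 := h5
  rw [cls_eq_zero_iff (mem_closedBall_singleton.2 (hle m hm)), mem_openBall_singleton,
    add_sub_cancel_right, ht] at h6
  exact lt_irrefl _ h6

include hv in
/-- The reduction of a tame algebra has the dimension of the algebra. -/
theorem IsTameEtale.exists_homogeneous_basis (hE : IsTameEtale v ks E) :
    ∃ (J : Type u) (_ : Fintype J) (d : J → Additive Γ)
      (b : Module.Basis J (ResField v) (GRed (extensions v E))),
        (∀ j, b j ∈ redDeg (extensions v E) (d j)) ∧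
        Nonempty ((E →ₐ[k] maxTame v ks) ≃ J) := by
  obtain ⟨wM, hM⟩ := hv.exists_extensions_eq (maxTame v ks)
  have := hE.finite
  have hX := hE.finite_algHom
  have hR : IsGradedField (resDeg v) := isGradedField_redDeg v
  have hn := hR.nontrivial
  obtain ⟨J, d, b, hb⟩ := hR.exists_homogeneous_basis
    ((red v).obj (CommAlgCat.of k E)).algebraMap_mem
  change Module.Basis J (ResField v) (GRed (extensions v E)) at b
  choose a ha hab using fun j => exists_cls_of_mem (hb j)
  have hli : LinearIndependent k a := linearIndependent_of_cls (v := v) ha (by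
    have h1 : (fun i => cls (extensions v E) (d i) (a i)) = b := funext hab
    rw [h1]
    exact b.linearIndependent)
  have hJ : Finite J := hli.finite
  let _ : Fintype J := Fintype.ofFinite J
  let _ : Fintype (E →ₐ[k] maxTame v ks) := Fintype.ofFinite _
  have hD := isGradedField_redMaxTame hv ks
  have hdom : IsDomain (GRed (extensions v (maxTame v ks))) := hD.isDomain
  -- Dedekind's bound, applied to the distinct reductions of the points, gives |Hom(E, M)| ≤ |J|.
  -- The lifts of the basis are independent over k, so |J| ≤ dim E = |Hom(E, M)|.
  refine ⟨J, inferInstance, d, b, hb, ⟨Fintype.equivOfCardEq (le_antisymm ?_ ?_)⟩⟩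
  · exact card_algHom_le b (hE.redAlgHom_injective hv hM)
  · rw [← Nat.card_eq_fintype_card (α := E →ₐ[k] maxTame v ks), hE.card_algHom]
    exact hli.fintype_card_le_finrank

include hv in
theorem IsTameEtale.bijective_evalAll_redAlgHom (hE : IsTameEtale v ks E) :
    Function.Bijective (evalAll fun x : E →ₐ[k] maxTame v ks => redAlgHom v x) := by
  obtain ⟨wM, hM⟩ := hv.exists_extensions_eq (maxTame v ks)
  obtain ⟨J, _, d, b, hb, ⟨e⟩⟩ := hE.exists_homogeneous_basis hv
  exact bijective_evalAll_of_homogeneous (D := redMaxTame v ks)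
    (B := (red v).obj (CommAlgCat.of k E)) (isGradedField_redMaxTame hv ks) b hb
    (hE.redAlgHom_injective hv hM) (fun x γ a ha => redAlgHom_mem x ha) e

include hv in
/-- The morphisms from a tame algebra to `M` are the morphisms between their reductions. -/
theorem IsTameEtale.bijective_redAlgHom (hE : IsTameEtale v ks E) :
    Function.Bijective (redAlgHom v : (E →ₐ[k] maxTame v ks) → _) := by
  obtain ⟨wM, hM⟩ := hv.exists_extensions_eq (maxTame v ks)
  obtain ⟨J, _, d, b, hb, ⟨e⟩⟩ := hE.exists_homogeneous_basis hv
  have hD := isGradedField_redMaxTame hv ks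
  have hdom : IsDomain (GRed (extensions v (maxTame v ks))) := hD.isDomain
  have hfin : Finite (GRed (extensions v E) →ₐ[ResField v] GRed (extensions v (maxTame v ks))) :=
    finite_algHom_of_basis b
  have hX := hE.finite_algHom
  let _ : Fintype (GRed (extensions v E) →ₐ[ResField v] GRed (extensions v (maxTame v ks))) :=
    Fintype.ofFinite _
  let _ : Fintype (E →ₐ[k] maxTame v ks) := Fintype.ofFinite _
  have hinj := hE.redAlgHom_injective hv hM
  refine (Fintype.bijective_iff_injective_and_card _).2
    ⟨hinj, le_antisymm (Fintype.card_le_of_injective _ hinj) ?_⟩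
  rw [Fintype.card_congr e]
  exact card_algHom_le b (φ := id) Function.injective_id

-- The reduction of E is split by that of M, hence unramified after a faithfully flat base change,
-- hence unramified.
include hv in
theorem IsTameEtale.etaleGr (hE : IsTameEtale v ks E) :
    etaleGr (resDeg v) ((red v).obj (CommAlgCat.of k E)) := by
  obtain ⟨J, _, d, b, hb, -⟩ := hE.exists_homogeneous_basis hv
  have hD : IsGradedField (redDeg (extensions v (maxTame v ks))) := isGradedField_redMaxTame hv ks
  have hff : Module.FaithfullyFlat (ResField v) (GRed (extensions v (maxTame v ks))) :=
    (isGradedField_redDeg v).faithfullyFlat hD (redMaxTame v ks).algebraMap_mem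
  have hX := hE.finite_algHom
  let e := AlgEquiv.ofBijective _ (hE.bijective_evalAll_redAlgHom hv)
  have h1 : Algebra.FormallyUnramified (GRed (extensions v (maxTame v ks)))
      ((E →ₐ[k] maxTame v ks) → GRed (extensions v (maxTame v ks))) :=
    (Algebra.FormallyUnramified.pi_iff _).2 fun _ => inferInstance
  have h2 := Algebra.FormallyUnramified.of_equiv e.symm
  have h3 : Algebra.FormallyUnramified (ResField v) (GRed (extensions v E)) :=
    Algebra.FormallyUnramified.of_formallyUnramified_tensorProduct_of_faithfullyFlat
      (GRed (extensions v (maxTame v ks)))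
  exact ⟨Module.Finite.of_basis b, h3.1⟩

end Tame

end GradedRamification

end

noncomputable section

namespace GradedRamification

/-! ### From finite Galois sets to tame algebras -/

section Construction

variable {Γ : Type u} [CommGroup Γ] [LinearOrder Γ] [IsOrderedMonoid Γ]
  {k : Type u} [Field k] (v : Valuation k (WithZero Γ))
  (ks : Type u) [Field ks] [Algebra k ks]

variable {ks} in
/-- An algebra with as many morphisms to `M` as its dimension is tame. -/
theorem isTameEtale_of_injective {E : Type u} [CommRing E] [Algebra k E] {J : Type*} [Fintype J]
    (b : Module.Basis J k E) {φ : J → (E →ₐ[k] maxTame v ks)} (hφ : Function.Injective φ) :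
    IsTameEtale v ks E := by
  classical
  have hbij : Function.Bijective (evalAll φ) :=
    bijective_evalAll b (det_ne_zero_of_injective b hφ).isUnit
  let e := AlgEquiv.ofBijective _ hbij
  have h1 : Algebra.FormallyUnramified (maxTame v ks) (J → maxTame v ks) :=
    (Algebra.FormallyUnramified.pi_iff _).2 fun _ => inferInstance
  have h2 := Algebra.FormallyUnramified.of_equiv e.symm
  have h3 : Algebra.FormallyUnramified k E :=
    Algebra.FormallyUnramified.of_formallyUnramified_tensorProduct_of_faithfullyFlat (maxTame v ks)
  have h4 : Module.Finite k E := Module.Finite.of_basis b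
  have h5 : Algebra.FormallyEtale k E := Algebra.FormallyEtale.iff_formallyUnramified_of_field.2 h3
  have h6 : Algebra.FinitePresentation k E :=
    Algebra.FinitePresentation.of_finiteType.1 inferInstance
  exact ⟨⟨h5, h6⟩, Fintype.card J,
    ⟨e.trans (AlgEquiv.piCongrLeft (maxTame v ks) (fun _ => maxTame v ks) (Fintype.equivFin J))⟩⟩

variable [IsSepClosure k ks]

theorem card_algHom_maxTame (F : IntermediateField k (maxTame v ks)) [FiniteDimensional k F] :
    Nat.card (F →ₐ[k] maxTame v ks) = Module.finrank k F := by
  refine AlgHom.natCard_of_splits k F (maxTame v ks) fun x => ?_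
  rw [← minpoly.algebraMap_eq (algebraMap F (maxTame v ks)).injective x]
  exact Normal.splits inferInstance _

/-- M is normal over k, so isomorphisms between its subfields extend to M. -/
theorem exists_algEquiv_comp_val (F : IntermediateField k (maxTame v ks))
    (h : F →ₐ[k] maxTame v ks) : ∃ g : Gal(maxTame v ks/k),
      (g : maxTame v ks →ₐ[k] maxTame v ks).comp F.val = h := by
  let χ : F ≃ₐ[k] h.fieldRange := AlgEquiv.ofInjectiveField h
  exact ⟨χ.liftNormal (maxTame v ks), AlgHom.ext (χ.liftNormal_commutes (maxTame v ks))⟩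

theorem isTameEtale_intermediateField (F : IntermediateField k (maxTame v ks))
    [FiniteDimensional k F] : IsTameEtale v ks F := by
  have h1 : Finite (F →ₐ[k] maxTame v ks) := inferInstance
  let _ : Fintype (F →ₐ[k] maxTame v ks) := Fintype.ofFinite _
  let s : Fin (Module.finrank k F) ≃ (F →ₐ[k] maxTame v ks) := Fintype.equivOfCardEq (by
    rw [Fintype.card_fin, ← card_algHom_maxTame v ks F, Nat.card_eq_fintype_card])
  exact isTameEtale_of_injective v (Module.finBasis k F) s.injective

/-- A finite set with open stabilizers is the set of morphisms from a tame algebra to `M`. -/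
theorem exists_tame_of_mulAction {X : Type u} [Finite X] [MulAction Gal(maxTame v ks/k) X]
    (hX : ∀ x : X, IsOpen (MulAction.stabilizer Gal(maxTame v ks/k) x : Set Gal(maxTame v ks/k))) :
    ∃ (E : Type u) (_ : CommRing E) (_ : Algebra k E), IsTameEtale v ks E ∧
      ∃ e : X ≃ (E →ₐ[k] maxTame v ks), ∀ (g : Gal(maxTame v ks/k)) x a,
        e (g • x) a = g (e x a) := by
  classical
  let Ω := MulAction.orbitRel.Quotient Gal(maxTame v ks/k) X
  -- E is the product, over the orbits, of the fixed fields of the stabilizers of chosen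
  -- representatives. Open stabilizers make these fields finite over k, with the stabilizers as
  -- fixing groups.
  let F : Ω → IntermediateField k (maxTame v ks) := fun ω =>
    IntermediateField.fixedField (MulAction.stabilizer Gal(maxTame v ks/k) ω.out)
  have hfix : ∀ ω, (F ω).fixingSubgroup = MulAction.stabilizer Gal(maxTame v ks/k) ω.out :=
    fun ω => InfiniteGalois.fixingSubgroup_fixedField
      ⟨MulAction.stabilizer Gal(maxTame v ks/k) ω.out, Subgroup.isClosed_of_isOpen _ (hX _)⟩
  have hfin : ∀ ω, FiniteDimensional k (F ω) := fun ω =>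
    (InfiniteGalois.isOpen_iff_finite (F ω)).1 (by
      have h1 := hX ω.out
      rw [← hfix] at h1
      exact h1)
  let _ : Fintype Ω := Fintype.ofFinite Ω
  have hHom : ∀ ω, Finite (F ω →ₐ[k] maxTame v ks) := fun ω => inferInstance
  let _ : ∀ ω, Fintype (F ω →ₐ[k] maxTame v ks) := fun ω => Fintype.ofFinite _
  let ψ : (Σ ω, (F ω →ₐ[k] maxTame v ks)) → ((∀ ω, F ω) →ₐ[k] maxTame v ks) := fun s =>
    s.2.comp (Pi.evalAlgHom k (fun ω => F ω) s.1)
  have hψ : Function.Injective ψ := by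
    rintro ⟨ω, h⟩ ⟨ω', h'⟩ heq
    have h1 : ω = ω' := by
      by_contra hne
      have h2 := DFunLike.congr_fun heq (Pi.single ω 1)
      simp only [ψ, AlgHom.comp_apply, Pi.evalAlgHom_apply, Pi.single_eq_same, map_one] at h2
      rw [Pi.single_eq_of_ne (Ne.symm hne), map_zero] at h2
      exact one_ne_zero h2
    subst h1
    congr 1
    refine AlgHom.ext fun x => ?_
    have h2 := DFunLike.congr_fun heq (Pi.single ω x)
    simpa [ψ] using h2
  have hcard : Fintype.card (Σ ω, (F ω →ₐ[k] maxTame v ks)) = Module.finrank k (∀ ω, F ω) := by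
    rw [Fintype.card_sigma, Module.finrank_pi_fintype]
    refine Finset.sum_congr rfl fun ω _ => ?_
    rw [← Nat.card_eq_fintype_card, card_algHom_maxTame]
  let b := Module.finBasis k (∀ ω, F ω)
  let s : Fin (Module.finrank k (∀ ω, F ω)) ≃ (Σ ω, (F ω →ₐ[k] maxTame v ks)) :=
    Fintype.equivOfCardEq (by rw [hcard, Fintype.card_fin])
  have htame : IsTameEtale v ks (∀ ω, F ω) :=
    isTameEtale_of_injective v b (hψ.comp s.injective)
  have hfinHom := htame.finite_algHom
  let _ : Fintype ((∀ ω, F ω) →ₐ[k] maxTame v ks) := Fintype.ofFinite _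
  -- By counting, every morphism from the product to M factors through one of the factors.
  have hψb : Function.Bijective ψ := (Fintype.bijective_iff_injective_and_card ψ).2 ⟨hψ, by
    rw [hcard, ← htame.card_algHom, Nat.card_eq_fintype_card]⟩
  have hout : ∀ x : X, ∃ g : Gal(maxTame v ks/k),
      g • (Quotient.mk'' x : Ω).out = x := fun x => by
    let S : Setoid X := MulAction.orbitRel Gal(maxTame v ks/k) X
    exact S.symm (Quotient.mk_out (s := S) x)
  choose γ hγ using hout
  -- A point written γ x • (representative) goes to the restriction of γ x to the fixed field; by
  -- `hres` below, the choice of γ x does not matter.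
  let Φ : X → (Σ ω, (F ω →ₐ[k] maxTame v ks)) := fun x =>
    ⟨Quotient.mk'' x, (γ x : maxTame v ks →ₐ[k] maxTame v ks).comp (F (Quotient.mk'' x)).val⟩
  have hmk : ∀ (g : Gal(maxTame v ks/k)) (ω : Ω), (Quotient.mk'' (g • ω.out) : Ω) = ω := by
    intro g ω
    conv_rhs => rw [← Quotient.out_eq' ω]
    exact Quotient.sound' ⟨g, rfl⟩
  have hres : ∀ (g h : Gal(maxTame v ks/k)) (ω : Ω), g • ω.out = h • ω.out ↔
      (g : maxTame v ks →ₐ[k] maxTame v ks).comp (F ω).val =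
        (h : maxTame v ks →ₐ[k] maxTame v ks).comp (F ω).val := by
    intro g h ω
    rw [← inv_smul_eq_iff, smul_smul, ← MulAction.mem_stabilizer_iff, ← hfix,
      IntermediateField.mem_fixingSubgroup_iff]
    constructor
    · intro h1
      refine AlgHom.ext fun x => ?_
      have h2 := congrArg h (h1 x x.2)
      change h (h.symm (g x)) = h x at h2
      rwa [AlgEquiv.apply_symm_apply] at h2
    · intro h1 x hx
      have h2 := DFunLike.congr_fun h1 ⟨x, hx⟩
      change g x = h x at h2
      change h.symm (g x) = x
      rw [h2, AlgEquiv.symm_apply_apply]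
  have hΦ : ∀ (g : Gal(maxTame v ks/k)) (ω : Ω), Φ (g • ω.out) =
      ⟨ω, (g : maxTame v ks →ₐ[k] maxTame v ks).comp (F ω).val⟩ := by
    intro g ω
    have key : ∀ (ω' : Ω) (hω : ω' = ω) (g' : Gal(maxTame v ks/k)), g' • ω'.out = g • ω.out →
        (⟨ω', (g' : maxTame v ks →ₐ[k] maxTame v ks).comp (F ω').val⟩ :
          Σ ω, (F ω →ₐ[k] maxTame v ks)) =
        ⟨ω, (g : maxTame v ks →ₐ[k] maxTame v ks).comp (F ω).val⟩ := by
      rintro ω' rfl g' h1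
      rw [(hres g' g ω').1 h1]
    exact key _ (hmk g ω) _ (hγ _)
  have hΦb : Function.Bijective Φ := by
    constructor
    · intro x y hxy
      obtain ⟨g, ω, rfl⟩ : ∃ g : Gal(maxTame v ks/k), ∃ ω : Ω, g • ω.out = x := ⟨_, _, hγ x⟩
      obtain ⟨h, ω', rfl⟩ : ∃ g : Gal(maxTame v ks/k), ∃ ω : Ω, g • ω.out = y := ⟨_, _, hγ y⟩
      rw [hΦ, hΦ] at hxy
      obtain ⟨rfl, h2⟩ := Sigma.mk.inj_iff.1 hxy
      exact (hres g h ω).2 (eq_of_heq h2)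
    · rintro ⟨ω, h⟩
      obtain ⟨g, hg⟩ := exists_algEquiv_comp_val v ks (F ω) h
      exact ⟨g • ω.out, by rw [hΦ, hg]⟩
  refine ⟨∀ ω, F ω, inferInstance, inferInstance, htame,
    (Equiv.ofBijective Φ hΦb).trans (Equiv.ofBijective ψ hψb), ?_⟩
  intro g x a
  obtain ⟨h, ω, rfl⟩ : ∃ g : Gal(maxTame v ks/k), ∃ ω : Ω, g • ω.out = x := ⟨_, _, hγ x⟩
  change ψ (Φ (g • h • ω.out)) a = g (ψ (Φ (h • ω.out)) a)
  rw [smul_smul, hΦ, hΦ]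
  rfl

end Construction

/-! ### Galois invariants of the reduction of M -/

section Invariants

/-- If a takes the same value d at all points, then 1 ⊗ a = d ⊗ 1. Comparing a coordinate where 1
has an invertible coefficient puts d in the image of R. -/
theorem exists_of_forall_algHom_eq {R D B X J : Type*} [CommRing R] [CommRing D] [Algebra R D]
    [CommRing B] [Algebra R B] [Fintype J] (b : Module.Basis J R B) {φ : X → (B →ₐ[R] D)}
    (hφ : Function.Injective (evalAll φ)) {a : B} {d : D} (had : ∀ x, φ x a = d)
    (h1 : ∃ j, IsUnit (b.repr 1 j)) : ∃ r, algebraMap R D r = d := by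
  obtain ⟨j, hj⟩ := h1
  obtain ⟨c, hc⟩ := hj.exists_right_inv
  have h2 : (1 : D) ⊗ₜ[R] a = d ⊗ₜ 1 := by
    refine hφ (funext fun x => ?_)
    rw [evalAll_tmul, evalAll_tmul, had, map_one, one_mul, mul_one]
  have h3 := congrArg (fun t => (b.baseChange D).repr t j) h2
  simp only [Module.Basis.baseChange_repr_tmul, Algebra.smul_def, mul_one] at h3
  refine ⟨b.repr a j * c, ?_⟩
  rw [map_mul, h3, mul_right_comm, ← map_mul, hc, map_one, one_mul]

variable {Γ : Type u} [CommGroup Γ] [LinearOrder Γ] [IsOrderedMonoid Γ]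

theorem algebraMap_mem_redDeg {k : Type u} [CommRing k] (v : Valuation k (WithZero Γ))
    (A : Type u) [CommRing A] [Algebra k A] {γ : Additive Γ} {x : ResField v}
    (hx : x ∈ resDeg v γ) :
    algebraMap (ResField v) (GRed (extensions v A)) x ∈ redDeg (extensions v A) γ :=
  redMap_mem _ _ γ x hx

variable {k : Type u} [Field k] {v : Valuation k (WithZero Γ)} (hv : Henselian v)
  {ks : Type u} [Field ks] [Algebra k ks] [IsSepClosure k ks]

include hv in
/-- The invariants of the Galois group in the reduction of `M` are the reduction of `k`. -/
theorem exists_algebraMap_eq_of_fixed (d : GRed (extensions v (maxTame v ks)))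
    (hd : ∀ g : Gal(maxTame v ks/k),
      redAlgHom v (g : maxTame v ks →ₐ[k] maxTame v ks) d = d) :
    ∃ r, algebraMap (ResField v) (GRed (extensions v (maxTame v ks))) r = d := by
  obtain ⟨wM, hM⟩ := hv.exists_extensions_eq (maxTame v ks)
  have hD : IsGradedField (redDeg (extensions v (maxTame v ks))) := isGradedField_redMaxTame hv ks
  have hn := hD.nontrivial
  have hom : ∀ γ, ∀ d ∈ redDeg (extensions v (maxTame v ks)) γ,
      (∀ g : Gal(maxTame v ks/k), redAlgHom v (g : maxTame v ks →ₐ[k] maxTame v ks) d = d) →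
      ∃ r, algebraMap (ResField v) (GRed (extensions v (maxTame v ks))) r = d := by
    intro γ d hdγ hd
    obtain ⟨a, ha, rfl⟩ := exists_cls_of_mem hdγ
    -- The points of the tame field k(a) in M are restrictions of Galois automorphisms, so they all
    -- send the class of a to the invariant element.
    let F := IntermediateField.adjoin k {a}
    have hF : FiniteDimensional k F := IntermediateField.adjoin.finiteDimensional
      (Algebra.IsIntegral.isIntegral a)
    have htame : IsTameEtale v ks F := isTameEtale_intermediateField v ks F
    obtain ⟨wF, hwF⟩ := hv.exists_extensions_eq F
    let a' : F := ⟨a, IntermediateField.mem_adjoin_simple_self k a⟩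
    have ha' : a' ∈ closedBall (extensions v F) γ := by
      rw [mem_closedBall_extensions hwF, ← comap_eq_of_extensions_eq hwF hM F.val]
      exact (mem_closedBall_extensions hM).1 ha
    obtain ⟨J, _, δ, b, hb, -⟩ := htame.exists_homogeneous_basis hv
    refine exists_of_forall_algHom_eq b (htame.bijective_evalAll_redAlgHom hv).1
      (a := cls (extensions v F) γ a') ?_ ?_
    · intro x
      obtain ⟨g, rfl⟩ := exists_algEquiv_comp_val v ks F x
      rw [redAlgHom_cls _ ha', ← hd g, redAlgHom_cls _ ha]
      rfl
    · obtain ⟨j, hj⟩ : ∃ j, b.repr 1 j ≠ 0 := by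
        by_contra! h0
        have h1 : (1 : GRed (extensions v F)) = 0 :=
          b.repr.injective (Finsupp.ext fun j => by rw [h0, map_zero]; rfl)
        have h2 := congrArg (redAlgHom v F.val) h1
        rw [map_one, map_zero] at h2
        exact one_ne_zero h2
      exact ⟨j, (isGradedField_redDeg v).isUnit (repr_mem_of_mem b
        (𝓑 := redDeg (extensions v F)) (fun γ x hx => algebraMap_mem_redDeg v F hx) hb
        (SetLike.one_mem_graded _) j) hj⟩
  -- The Galois action preserves degrees, so the components of an invariant element are invariant.
  have hproj : ∀ γ, ∃ r, algebraMap (ResField v) (GRed (extensions v (maxTame v ks))) r =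
      GradedRing.proj (redDeg (extensions v (maxTame v ks))) γ d := fun γ =>
    hom γ _ (proj_mem (redDeg (extensions v (maxTame v ks))) γ d) fun g => by
      conv_rhs => rw [← hd g]
      exact (proj_map (redDeg (extensions v (maxTame v ks)))
        (redDeg (extensions v (maxTame v ks))) (redAlgHom v (g : maxTame v ks →ₐ[k] maxTame v ks)).toAddMonoidHom
        (fun γ x hx => redAlgHom_mem _ hx) γ d).symm
  classical
  have hsum := DirectSum.sum_support_decompose (redDeg (extensions v (maxTame v ks))) d
  choose r hr using hproj
  refine ⟨∑ i ∈ (DirectSum.decompose (redDeg (extensions v (maxTame v ks))) d).support, r i, ?_⟩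
  rw [map_sum, ← hsum]
  refine Finset.sum_congr ?_ fun i _ => ?_
  · rw [hsum]
  · rw [hr, GradedRing.proj_apply]

end Invariants

end GradedRamification

end

noncomputable section

namespace GradedRamification

/-! ### Galois descent of morphisms and the equivalences of categories -/

section Descent

variable {R D B B' X J : Type*} [CommRing R] [CommRing D] [Algebra R D] [CommRing B] [Algebra R B]
  [CommRing B'] [Algebra R B'] [Fintype J]

/-- Galois descent of morphisms. -/
theorem exists_algHom_of_equivariant (b : Module.Basis J R B)
    (hinj : Function.Injective (algebraMap R D)) {φ : X → (B →ₐ[R] D)}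
    (hφ : Function.Bijective (evalAll φ)) {G : Type*} (ρ : G → (D →ₐ[R] D))
    (hinv : ∀ d, (∀ g, ρ g d = d) → ∃ r, algebraMap R D r = d) (act : G → X → X)
    (hsurj : ∀ g, Function.Surjective (act g)) (hact : ∀ g x a, φ (act g x) a = ρ g (φ x a))
    (f : X → (B' →ₐ[R] D)) (hf : ∀ g x a, f (act g x) a = ρ g (f x a)) :
    ∃ h : B' →ₐ[R] B, ∀ x a, φ x (h a) = f x a := by
  choose h hh using fun a => exists_of_equivariant b hφ ρ hinv act hsurj hact
    (fun x => f x a) (fun g x => hf g x a)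
  have hext : ∀ {a a' : B}, (∀ x, φ x a = φ x a') → a = a' := eq_of_forall_algHom_eq b hinj hφ
  refine ⟨{ toFun := h, map_one' := ?_, map_mul' := ?_, map_zero' := ?_, map_add' := ?_,
            commutes' := ?_ }, fun x a => hh a x⟩
  · exact hext fun x => by rw [hh, map_one, map_one]
  · exact fun a a' => hext fun x => by rw [hh, map_mul, map_mul, hh, hh]
  · exact hext fun x => by rw [hh, map_zero, map_zero]
  · exact fun a a' => hext fun x => by rw [hh, map_add, map_add, hh, hh]
  · exact fun r => hext fun x => by rw [hh, AlgHom.commutes, AlgHom.commutes]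

end Descent

section HomAction

variable {𝒞 : Type*} [Category.{u} 𝒞] {G : Type u} [Group G] (X : 𝒞) (ρ : G →* End X)

variable {X ρ} in
theorem homAction_hom_ext {Y Z : 𝒞ᵒᵖ} {f g : (homAction X ρ).obj Y ⟶ (homAction X ρ).obj Z}
    (h : ∀ x : Y.unop ⟶ X, (f.hom x : Z.unop ⟶ X) = g.hom x) : f = g :=
  Action.Hom.ext (TypeCat.homEquiv.injective (funext h))

variable {X ρ} in
theorem homAction_hom_comm {Y Z : 𝒞ᵒᵖ} (f : (homAction X ρ).obj Y ⟶ (homAction X ρ).obj Z) (g : G)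
    (x : Y.unop ⟶ X) :
    (f.hom (x ≫ End.asHom (ρ g) : Y.unop ⟶ X) : Z.unop ⟶ X) =
      (f.hom x : Z.unop ⟶ X) ≫ End.asHom (ρ g) :=
  ConcreteCategory.congr_hom (f.comm g) x

theorem faithful_homAction_of {P : ObjectProperty 𝒞}
    (h : ∀ {Y Z : 𝒞}, P Y → P Z → ∀ f g : Z ⟶ Y, (∀ x : Y ⟶ X, f ≫ x = g ≫ x) → f = g) :
    (P.ι.op ⋙ homAction X ρ).Faithful where
  map_injective {Y Z} φ ψ hφψ := by
    refine Quiver.Hom.unop_inj (ObjectProperty.hom_ext _ ?_)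
    refine h Y.unop.property Z.unop.property _ _ fun x => ?_
    exact congrArg (fun f : (homAction X ρ).obj (Opposite.op Y.unop.obj) ⟶
      (homAction X ρ).obj (Opposite.op Z.unop.obj) => (f.hom x : Z.unop.obj ⟶ X)) hφψ

theorem full_homAction_of {P : ObjectProperty 𝒞}
    (h : ∀ {Y Z : 𝒞}, P Y → P Z → ∀ F : (Y ⟶ X) → (Z ⟶ X),
      (∀ g x, F (x ≫ End.asHom (ρ g)) = F x ≫ End.asHom (ρ g)) →
        ∃ f : Z ⟶ Y, ∀ x, f ≫ x = F x) :
    (P.ι.op ⋙ homAction X ρ).Full where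
  map_surjective {Y Z} f := by
    obtain ⟨h, hh⟩ := h Y.unop.property Z.unop.property
      (fun x => ((f : (homAction X ρ).obj (Opposite.op Y.unop.obj) ⟶
        (homAction X ρ).obj (Opposite.op Z.unop.obj)).hom x : Z.unop.obj ⟶ X))
      (fun g x => homAction_hom_comm (X := X) (ρ := ρ) f g x)
    exact ⟨(ObjectProperty.homMk h).op, homAction_hom_ext hh⟩

end HomAction

section Functors

variable {Γ : Type u} [CommGroup Γ] [LinearOrder Γ] [IsOrderedMonoid Γ]
  {k : Type u} [Field k] (v : Valuation k (WithZero Γ))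
  (ks : Type u) [Field ks] [Algebra k ks]

/-- The functor `E ↦ Hom(E, M)`. -/
abbrev homTame : ((tameEtale v ks).FullSubcategory)ᵒᵖ ⥤ Action (Type u) Gal(maxTame v ks/k) :=
  (tameEtale v ks).ι.op ⋙ homAction (CommAlgCat.of k (maxTame v ks)) (galEnd k (maxTame v ks))

theorem faithful_homTame : (homTame v ks).Faithful :=
  faithful_homAction_of _ _ fun {Y Z} hY hZ f g h => by
    refine CommAlgCat.hom_ext (AlgHom.ext fun a => ?_)
    rw [← sub_eq_zero]
    refine IsTameEtale.eq_zero hY fun x => ?_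
    rw [map_sub, sub_eq_zero]
    exact DFunLike.congr_fun (congrArg CommAlgCat.Hom.hom (h (CommAlgCat.ofHom x))) a

theorem full_homTame [IsSepClosure k ks] : (homTame v ks).Full :=
  full_homAction_of _ _ fun {Y Z} hY hZ F hF => by
    have hY : IsTameEtale v ks Y := hY
    have := hY.finite
    obtain ⟨h, hh⟩ := exists_algHom_of_equivariant (Module.finBasis k Y)
      (FaithfulSMul.algebraMap_injective k (maxTame v ks)) hY.bijective_evalAll
      (fun g : Gal(maxTame v ks/k) => (g : maxTame v ks →ₐ[k] maxTame v ks))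
      (fun d hd => (InfiniteGalois.mem_range_algebraMap_iff_fixed d).2 hd)
      (fun g x => (g : maxTame v ks →ₐ[k] maxTame v ks).comp x)
      (fun g x => ⟨(g.symm : maxTame v ks →ₐ[k] maxTame v ks).comp x,
        AlgHom.ext fun a => g.apply_symm_apply (x a)⟩) (fun g x a => rfl)
      (fun x => (F (CommAlgCat.ofHom x)).hom)
      (fun g x a => DFunLike.congr_fun (congrArg CommAlgCat.Hom.hom (hF g (CommAlgCat.ofHom x))) a)
    exact ⟨CommAlgCat.ofHom h, fun x => CommAlgCat.hom_ext (AlgHom.ext fun a => hh x.hom a)⟩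

theorem isOpen_of_fixingSubgroup_le {K L : Type*} [Field K] [Field L] [Algebra K L]
    {S : Set Gal(L/K)} (hmul : ∀ g ∈ S, ∀ h ∈ S, g * h ∈ S) (hinv : ∀ g ∈ S, g⁻¹ ∈ S)
    (F : IntermediateField K L) [FiniteDimensional K F] (hF : ∀ g ∈ F.fixingSubgroup, g ∈ S) :
    IsOpen S :=
  Subgroup.isOpen_mono (H₁ := F.fixingSubgroup)
    (H₂ := { carrier := S, mul_mem' := fun hg hh => hmul _ hg _ hh,
             one_mem' := hF 1 (one_mem _), inv_mem' := fun hg => hinv _ hg }) hF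
    F.fixingSubgroup_isOpen

theorem isOpen_stabilizer_of_fixingSubgroup_le {K L : Type u} [Field K] [Field L] [Algebra K L]
    {X : Action (Type u) Gal(L/K)} (x : X.V) (F : IntermediateField K L) [FiniteDimensional K F]
    (hF : ∀ g ∈ F.fixingSubgroup, X.ρ g x = x) : IsOpen {g : Gal(L/K) | X.ρ g x = x} := by
  refine isOpen_of_fixingSubgroup_le ?_ ?_ F hF
  · intro g hg h hh
    change X.ρ (g * h) x = x
    rw [map_mul]
    change X.ρ g (X.ρ h x) = x
    rw [hh, hg]
  · intro g hg
    change X.ρ g⁻¹ x = x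
    conv_lhs => rw [← (show X.ρ g x = x from hg)]
    exact Action.ρ_inv_self_apply g x

theorem finDiscrete_homTame [IsSepClosure k ks] (E : ((tameEtale v ks).FullSubcategory)ᵒᵖ) :
    finDiscrete Gal(maxTame v ks/k) ((homTame v ks).obj E) := by
  have hE : IsTameEtale v ks E.unop.obj := E.unop.property
  have hfin := hE.finite
  have hX := hE.finite_algHom
  refine ⟨Finite.of_injective (fun f : E.unop.obj ⟶ CommAlgCat.of k (maxTame v ks) => f.hom)
    fun f g h => CommAlgCat.hom_ext h, fun (x : E.unop.obj ⟶ CommAlgCat.of k (maxTame v ks)) => ?_⟩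
  let b := Module.finBasis k E.unop.obj
  -- A point is determined by the images of a finite basis, so the open subgroup that fixes the
  -- finite extension they generate stabilizes it.
  let F := IntermediateField.adjoin k (Set.range fun j => x.hom (b j))
  have hF : FiniteDimensional k F := IntermediateField.finiteDimensional_adjoin
    fun y _ => Algebra.IsIntegral.isIntegral y
  refine isOpen_stabilizer_of_fixingSubgroup_le (X := (homTame v ks).obj E) x F fun g hg => ?_
  refine CommAlgCat.hom_ext ?_
  change (g : maxTame v ks →ₐ[k] maxTame v ks).comp x.hom = x.hom
  refine AlgHom.toLinearMap_injective (b.ext fun j => ?_)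
  exact (IntermediateField.mem_fixingSubgroup_iff _ _).1 hg _
    (IntermediateField.subset_adjoin k _ ⟨j, rfl⟩)

/-- The set underlying an object of `Action (Type u) G`, with its action of `G`. -/
abbrev mulActionOfAction {G : Type u} [Group G] (X : Action (Type u) G) : MulAction G X.V where
  smul g x := X.ρ g x
  one_smul x := by
    change X.ρ 1 x = x
    rw [map_one]
    rfl
  mul_smul g h x := by
    change X.ρ (g * h) x = X.ρ g (X.ρ h x)
    rw [map_mul]
    rfl

theorem isEquivalence_lift_homTame [IsSepClosure k ks]
    (h : ∀ E, finDiscrete Gal(maxTame v ks/k) ((homTame v ks).obj E)) :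
    ((finDiscrete Gal(maxTame v ks/k)).lift (homTame v ks) h).IsEquivalence := by
  have := faithful_homTame v ks
  have := full_homTame v ks
  have hess : ((finDiscrete Gal(maxTame v ks/k)).lift (homTame v ks) h).EssSurj := by
    refine ⟨fun X => ?_⟩
    let _ : MulAction Gal(maxTame v ks/k) X.obj.V := mulActionOfAction X.obj
    have hfin : Finite X.obj.V := X.property.1
    obtain ⟨E, _, _, hE, e, he⟩ := exists_tame_of_mulAction v ks (X := X.obj.V) X.property.2
    let e' : (CommAlgCat.of k E ⟶ CommAlgCat.of k (maxTame v ks)) ≃ X.obj.V :=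
      { toFun := fun f => e.symm f.hom
        invFun := fun x => CommAlgCat.ofHom (e x)
        left_inv := fun f => CommAlgCat.hom_ext (e.apply_symm_apply f.hom)
        right_inv := fun x => e.symm_apply_apply x }
    refine ⟨Opposite.op ⟨CommAlgCat.of k E, hE⟩, ⟨ObjectProperty.isoMk _
      (Action.mkIso (Equiv.toIso e') fun g => ?_)⟩⟩
    refine TypeCat.homEquiv.injective
      (funext fun (f : CommAlgCat.of k E ⟶ CommAlgCat.of k (maxTame v ks)) => ?_)
    change e.symm ((g : maxTame v ks →ₐ[k] maxTame v ks).comp f.hom) = g • e.symm f.hom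
    rw [Equiv.symm_apply_eq]
    refine AlgHom.ext fun a => ?_
    rw [he, Equiv.apply_symm_apply]
    rfl
  exact ⟨inferInstance, inferInstance, hess⟩

/-! ### Graded algebras -/

/-- The functor `B ↦ Hom(B, M̃)`. -/
abbrev homEtaleGr : ((etaleGr (resDeg v)).FullSubcategory)ᵒᵖ ⥤ Action (Type u) Gal(maxTame v ks/k) :=
  (etaleGr (resDeg v)).ι.op ⋙ homAction (redMaxTame v ks) (galRed v (maxTame v ks))

variable {v} (hv : Henselian v) [IsSepClosure k ks]

-- The degree-preserving morphisms found by the splitting theorem already reach Dedekind's bound.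
-- Hence all algebra morphisms to the reduction of M are graded, and there are as many as the rank.
include hv in
theorem bijective_evalAll_of_etaleGr {B : GrAlg (ResField v) (resDeg v)}
    (hB : etaleGr (resDeg v) B) :
    ∃ (J : Type u) (_ : Fintype J) (d : J → Additive Γ)
      (b : Module.Basis J (ResField v) B.carrier), (∀ j, b j ∈ B.deg (d j)) ∧
      Nonempty ((B ⟶ redMaxTame v ks) ≃ J) ∧
      Function.Bijective (evalAll fun x : B ⟶ redMaxTame v ks => x.toAlgHom) := by
  have hD := isGradedField_redMaxTame hv ks
  have hdom : IsDomain (redMaxTame v ks).carrier := hD.isDomain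
  obtain ⟨J, _, d, b, φ, hb, hφ, hdeg⟩ := exists_algHom_redMaxTame hv ks hB
  have hfin : Finite (B.carrier →ₐ[ResField v] (redMaxTame v ks).carrier) :=
    finite_algHom_of_basis b
  let _ : Fintype (B.carrier →ₐ[ResField v] (redMaxTame v ks).carrier) := Fintype.ofFinite _
  have hφb : Function.Bijective φ := (Fintype.bijective_iff_injective_and_card φ).2
    ⟨hφ, le_antisymm (Fintype.card_le_of_injective φ hφ)
      (card_algHom_le b (φ := id) Function.injective_id)⟩
  let Φ : J → (B ⟶ redMaxTame v ks) := fun j => ⟨φ j, hdeg j⟩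
  have hΦ : Function.Bijective Φ := by
    refine ⟨fun i j hij => hφ (congrArg GrAlg.Hom.toAlgHom hij), fun x => ?_⟩
    obtain ⟨j, hj⟩ := hφb.2 x.toAlgHom
    exact ⟨j, GrAlg.Hom.ext hj⟩
  let e := (Equiv.ofBijective Φ hΦ).symm
  exact ⟨J, inferInstance, d, b, hb, ⟨e⟩, bijective_evalAll_of_homogeneous hD b hb
    (fun x y hxy => GrAlg.Hom.ext hxy) (fun x => x.map_mem) e⟩

include hv in
theorem algebraMap_redMaxTame_injective :
    Function.Injective (algebraMap (ResField v) (redMaxTame v ks).carrier) := by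
  have hff : Module.FaithfullyFlat (ResField v) (redMaxTame v ks).carrier :=
    (isGradedField_redDeg v).faithfullyFlat (isGradedField_redMaxTame hv ks)
      (redMaxTame v ks).algebraMap_mem
  exact FaithfulSMul.algebraMap_injective _ _

include hv in
theorem faithful_homEtaleGr : (homEtaleGr v ks).Faithful :=
  faithful_homAction_of _ _ fun {Y Z} hY hZ f g h => by
    obtain ⟨J, _, d, b, hb, -, hbij⟩ := bijective_evalAll_of_etaleGr ks hv hY
    refine GrAlg.Hom.ext (AlgHom.ext fun a => ?_)
    refine eq_of_forall_algHom_eq b (algebraMap_redMaxTame_injective ks hv) hbij fun x => ?_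
    exact DFunLike.congr_fun (congrArg GrAlg.Hom.toAlgHom (h x)) a

include hv in
theorem full_homEtaleGr : (homEtaleGr v ks).Full :=
  full_homAction_of _ _ fun {Y Z} hY hZ F hF => by
    obtain ⟨J, _, d, b, hb, -, hbij⟩ := bijective_evalAll_of_etaleGr ks hv hY
    have hinj := algebraMap_redMaxTame_injective ks hv
    obtain ⟨h, hh⟩ := exists_algHom_of_equivariant (B' := Z.carrier) b hinj hbij
      (fun g : Gal(maxTame v ks/k) => (galRed v (maxTame v ks) g).toAlgHom)
      (exists_algebraMap_eq_of_fixed hv)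
      (fun g x => x ≫ End.asHom (galRed v (maxTame v ks) g))
      (fun g x => ⟨x ≫ End.asHom (galRed v (maxTame v ks) g⁻¹), by
        refine (Category.assoc _ _ _).trans ?_
        have h1 : End.asHom (galRed v (maxTame v ks) g⁻¹) ≫
            End.asHom (galRed v (maxTame v ks) g) = 𝟙 (redMaxTame v ks) := by
          change (galRed v (maxTame v ks) g) * (galRed v (maxTame v ks) g⁻¹) = 1
          rw [← map_mul, mul_inv_cancel, map_one]
        rw [h1]
        exact Category.comp_id x⟩) (fun g x a => rfl)
      (fun x => (F x).toAlgHom)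
      (fun g x a => DFunLike.congr_fun (congrArg GrAlg.Hom.toAlgHom (hF g x)) a)
    refine ⟨⟨h, fun γ a ha => ?_⟩, fun x => GrAlg.Hom.ext (AlgHom.ext fun a => hh x a)⟩
    -- Descent provides only an algebra morphism. Its degree is checked through the points of Y,
    -- which preserve degrees and separate elements.
    refine mem_of_proj_eq_zero Y.deg fun δ hδ => ?_
    refine eq_of_forall_algHom_eq b hinj hbij fun x => ?_
    have h1 := proj_map Y.deg (redMaxTame v ks).deg x.toAlgHom.toAddMonoidHom x.map_mem δ (h a)
    change _ = x.toAlgHom (GradedRing.proj Y.deg δ (h a)) at h1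
    rw [← h1, map_zero]
    change GradedRing.proj (redMaxTame v ks).deg δ (x.toAlgHom (h a)) = 0
    rw [hh]
    exact proj_of_mem_ne _ ((F x).map_mem γ a ha) hδ.symm

include hv in
theorem finDiscrete_homEtaleGr (A : ((etaleGr (resDeg v)).FullSubcategory)ᵒᵖ) :
    finDiscrete Gal(maxTame v ks/k) ((homEtaleGr v ks).obj A) := by
  obtain ⟨J, _, d, b, hb, ⟨e⟩, -⟩ := bijective_evalAll_of_etaleGr ks hv A.unop.property
  refine ⟨Finite.of_equiv J e.symm, fun (x : A.unop.obj ⟶ redMaxTame v ks) => ?_⟩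
  have h1 : ∀ j, ∃ a ∈ closedBall (extensions v (maxTame v ks)) (d j),
      cls (extensions v (maxTame v ks)) (d j) a = x.toAlgHom (b j) := fun j =>
    exists_cls_of_mem (x.map_mem _ _ (hb j))
  choose a ha hab using h1
  -- Automorphisms fixing lifts to M of the images of a basis fix the images themselves, and
  -- finitely many lifts generate a finite extension.
  let F := IntermediateField.adjoin k (Set.range a)
  have hF : FiniteDimensional k F := IntermediateField.finiteDimensional_adjoin
    fun y _ => Algebra.IsIntegral.isIntegral y
  refine isOpen_stabilizer_of_fixingSubgroup_le (X := (homEtaleGr v ks).obj A) x F fun g hg => ?_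
  refine GrAlg.Hom.ext (AlgHom.toLinearMap_injective (b.ext fun j => ?_))
  change redAlgHom v (g : maxTame v ks →ₐ[k] maxTame v ks) (x.toAlgHom (b j)) = x.toAlgHom (b j)
  rw [← hab, redAlgHom_cls _ (ha j)]
  exact congrArg (cls _ _) ((IntermediateField.mem_fixingSubgroup_iff _ _).1 hg _
    (IntermediateField.subset_adjoin k _ ⟨j, rfl⟩))

include hv in
/-- The morphisms from a tame algebra to `M` are the morphisms between their reductions. -/
theorem isIso_homActionMap {E : CommAlgCat.{u} k} (hE : tameEtale v ks E) :
    IsIso ((homActionMap (red v) (CommAlgCat.of k (maxTame v ks))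
      (galEnd k (maxTame v ks))).app (Opposite.op E)) := by
  have hE : IsTameEtale v ks E := hE
  have h1 := hE.bijective_redAlgHom hv
  have h2 : Function.Bijective (fun f : E ⟶ CommAlgCat.of k (maxTame v ks) =>
      ((red v).map f : (red v).obj E ⟶ redMaxTame v ks)) := by
    constructor
    · intro f g hfg
      exact CommAlgCat.hom_ext (h1.1 (congrArg GrAlg.Hom.toAlgHom hfg))
    · intro y
      obtain ⟨x, hx⟩ := h1.2 y.toAlgHom
      exact ⟨CommAlgCat.ofHom x, GrAlg.Hom.ext hx⟩
  have h3 : IsIso ((homActionMap (red v) (CommAlgCat.of k (maxTame v ks))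
      (galEnd k (maxTame v ks))).app (Opposite.op E)).hom := (isIso_iff_bijective _).2 h2
  exact Action.isIso_of_hom_isIso _

include hv in
theorem etaleGr_red (E : (tameEtale v ks).FullSubcategory) :
    etaleGr (resDeg v) (((tameEtale v ks).ι ⋙ red v).obj E) :=
  IsTameEtale.etaleGr hv (show IsTameEtale v ks E.obj from E.property)

/-- The compatibility between the two functors to finite sets with an action. -/
def homTameIso (h : ∀ E, etaleGr (resDeg v) (((tameEtale v ks).ι ⋙ red v).obj E))
    (h₁ : ∀ E, finDiscrete Gal(maxTame v ks/k) ((homTame v ks).obj E))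
    (h₂ : ∀ E, finDiscrete Gal(maxTame v ks/k) ((homEtaleGr v ks).obj E)) :
    (finDiscrete Gal(maxTame v ks/k)).lift (homTame v ks) h₁ ≅
      ((etaleGr (resDeg v)).lift ((tameEtale v ks).ι ⋙ red v) h).op ⋙
        (finDiscrete Gal(maxTame v ks/k)).lift (homEtaleGr v ks) h₂ :=
  NatIso.ofComponents (fun E => ObjectProperty.isoMk _
    (@asIso _ _ _ _ ((homActionMap (red v) (CommAlgCat.of k (maxTame v ks))
      (galEnd k (maxTame v ks))).app (Opposite.op E.unop.obj))
      (isIso_homActionMap ks hv E.unop.property))) (fun f =>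
    ObjectProperty.hom_ext _ ((homActionMap (red v) (CommAlgCat.of k (maxTame v ks))
      (galEnd k (maxTame v ks))).naturality f.unop.hom.op))

include hv in
theorem isEquivalence_lift_homEtaleGr
    (h₂ : ∀ E, finDiscrete Gal(maxTame v ks/k) ((homEtaleGr v ks).obj E)) :
    ((finDiscrete Gal(maxTame v ks/k)).lift (homEtaleGr v ks) h₂).IsEquivalence := by
  have := faithful_homEtaleGr ks hv
  have := full_homEtaleGr ks hv
  have hess : ((finDiscrete Gal(maxTame v ks/k)).lift (homEtaleGr v ks) h₂).EssSurj := by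
    refine ⟨fun X => ?_⟩
    have h1 := isEquivalence_lift_homTame v ks (finDiscrete_homTame v ks)
    -- A finite Galois set is already Hom(E, M) for a tame E, hence also the set of points of the
    -- reduction of E.
    let α := homTameIso ks hv (etaleGr_red ks hv) (finDiscrete_homTame v ks) h₂
    exact ⟨_, ⟨(α.app _).symm ≪≫ Functor.objObjPreimageIso
      ((finDiscrete Gal(maxTame v ks/k)).lift (homTame v ks) (finDiscrete_homTame v ks)) X⟩⟩
  exact ⟨inferInstance, inferInstance, hess⟩

-- The functor of points of tame algebras is isomorphic to the reduction followed by that of graded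
-- algebras. Both functors of points are equivalences, so the reduction is one.
include hv in
theorem isEquivalence_lift_red
    (h : ∀ E, etaleGr (resDeg v) (((tameEtale v ks).ι ⋙ red v).obj E)) :
    ((etaleGr (resDeg v)).lift ((tameEtale v ks).ι ⋙ red v) h).IsEquivalence := by
  have h1 := isEquivalence_lift_homTame v ks (finDiscrete_homTame v ks)
  have h2 := isEquivalence_lift_homEtaleGr ks hv (finDiscrete_homEtaleGr ks hv)
  have h3 := Functor.isEquivalence_of_iso
    (homTameIso ks hv h (finDiscrete_homTame v ks) (finDiscrete_homEtaleGr ks hv))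
  have h4 : ((etaleGr (resDeg v)).lift ((tameEtale v ks).ι ⋙ red v) h).op.IsEquivalence :=
    Functor.isEquivalence_of_comp_right _
      ((finDiscrete Gal(maxTame v ks/k)).lift (homEtaleGr v ks) (finDiscrete_homEtaleGr ks hv))
  exact ((etaleGr (resDeg v)).lift ((tameEtale v ks).ι ⋙ red v) h).op.asEquivalence.unop.isEquivalence_functor

end Functors

end GradedRamification

end

noncomputable section

namespace GradedRamification

/-! ### Extension of scalars -/

section Determinant

variable {Γ : Type u} [CommGroup Γ] [LinearOrder Γ]

/-- Each Leibniz term uses every row and every column once. This form, with degrees on both sides,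
serves for the transition matrix between homogeneous families. -/
theorem det_mem_graded_sub {R : Type u} [CommRing R] {𝓡 : Additive Γ → AddSubgroup R}
    [GradedRing 𝓡] {ι : Type*} [Fintype ι] [DecidableEq ι] (m : Matrix ι ι R)
    (d d' : ι → Additive Γ) (hm : ∀ i j, m i j ∈ 𝓡 (d j - d' i)) :
    m.det ∈ 𝓡 (∑ j, d j - ∑ i, d' i) := by
  rw [Matrix.det_apply]
  refine sum_mem fun σ _ => ?_
  rw [Units.smul_def]
  refine zsmul_mem ?_ _
  have h1 := prod_mem_graded (𝓡 := 𝓡) Finset.univ (fun i => m (σ i) i) (fun i => d i - d' (σ i))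
    (fun i _ => hm _ _)
  rwa [Finset.sum_sub_distrib, Equiv.sum_comp σ d'] at h1

end Determinant

section BaseChange

variable {Γ : Type u} [CommGroup Γ] [LinearOrder Γ] [IsOrderedMonoid Γ]
  {k : Type u} [Field k] {v : Valuation k (WithZero Γ)} (hv : Henselian v)
  (ks : Type u) [Field ks] [Algebra k ks]
  {K : Type u} [Field K] [Algebra k K] (vK : Valuation K (WithZero Γ)) [hK : Extends v vK]
  (hvK : Henselian vK) (Ks : Type u) [Field Ks] [Algebra K Ks] [Algebra k Ks] [IsScalarTower k K Ks]

include hK in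
theorem extensions_subset_of_tower {A : Type u} [CommRing A] [Algebra k A] [Algebra K A]
    [IsScalarTower k K A] : extensions vK A ⊆ extensions v A := fun w hw =>
  ⟨by rw [IsScalarTower.algebraMap_eq k K A, Valuation.comap_comp, hw.comap_eq, hK.comap_eq]⟩

variable [IsSepClosure k ks] [IsSepClosure K Ks]

include hv hvK in
/-- The maximal tame extension of `k` embeds in that of a henselian extension `K` of `k`. -/
theorem exists_algHom_maxTame : Nonempty (maxTame v ks →ₐ[k] maxTame vK Ks) := by
  have hsep : Algebra.IsSeparable k ks := IsSepClosure.separable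
  have hscK : IsSepClosed Ks := IsSepClosure.sep_closed K
  obtain ⟨w, hw⟩ := hv.exists_extensions_eq ks
  obtain ⟨wK, hwK⟩ := hvK.exists_extensions_eq Ks
  let j : ks →ₐ[k] Ks := IsSepClosed.lift
  have hj : ∀ x, wK (j x) = w x := fun x => by
    have h1 : wK.comap (j : ks →+* Ks) ∈ extensions v ks :=
      comap_mem_extensions j _ (extensions_subset_of_tower vK (hwK.symm.subset rfl))
    rw [hw] at h1
    exact DFunLike.congr_fun h1 x
  let _ : Algebra ks Ks := j.toAlgebra
  have htower : IsScalarTower k ks Ks := IsScalarTower.of_algebraMap_eq fun x => (j.commutes x).symm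
  have hmem : ∀ x ∈ maxTame v ks, j x ∈ maxTame vK Ks := by
    intro x hx
    refine (IntermediateField.mem_fixedField_iff _ _).2 fun σ hσ => ?_
    -- Since j is isometric, an inertia element σ over K restricts to an inertia element τ over k;
    -- so τ fixes M and σ fixes j(M).
    let τ : Gal(ks/k) := (σ.restrictScalars k).restrictNormal ks
    have hτ : ∀ y, j (τ y) = σ (j y) := (σ.restrictScalars k).restrictNormal_commutes ks
    have h1 : τ ∈ sepInertia v ks := (mem_sepInertia_iff hv hw τ).2 fun y hy => by
      rw [← hj, ← hj, map_sub, hτ]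
      exact (mem_sepInertia_iff hvK hwK σ).1 hσ _ (by simpa using hy)
    have h2 : τ x = x := (IntermediateField.mem_fixedField_iff _ _).1 hx τ h1
    rw [← hτ, h2]
  exact ⟨(j.comp (maxTame v ks).val).codRestrict
    ((maxTame vK Ks).toSubalgebra.restrictScalars k) fun x => hmem x x.2⟩

variable {ks Ks} {E : Type u} [CommRing E] [Algebra k E]

/-- The morphism `K ⊗ E → M_K` given by a morphism `E → M`. -/
def baseChangeHom (i : maxTame v ks →ₐ[k] maxTame vK Ks) (x : E →ₐ[k] maxTame v ks) :
    K ⊗[k] E →ₐ[K] maxTame vK Ks :=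
  Algebra.TensorProduct.lift (Algebra.ofId K _) (i.comp x) fun _ _ => Commute.all _ _

omit [IsSepClosure k ks] [IsSepClosure K Ks] hK in
theorem baseChangeHom_one_tmul (i : maxTame v ks →ₐ[k] maxTame vK Ks)
    (x : E →ₐ[k] maxTame v ks) (a : E) : baseChangeHom vK i x (1 ⊗ₜ a) = i (x a) := by
  simp [baseChangeHom]

omit [IsSepClosure k ks] [IsSepClosure K Ks] hK in
theorem baseChangeHom_injective (i : maxTame v ks →ₐ[k] maxTame vK Ks) :
    Function.Injective (baseChangeHom (E := E) vK i) := fun x y hxy => AlgHom.ext fun a =>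
  (i : maxTame v ks →+* maxTame vK Ks).injective (by
    have h1 := DFunLike.congr_fun hxy (1 ⊗ₜ a)
    rwa [baseChangeHom_one_tmul, baseChangeHom_one_tmul] at h1)

include hv hvK in
theorem IsTameEtale.baseChange (hE : IsTameEtale v ks E) : IsTameEtale vK Ks (K ⊗[k] E) := by
  obtain ⟨i⟩ := exists_algHom_maxTame hv ks vK hvK Ks
  have hfin := hE.finite
  have hX := hE.finite_algHom
  let _ : Fintype (E →ₐ[k] maxTame v ks) := Fintype.ofFinite _
  let s : Fin (Module.finrank k E) ≃ (E →ₐ[k] maxTame v ks) := Fintype.equivOfCardEq (by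
    rw [Fintype.card_fin, ← hE.card_algHom, Nat.card_eq_fintype_card])
  exact isTameEtale_of_injective vK ((Module.finBasis k E).baseChange K)
    ((baseChangeHom_injective vK i).comp s.injective)

omit [IsSepClosure k ks] [IsSepClosure K Ks] [Algebra k Ks] [IsScalarTower k K Ks] in
theorem redBaseChange_cls {r : Additive Γ} {a : E} (ha : a ∈ closedBall (extensions v E) r) :
    redBaseChange v vK E (cls (extensions v E) r a) =
      cls (extensions vK (K ⊗[k] E)) r (1 ⊗ₜ a) :=
  redMap_cls _ _ ha

omit [IsSepClosure k ks] [IsSepClosure K Ks] [Algebra k Ks] [IsScalarTower k K Ks] in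
theorem redBaseChange_mem {r : Additive Γ} {x : GRed (extensions v E)}
    (hx : x ∈ redDeg (extensions v E) r) :
    redBaseChange v vK E x ∈ redDeg (extensions vK (K ⊗[k] E)) r :=
  redMap_mem _ _ r x hx

theorem redBaseChange_algebraMap (x : ResField v) :
    redBaseChange v vK E (algebraMap (ResField v) (GRed (extensions v E)) x) =
      algebraMap (ResField vK) (GRed (extensions vK (K ⊗[k] E)))
        (algebraMap (ResField v) (ResField vK) x) := by
  have h : (redBaseChange v vK E).comp (algebraMap (ResField v) (GRed (extensions v E))) =
      (algebraMap (ResField vK) (GRed (extensions vK (K ⊗[k] E)))).comp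
        (algebraMap (ResField v) (ResField vK)) := by
    refine GRed.ringHom_ext_cls fun r a ha => ?_
    have ha' : v a ≤ radius r := mem_closedBall_singleton.1 ha
    have haK : vK (algebraMap k K a) ≤ radius r := by rwa [hK.apply]
    have h1 : algebraMap (ResField v) (ResField vK) (cls {v} r a) =
        cls {vK} r (algebraMap k K a) := redMap_cls _ _ ha
    have h2 : algebraMap k E a ∈ closedBall (extensions v E) r := fun w hw => by
      rwa [hw.apply]
    rw [RingHom.comp_apply, RingHom.comp_apply, h1, cls_algebraMap ha', redBaseChange_cls vK h2,
      cls_algebraMap haK]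
    congr 1
    rw [Algebra.TensorProduct.algebraMap_apply, Algebra.algebraMap_self_apply,
      Algebra.algebraMap_eq_smul_one, Algebra.algebraMap_eq_smul_one, TensorProduct.smul_tmul]
  exact DFunLike.congr_fun h x

/-- The determinant of the image in the reduction of `K ⊗ E` of a basis of the reduction of `E`. -/
theorem IsTameEtale.det_ne_zero (hv : Henselian v) (hvK : Henselian vK)
    (i : maxTame v ks →ₐ[k] maxTame vK Ks) (hE : IsTameEtale v ks E)
    {J : Type*} [Fintype J] [DecidableEq J] (b : Module.Basis J (ResField v) (GRed (extensions v E)))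
    (e : J ≃ (E →ₐ[k] maxTame v ks)) :
    (Matrix.of fun x j => redAlgHom vK (baseChangeHom vK i (e x))
      (redBaseChange v vK E (b j))).det ≠ 0 := by
  obtain ⟨wM, hM⟩ := hv.exists_extensions_eq (maxTame v ks)
  obtain ⟨wMK, hMK⟩ := hvK.exists_extensions_eq (maxTame vK Ks)
  have hi : ∀ x, wMK (i x) = wM x := fun x => by
    have h1 : wMK.comap (i : maxTame v ks →+* maxTame vK Ks) ∈ extensions v (maxTame v ks) :=
      comap_mem_extensions i _ (extensions_subset_of_tower vK (hMK.symm.subset rfl))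
    rw [hM] at h1
    exact DFunLike.congr_fun h1 x
  have hD : IsGradedField (redDeg (extensions vK (maxTame vK Ks))) :=
    isGradedField_redMaxTame hvK Ks
  have hdom : IsDomain (GRed (extensions vK (maxTame vK Ks))) := hD.isDomain
  let _ : Algebra (ResField v) (GRed (extensions vK (maxTame vK Ks))) :=
    ((algebraMap (ResField vK) (GRed (extensions vK (maxTame vK Ks)))).comp
      (algebraMap (ResField v) (ResField vK))).toAlgebra
  let φ : J → (GRed (extensions v E) →ₐ[ResField v] GRed (extensions vK (maxTame vK Ks))) :=
    fun x => { (redAlgHom vK (baseChangeHom vK i (e x)) : GRed (extensions vK (K ⊗[k] E)) →+*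
        GRed (extensions vK (maxTame vK Ks))).comp (redBaseChange v vK E) with
      commutes' := fun r => by
        change redAlgHom vK (baseChangeHom vK i (e x)) (redBaseChange v vK E
          (algebraMap (ResField v) (GRed (extensions v E)) r)) = _
        rw [redBaseChange_algebraMap, AlgHom.commutes]
        rfl }
  -- As i is isometric, points of E in M that have the same reduction after composition with i had
  -- the same reduction before, and then are equal.
  refine det_ne_zero_of_injective b (φ := φ) fun x y hxy => e.injective ?_
  refine hE.redAlgHom_injective hv hM (redAlgHom_ext fun r a ha => ?_)
  have h1 : redAlgHom vK (baseChangeHom vK i (e x))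
      (redBaseChange v vK E (cls (extensions v E) r a)) =
      redAlgHom vK (baseChangeHom vK i (e y)) (redBaseChange v vK E (cls (extensions v E) r a)) :=
    DFunLike.congr_fun hxy (cls (extensions v E) r a)
  have h2 : (1 : K) ⊗ₜ[k] a ∈ closedBall (extensions vK (K ⊗[k] E)) r := fun w hw =>
    ha _ (comap_includeRight_mem v vK w hw)
  rw [redBaseChange_cls vK ha, redAlgHom_cls _ h2, redAlgHom_cls _ h2,
    cls_eq_iff (map_mem_closedBall _ h2) (map_mem_closedBall _ h2), baseChangeHom_one_tmul,
    baseChangeHom_one_tmul, ← map_sub, mem_openBall_extensions hMK, hi] at h1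
  rw [redAlgHom_cls _ ha, redAlgHom_cls _ ha,
    cls_eq_iff (map_mem_closedBall _ ha) (map_mem_closedBall _ ha), mem_openBall_extensions hM]
  exact h1

include hv hvK in
/-- The reduction of a tame algebra commutes with extensions of scalars. -/
theorem IsTameEtale.exists_redBaseChange_equiv (hE : IsTameEtale v ks E)
    (hEK : IsTameEtale vK Ks (K ⊗[k] E)) :
    ∃ e : (ResField vK ⊗[ResField v] GRed (extensions v E)) ≃ₐ[ResField vK]
          GRed (extensions vK (K ⊗[k] E)),
        (∀ x : GRed (extensions v E), e (1 ⊗ₜ x) = redBaseChange v vK E x) ∧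
        ∀ (γ : Additive Γ) (t : ResField vK ⊗[ResField v] GRed (extensions v E)),
          t ∈ tensorDeg (resDeg vK) (redDeg (extensions v E)) γ ↔
            e t ∈ redDeg (extensions vK (K ⊗[k] E)) γ := by
  classical
  obtain ⟨i⟩ := exists_algHom_maxTame hv ks vK hvK Ks
  obtain ⟨J, _, d, b, hb, ⟨e⟩⟩ := hE.exists_homogeneous_basis hv
  obtain ⟨J', _, d', c', hc', ⟨e'⟩⟩ := hEK.exists_homogeneous_basis hvK
  have hfin := hE.finite
  have s : J' ≃ J := by
    refine Fintype.equivOfCardEq ?_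
    rw [← Nat.card_eq_fintype_card, ← Nat.card_eq_fintype_card, ← Nat.card_congr e,
      ← Nat.card_congr e', hE.card_algHom, hEK.card_algHom, Module.finrank_baseChange]
  let c := c'.reindex s
  have hc : ∀ j, c j ∈ redDeg (extensions vK (K ⊗[k] E)) (d' (s.symm j)) := fun j => by
    rw [Module.Basis.reindex_apply]
    exact hc' _
  let f : J → GRed (extensions vK (K ⊗[k] E)) := fun j => redBaseChange v vK E (b j)
  have hf : ∀ j, f j ∈ redDeg (extensions vK (K ⊗[k] E)) (d j) := fun j =>
    redBaseChange_mem vK (hb j)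
  -- Evaluation at the points of K ⊗ E writes the nonsingular matrix of `IsTameEtale.det_ne_zero` as
  -- a product whose second factor is the transition matrix from c to f.
  have hdet0 : c.det f ≠ 0 := by
    intro h0
    refine hE.det_ne_zero vK hv hvK i b e.symm ?_
    have h1 : (Matrix.of fun x j => redAlgHom vK (baseChangeHom vK i (e.symm x))
        (redBaseChange v vK E (b j))) =
        (Matrix.of fun x l => redAlgHom vK (baseChangeHom vK i (e.symm x)) (c l)) *
          (c.toMatrix f).map (algebraMap (ResField vK) (GRed (extensions vK (maxTame vK Ks)))) := by
      ext x j
      rw [Matrix.mul_apply, Matrix.of_apply]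
      change redAlgHom vK (baseChangeHom vK i (e.symm x)) (f j) = _
      conv_lhs => rw [← c.sum_repr (f j), map_sum]
      refine Finset.sum_congr rfl fun l _ => ?_
      rw [map_smul, Algebra.smul_def, mul_comm]
      rfl
    rw [h1, Matrix.det_mul]
    have h2 : (c.toMatrix f).det = 0 := h0
    have h3 := RingHom.map_det
      (algebraMap (ResField vK) (GRed (extensions vK (maxTame vK Ks)))) (c.toMatrix f)
    rw [h2, map_zero] at h3
    rw [← RingHom.mapMatrix_apply, ← h3, mul_zero]
  -- The determinant is also homogeneous, hence a unit: the natural map sends a basis to a basis.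
  have hdet : IsUnit (c.det f) := by
    refine (isGradedField_redDeg vK).isUnit
      (det_mem_graded_sub (𝓡 := resDeg vK) (c.toMatrix f) d (fun j => d' (s.symm j)) fun l j => ?_)
      hdet0
    exact repr_mem_of_mem c (𝓑 := redDeg (extensions vK (K ⊗[k] E)))
      (fun γ x hx => algebraMap_mem_redDeg vK _ hx) hc (hf j) l
  obtain ⟨hli, hsp⟩ := (Module.Basis.is_basis_iff_det c).2 hdet
  let f' := Module.Basis.mk hli hsp.ge
  let _ : Algebra (ResField v) (GRed (extensions vK (K ⊗[k] E))) :=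
    ((algebraMap (ResField vK) (GRed (extensions vK (K ⊗[k] E)))).comp
      (algebraMap (ResField v) (ResField vK))).toAlgebra
  have htower : IsScalarTower (ResField v) (ResField vK) (GRed (extensions vK (K ⊗[k] E))) :=
    IsScalarTower.of_algebraMap_eq fun _ => rfl
  let β : GRed (extensions v E) →ₐ[ResField v] GRed (extensions vK (K ⊗[k] E)) :=
    { redBaseChange v vK E with commutes' := redBaseChange_algebraMap vK }
  let m : ResField vK ⊗[ResField v] GRed (extensions v E) →ₐ[ResField vK]
      GRed (extensions vK (K ⊗[k] E)) :=
    Algebra.TensorProduct.lift (Algebra.ofId _ _) β fun _ _ => Commute.all _ _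
  have hm1 : ∀ x, m (1 ⊗ₜ x) = redBaseChange v vK E x := fun x => by
    refine (Algebra.TensorProduct.lift_tmul _ _ _ _ _).trans ?_
    rw [map_one, one_mul]
    rfl
  have hmt : ∀ r x, m (r ⊗ₜ x) =
      algebraMap (ResField vK) (GRed (extensions vK (K ⊗[k] E))) r * redBaseChange v vK E x :=
    fun r x => Algebra.TensorProduct.lift_tmul _ _ _ _ _
  have hmb : Function.Bijective m := by
    have h1 : m.toLinearMap =
        ((b.baseChange (ResField vK)).equiv f' (Equiv.refl J)).toLinearMap := by
      refine (b.baseChange (ResField vK)).ext fun j => ?_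
      rw [LinearEquiv.coe_coe, Module.Basis.equiv_apply, Module.Basis.baseChange_apply,
        Module.Basis.mk_apply]
      exact hm1 (b j)
    have h2 : (m : ResField vK ⊗[ResField v] GRed (extensions v E) →
        GRed (extensions vK (K ⊗[k] E))) =
        (b.baseChange (ResField vK)).equiv f' (Equiv.refl J) :=
      funext fun x => LinearMap.congr_fun h1 x
    rw [h2]
    exact LinearEquiv.bijective _
  refine ⟨AlgEquiv.ofBijective m hmb, hm1, fun γ t => ?_⟩
  have h1 := mem_tensorDeg_iff (resDeg vK) (redDeg (extensions v E))
    (redDeg (extensions vK (K ⊗[k] E))) (I := Unit) (fun _ => m.toAddMonoidHom)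
    (fun t ht => hmb.1 ((ht ()).trans (map_zero m).symm))
    (fun _ γ δ a ha x hx => by
      change m (a ⊗ₜ x) ∈ _
      rw [hmt]
      exact SetLike.mul_mem_graded (algebraMap_mem_redDeg vK _ ha) (redBaseChange_mem vK hx)) γ t
  exact h1.trans ⟨fun h => h (), fun h _ => h⟩

end BaseChange

end GradedRamification

end

open GradedRamification in
theorem mainTheorem9 {Γ : Type u} [CommGroup Γ] [LinearOrder Γ] [IsOrderedMonoid Γ]
    (hΓ : ∀ n : ℕ, n ≠ 0 → ∀ γ : Γ, ∃ δ : Γ, δ ^ n = γ)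
    {k : Type u} [Field k] (v : Valuation k (WithZero Γ)) (hv : Henselian v)
    (ks : Type u) [Field ks] [Algebra k ks] [IsSepClosure k ks] :
    -- every étale graded algebra is split by the reduction of the maximal tame extension
    (∀ B : GrAlg (ResField v) (resDeg v), etaleGr (resDeg v) B → SplitBy B (redMaxTame v ks)) ∧
    -- the reduction is an equivalence from tame étale algebras to étale graded algebras
    (∃ h : ∀ E : (tameEtale v ks).FullSubcategory,
        etaleGr (resDeg v) (((tameEtale v ks).ι ⋙ red v).obj E),
      ((etaleGr (resDeg v)).lift ((tameEtale v ks).ι ⋙ red v) h).IsEquivalence) ∧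
    -- `Gal(M/k)` is naturally isomorphic to the group `Π` of automorphisms of the reduction
    -- of the separable closure
    (∃ π : Gal(maxTame v ks/k) ≃* Aut ((red v).obj (CommAlgCat.of k ks)),
      ∀ (g : Gal(ks/k)) (h : Gal(maxTame v ks/k)),
        (∀ x : maxTame v ks, g (x : ks) = (h x : ks)) → (π h).hom = galRed v ks g) ∧
    -- `E ↦ Hom(E, M)` is an anti-equivalence from tame étale algebras to finite `Π`-sets
    (∃ h : ∀ E : ((tameEtale v ks).FullSubcategory)ᵒᵖ,
        finDiscrete Gal(maxTame v ks/k) (((tameEtale v ks).ι.op ⋙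
          homAction (CommAlgCat.of k (maxTame v ks)) (galEnd k (maxTame v ks))).obj E),
      ((finDiscrete Gal(maxTame v ks/k)).lift ((tameEtale v ks).ι.op ⋙
        homAction (CommAlgCat.of k (maxTame v ks)) (galEnd k (maxTame v ks))) h).IsEquivalence) ∧
    -- `A ↦ Hom(A, M̃)` is an anti-equivalence from étale graded algebras to finite `Π`-sets
    (∃ h : ∀ A : ((etaleGr (resDeg v)).FullSubcategory)ᵒᵖ,
        finDiscrete Gal(maxTame v ks/k) (((etaleGr (resDeg v)).ι.op ⋙
          homAction (redMaxTame v ks) (galRed v (maxTame v ks))).obj A),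
      ((finDiscrete Gal(maxTame v ks/k)).lift ((etaleGr (resDeg v)).ι.op ⋙
        homAction (redMaxTame v ks) (galRed v (maxTame v ks))) h).IsEquivalence) ∧
    -- these equivalences are compatible: `Hom(E, M) → Hom(Ẽ, M̃)` is an isomorphism of `Π`-sets
    (∀ E : CommAlgCat.{u} k, tameEtale v ks E →
      IsIso ((homActionMap (red v) (CommAlgCat.of k (maxTame v ks))
        (galEnd k (maxTame v ks))).app (Opposite.op E))) ∧
    -- compatibility with the extension of scalars to a henselian extension `K`
    (∀ (K : Type u) [Field K] [Algebra k K] (vK : Valuation K (WithZero Γ)) [Extends v vK]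
      (Ks : Type u) [Field Ks] [Algebra K Ks] [IsSepClosure K Ks]
      (E : Type u) [CommRing E] [Algebra k E],
      Henselian vK → IsTameEtale v ks E →
      IsTameEtale vK Ks (K ⊗[k] E) ∧
      ∃ e : (ResField vK ⊗[ResField v] GRed (extensions v E)) ≃ₐ[ResField vK]
          GRed (extensions vK (K ⊗[k] E)),
        (∀ x : GRed (extensions v E), e (1 ⊗ₜ x) = redBaseChange v vK E x) ∧
        ∀ (γ : Additive Γ) (t : ResField vK ⊗[ResField v] GRed (extensions v E)),
          t ∈ tensorDeg (resDeg vK) (redDeg (extensions v E)) γ ↔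
            e t ∈ redDeg (extensions vK (K ⊗[k] E)) γ) := by
  refine ⟨fun B hB => splitBy_redMaxTame hv ks hB,
    ⟨etaleGr_red ks hv, isEquivalence_lift_red ks hv _⟩,
    exists_galois_equiv_aut hv ks,
    ⟨finDiscrete_homTame v ks, isEquivalence_lift_homTame v ks _⟩,
    ⟨finDiscrete_homEtaleGr ks hv, isEquivalence_lift_homEtaleGr ks hv _⟩,
    fun E hE => isIso_homActionMap ks hv hE, ?_⟩
  intro K _ _ vK _ Ks _ _ _ E _ _ hvK hE
  let _ : Algebra k Ks := ((algebraMap K Ks).comp (algebraMap k K)).toAlgebra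
  have htower : IsScalarTower k K Ks := IsScalarTower.of_algebraMap_eq fun _ => rfl
  have hEK : IsTameEtale vK Ks (K ⊗[k] E) := hE.baseChange hv vK hvK
  exact ⟨hEK, hE.exists_redBaseChange_equiv hv vK hvK hEK⟩
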